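/- **Theorem.** Let $n\ge 0$ and $k\ge 2$ be integers, let $p\in\mathbb{C}$, and let $q\in\mathbb{C}$ be a primitive $k$-th root of unity. Let $B_m$ be the Coxeter group of permutations $w$ of $\{\pm1,\dots,\pm m\}$ with $w(-i)=-w(i)$, with simple reflections $t=(-1,1)$ and $s_i=(i,i+1)(-i,-(i+1))$ for $1\le i\le m-1$, and let $\ell$ be its length function. Let $H_{p,q}(B_m)$ be the Hecke algebra over $\mathbb{C}$ with generators $T_t,T_{s_1},\dots,T_{s_{m-1}}$, subject to the braid relations and the relations $(T_t-1)(T_t+p)=0$ and $(T_{s_i}-1)(T_{s_i}+q)=0$; write $T_w=T_{r_1}\cdots T_{r_l}$ for any reduced expression $w=r_1\cdots r_l$ in simple reflections. Regard $B_n\times S_k$ as the standard parabolic subgroup of $B_{n+k}$ generated by all simple reflections except $s_n$ (except $t$ if $n=0$), where $S_k$ is generated by $s_{n+1},\dots,s_{n+k-1}$, and let $H_q(S_k)\subset H_{p,q}(B_n\times S_k)\subset H_{p,q}(B_{n+k})$ be the corresponding Hecke algebras. Let $X_{n,k}$ be the set of distinguished right coset representatives of $B_n\times S_k$ in $B_{n+k}$,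 i.e. of the elements $x$ of minimal length in their coset $(B_n\times S_k)x$, and let $w_{n,k}$ be the element of maximal length in $X_{n,k}$. Let $\mathbb{C}_{\mathrm{triv}}=\mathbb{C}$ be the right $H_q(S_k)$-module on which every $T_w$ acts as $1$, and let $1_{\mathrm{triv}}=1\in\mathbb{C}_{\mathrm{triv}}$. Then there are unique coefficients $z_x\in H_{p,q}(B_n\times S_k)$, $x\in X_{n,k}$, such that $$T_{w_{n,k}}^2=\sum_{x\in X_{n,k}} z_x\,T_x ,$$ and $$1_{\mathrm{triv}}\otimes z_{w_{n,k}}=1_{\mathrm{triv}}\otimes\bigl(1+(-p)^k\bigr)T_1\quad\text{in}\quad \mathbb{C}_{\mathrm{triv}}\otimes_{H_q(S_k)}H_{p,q}(B_n\times S_k).$$ -/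

import Mathlib

open scoped TensorProduct

noncomputable section

namespace TypeBHecke

universe u v

/-! ### Iwahori–Hecke algebras by generators and relations -/

/-- The defining relations of the Hecke algebra of the Coxeter matrix `M` with parameters `q`:
the braid relations `T_i T_j T_i ⋯ = T_j T_i T_j ⋯` (`M i j` factors on each side) and the
quadratic relations `(T_i - 1) (T_i + q i) = 0`. -/
inductive HeckeRel {B : Type u} (M : CoxeterMatrix B) (q : B → ℂ) :
    FreeAlgebra ℂ B → FreeAlgebra ℂ B → Prop
  | braid (i j : B) (hij : i ≠ j) :
      HeckeRel M q
        (((CoxeterSystem.alternatingWord i j (M i j)).map (FreeAlgebra.ι ℂ)).prod)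
        (((CoxeterSystem.alternatingWord j i (M i j)).map (FreeAlgebra.ι ℂ)).prod)
  | quadratic (i : B) :
      HeckeRel M q
        ((FreeAlgebra.ι ℂ i - 1) * (FreeAlgebra.ι ℂ i + algebraMap ℂ (FreeAlgebra ℂ B) (q i))) 0

/-- The Hecke algebra `H_q(W)` of the Coxeter group `W` with Coxeter matrix `M`. -/
abbrev HeckeAlgebra {B : Type u} (M : CoxeterMatrix B) (q : B → ℂ) : Type u :=
  RingQuot (HeckeRel M q)

/-- The generator `T_i` attached to the simple reflection with index `i`. -/
def gen {B : Type u} (M : CoxeterMatrix B) (q : B → ℂ) (i : B) : HeckeAlgebra M q :=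
  RingQuot.mkAlgHom ℂ (HeckeRel M q) (FreeAlgebra.ι ℂ i)

theorem gen_braid {B : Type u} (M : CoxeterMatrix B) (q : B → ℂ) (i j : B) (hij : i ≠ j) :
    ((CoxeterSystem.alternatingWord i j (M i j)).map (gen M q)).prod =
      ((CoxeterSystem.alternatingWord j i (M i j)).map (gen M q)).prod := by
  have h := RingQuot.mkAlgHom_rel ℂ (HeckeRel.braid (M := M) (q := q) i j hij)
  rw [map_list_prod, map_list_prod, List.map_map, List.map_map] at h
  exact h

theorem gen_quadratic {B : Type u} (M : CoxeterMatrix B) (q : B → ℂ) (i : B) :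
    (gen M q i - 1) * (gen M q i + algebraMap ℂ (HeckeAlgebra M q) (q i)) = 0 := by
  have h := RingQuot.mkAlgHom_rel ℂ (HeckeRel.quadratic (M := M) (q := q) i)
  rw [map_mul, map_sub, map_add, map_one, map_zero, AlgHom.commutes] at h
  exact h

/-- The universal property of the Hecke algebra. -/
def lift {B : Type u} (M : CoxeterMatrix B) (q : B → ℂ) {A : Type v} [Ring A] [Algebra ℂ A]
    (f : B → A)
    (hbraid : ∀ i j, i ≠ j →
      ((CoxeterSystem.alternatingWord i j (M i j)).map f).prod =
        ((CoxeterSystem.alternatingWord j i (M i j)).map f).prod)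
    (hquad : ∀ i, (f i - 1) * (f i + algebraMap ℂ A (q i)) = 0) :
    HeckeAlgebra M q →ₐ[ℂ] A :=
  RingQuot.liftAlgHom ℂ ⟨FreeAlgebra.lift ℂ f, by
    intro x y h
    cases h with
    | braid i j hij =>
      rw [map_list_prod, map_list_prod, List.map_map, List.map_map, FreeAlgebra.ι_comp_lift]
      exact hbraid i j hij
    | quadratic i =>
      rw [map_mul, map_sub, map_add, map_one, map_zero, AlgHom.commutes, FreeAlgebra.lift_ι_apply]
      exact hquad i⟩

theorem lift_gen {B : Type u} (M : CoxeterMatrix B) (q : B → ℂ) {A : Type v} [Ring A]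
    [Algebra ℂ A] (f : B → A) (hbraid) (hquad) (i : B) :
    lift M q f hbraid hquad (gen M q i) = f i := by
  simp [lift, gen]

theorem map_alternatingWord {B : Type u} {B' : Type v} (f : B' → B) (i j : B') (m : ℕ) :
    (CoxeterSystem.alternatingWord i j m).map f =
      CoxeterSystem.alternatingWord (f i) (f j) m := by
  induction m generalizing i j with
  | zero => rfl
  | succ m ih => simp [CoxeterSystem.alternatingWord, ih]

/-- The Coxeter matrix of the standard parabolic subgroup with simple reflections indexed by `J`. -/
def parabolic {B : Type u} (M : CoxeterMatrix B) (J : Set B) : CoxeterMatrix J where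
  M := Matrix.of fun i j => M i j
  isSymm := by ext i j; exact M.symmetric j i
  diagonal i := M.diagonal i
  off_diagonal i j h := M.off_diagonal i j (Subtype.coe_injective.ne h)

/-- The Hecke algebra `H_q(W_J)` of the standard parabolic subgroup `W_J`, with the parameters
restricted from those of `H_q(W)`. -/
abbrev ParabolicHecke {B : Type u} (M : CoxeterMatrix B) (q : B → ℂ) (J : Set B) : Type u :=
  HeckeAlgebra (parabolic M J) (fun i => q i)

/-- The canonical homomorphism `H_q(W_J) → H_q(W)`, `T_i ↦ T_i`. -/
def parabolicIncl {B : Type u} (M : CoxeterMatrix B) (q : B → ℂ) (J : Set B) :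
    ParabolicHecke M q J →ₐ[ℂ] HeckeAlgebra M q :=
  lift _ _ (fun i => gen M q i)
    (by
      intro i j hij
      have h := gen_braid M q i j (Subtype.coe_injective.ne hij)
      rw [← map_alternatingWord, ← map_alternatingWord, List.map_map, List.map_map] at h
      exact h)
    (fun i => gen_quadratic M q i)

/-- The canonical homomorphism `H_q(W_K) → H_q(W_J)`, `T_i ↦ T_i`, for `K ⊆ J`. -/
def parabolicInclOfLE {B : Type u} (M : CoxeterMatrix B) (q : B → ℂ) {K J : Set B} (h : K ⊆ J) :
    ParabolicHecke M q K →ₐ[ℂ] ParabolicHecke M q J :=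
  lift _ _ (fun i => gen (parabolic M J) (fun i => q i) (Set.inclusion h i))
    (by
      intro i j hij
      have h' := gen_braid (parabolic M J) (fun i => q i) (Set.inclusion h i) (Set.inclusion h j)
        ((Set.inclusion_injective h).ne hij)
      rw [← map_alternatingWord, ← map_alternatingWord, List.map_map, List.map_map] at h'
      exact h')
    (fun i => gen_quadratic (parabolic M J) (fun i => q i) (Set.inclusion h i))

/-! ### The trivial module and tensor products over noncommutative rings -/

/-- The character of the Hecke algebra sending every generator `T_i`, hence every `T_w`, to `1`. -/
def trivChar {B : Type u} (M : CoxeterMatrix B) (q : B → ℂ) : HeckeAlgebra M q →ₐ[ℂ] ℂ :=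
  lift M q (fun _ => 1) (by intro i j _; simp) (by intro i; simp)

/-- The one-dimensional trivial module `ℂ_triv` of the Hecke algebra. -/
def TrivModule {B : Type u} (_M : CoxeterMatrix B) (_q : B → ℂ) : Type := ℂ

instance {B : Type u} (M : CoxeterMatrix B) (q : B → ℂ) : AddCommGroup (TrivModule M q) :=
  inferInstanceAs (AddCommGroup ℂ)

/-- `ℂ_triv` as a right module: `c · a = c * trivChar a`. -/
instance {B : Type u} (M : CoxeterMatrix B) (q : B → ℂ) :
    Module (HeckeAlgebra M q)ᵐᵒᵖ (TrivModule M q) :=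
  Module.compHom ℂ ((trivChar M q).toRingHom.fromOpposite fun _ _ => mul_comm _ _)

/-- The element `1 ∈ ℂ_triv`. -/
def oneTriv {B : Type u} (M : CoxeterMatrix B) (q : B → ℂ) : TrivModule M q := (1 : ℂ)

/-- The relations `x a ⊗ y - x ⊗ a y` imposed on `X ⊗_ℤ Y` to form `X ⊗_A Y`. -/
def balancedRelations (A X Y : Type*) [Ring A] [AddCommGroup X] [Module Aᵐᵒᵖ X]
    [AddCommGroup Y] [Module A Y] : Submodule ℤ (X ⊗[ℤ] Y) :=
  Submodule.span ℤ
    {z | ∃ (x : X) (a : A) (y : Y), z = (MulOpposite.op a • x) ⊗ₜ[ℤ] y - x ⊗ₜ[ℤ] (a • y)}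

/-- The tensor product `X ⊗_A Y` of a right module `X` and a left module `Y` over a not necessarily
commutative ring `A`. -/
abbrev BalancedTensor (A X Y : Type*) [Ring A] [AddCommGroup X] [Module Aᵐᵒᵖ X]
    [AddCommGroup Y] [Module A Y] : Type _ :=
  (X ⊗[ℤ] Y) ⧸ balancedRelations A X Y

/-- The pure tensor `x ⊗ y` in `X ⊗_A Y`. -/
def pureTensor (A : Type*) {X Y : Type*} [Ring A] [AddCommGroup X] [Module Aᵐᵒᵖ X]
    [AddCommGroup Y] [Module A Y] (x : X) (y : Y) : BalancedTensor A X Y :=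
  (balancedRelations A X Y).mkQ (x ⊗ₜ[ℤ] y)

/-! ### Words, length, parabolic subgroups and distinguished coset representatives -/

/-- The length of `w` with respect to the generators `s`: the least length of a word in the
generators with product `w`. -/
def wordLength {B : Type u} {W : Type v} [Group W] (s : B → W) (w : W) : ℕ :=
  sInf {l | ∃ ω : List B, ω.length = l ∧ (ω.map s).prod = w}

/-- A choice of a reduced expression of `w`. -/
def reducedWord {B : Type u} {W : Type v} [Group W] (s : B → W) (w : W) : List B :=
  Classical.epsilon fun ω : List B => ω.length = wordLength s w ∧ (ω.map s).prod = w

/-- The standard parabolic subgroup generated by the simple reflections indexed by `J`. -/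
def parabolicSubgroup {B : Type u} {W : Type v} [Group W] (s : B → W) (J : Set B) : Subgroup W :=
  Subgroup.closure (s '' J)

/-- The distinguished right coset representatives of `W_J` in `W`: the elements `x` of minimal
length in their coset `W_J x`. -/
def distinguishedReps {B : Type u} {W : Type v} [Group W] (s : B → W) (J : Set B) : Set W :=
  {x | ∀ u ∈ parabolicSubgroup s J, wordLength s x ≤ wordLength s (u * x)}

/-! ### The Coxeter group of type `B` -/

/-- The group `B_m` of permutations `w` of `{±1, …, ±m}` with `w (-i) = -w i`. A permutation of
`{±1, …, ±m}` is identified with the permutation of `ℤ` that extends it by the identity, so that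
`B_1 ⊆ B_2 ⊆ ⋯`. -/
def signedPerm (m : ℕ) : Subgroup (Equiv.Perm ℤ) where
  carrier := {w | (∀ i, w (-i) = -w i) ∧ ∀ i, (m : ℤ) < |i| → w i = i}
  one_mem' := by simp
  mul_mem' := by
    rintro a b ⟨ha, ha'⟩ ⟨hb, hb'⟩
    refine ⟨fun i => by simp [ha, hb], fun i hi => ?_⟩
    rw [Equiv.Perm.mul_apply, hb' i hi, ha' i hi]
  inv_mem' := by
    rintro a ⟨ha, ha'⟩
    refine ⟨fun i => ?_, fun i hi => ?_⟩
    · rw [Equiv.Perm.inv_eq_iff_eq, ha]; simp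
    · rw [Equiv.Perm.inv_eq_iff_eq, ha' i hi]

instance (m : ℕ) : Finite (signedPerm m) := by
  have hmaps : ∀ w : signedPerm m, ∀ i : ℤ, i ∈ Set.Icc (-(m : ℤ)) m →
      (w : Equiv.Perm ℤ) i ∈ Set.Icc (-(m : ℤ)) m := by
    intro w i hi
    by_contra hc
    have h1 : (m : ℤ) < |(w : Equiv.Perm ℤ) i| := by
      by_contra h2
      exact hc (abs_le.mp (not_lt.mp h2))
    have h3 := (w : Equiv.Perm ℤ).injective (w.2.2 _ h1)
    rw [h3] at hc
    exact hc hi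
  refine Finite.of_injective
    (fun w : signedPerm m => fun i : Set.Icc (-(m : ℤ)) m =>
      (⟨(w : Equiv.Perm ℤ) i, hmaps w i i.2⟩ : Set.Icc (-(m : ℤ)) m)) ?_
  intro w w' h
  ext i
  by_cases hi : i ∈ Set.Icc (-(m : ℤ)) m
  · exact congrArg Subtype.val (congrFun h ⟨i, hi⟩)
  · have h1 : (m : ℤ) < |i| := by
      by_contra h2
      exact hi (abs_le.mp (not_lt.mp h2))
    rw [w.2.2 i h1, w'.2.2 i h1]

/-- The underlying permutations of the simple reflections: `t = (-1, 1)` for the index `0`, and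
`s_i = (i, i+1) (-i, -(i+1))` for the index `i ≥ 1`. -/
def simplePerm (i : ℕ) : Equiv.Perm ℤ :=
  if i = 0 then Equiv.swap (-1) 1
  else Equiv.swap (i : ℤ) (i + 1) * Equiv.swap (-(i : ℤ)) (-(i + 1))

theorem simplePerm_mem {m i : ℕ} (h : i < m) : simplePerm i ∈ signedPerm m := by
  unfold simplePerm
  split_ifs with h0
  · refine ⟨fun j => ?_, fun j hj => ?_⟩
    · simp only [Equiv.swap_apply_def]
      split_ifs <;> omega
    · rw [lt_abs] at hj
      simp only [Equiv.swap_apply_def]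
      split_ifs <;> omega
  · refine ⟨fun j => ?_, fun j hj => ?_⟩
    · simp only [Equiv.Perm.mul_apply, Equiv.swap_apply_def]
      split_ifs <;> omega
    · rw [lt_abs] at hj
      simp only [Equiv.Perm.mul_apply, Equiv.swap_apply_def]
      split_ifs <;> omega

/-- The simple reflections `t, s_1, …, s_{m-1}` of `B_m`, indexed by `0, 1, …, m-1`. -/
def simpleRefl (m : ℕ) (i : Fin m) : signedPerm m :=
  ⟨simplePerm i, simplePerm_mem i.2⟩

/-- The Coxeter matrix of type `B_m`, numbered so that `t` has index `0` and `s_i` has index `i`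
(the reverse of Mathlib's numbering). -/
def typeB (m : ℕ) : CoxeterMatrix (Fin m) :=
  (CoxeterMatrix.B m).reindex Fin.revPerm

theorem typeB_apply (m : ℕ) (i j : Fin m) :
    typeB m i j =
      if i = j then 1
      else if ((i : ℕ) = 0 ∧ (j : ℕ) = 1) ∨ ((i : ℕ) = 1 ∧ (j : ℕ) = 0) then 4
      else if (i : ℕ) + 1 = j ∨ (j : ℕ) + 1 = i then 3 else 2 := by
  have hi := i.2
  have hj := j.2
  simp only [typeB, CoxeterMatrix.reindex_apply, CoxeterMatrix.B, Matrix.of_apply,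
    Fin.revPerm_symm, Fin.revPerm_apply, Fin.val_rev, Fin.ext_iff]
  split_ifs <;> omega

/-- The parameters `t ↦ p`, `s_i ↦ q`. -/
def paramB (m : ℕ) (p q : ℂ) (i : Fin m) : ℂ := if (i : ℕ) = 0 then p else q

/-- The Hecke algebra `H_{p,q}(B_m)`. -/
abbrev HeckeB (m : ℕ) (p q : ℂ) : Type := HeckeAlgebra (typeB m) (paramB m p q)

/-- The standard basis element `T_w` of `H_{p,q}(B_m)`: the product of the generators along a
reduced expression of `w`. -/
def T (m : ℕ) (p q : ℂ) (w : signedPerm m) : HeckeB m p q :=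
  ((reducedWord (simpleRefl m) w).map (gen (typeB m) (paramB m p q))).prod

/-! ### The parabolic subgroup `B_n × S_k` of `B_{n+k}` -/

/-- The indices of the simple reflections of `B_n × S_k` in `B_{n+k}`: all except `s_n` (except `t`
if `n = 0`). -/
def idxBS (n k : ℕ) : Set (Fin (n + k)) := {i | (i : ℕ) ≠ n}

/-- The indices of the simple reflections `s_{n+1}, …, s_{n+k-1}` of the factor `S_k`. -/
def idxS (n k : ℕ) : Set (Fin (n + k)) := {i | n < (i : ℕ)}

theorem idxS_subset (n k : ℕ) : idxS n k ⊆ idxBS n k := fun _ hi => Nat.ne_of_gt hi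

/-- The Hecke algebra `H_{p,q}(B_n × S_k)`. -/
abbrev HeckeBS (n k : ℕ) (p q : ℂ) : Type :=
  ParabolicHecke (typeB (n + k)) (paramB (n + k) p q) (idxBS n k)

/-- The Hecke algebra `H_q(S_k)`, all of whose parameters are equal to `q`. -/
abbrev HeckeS (n k : ℕ) (p q : ℂ) : Type :=
  ParabolicHecke (typeB (n + k)) (paramB (n + k) p q) (idxS n k)

/-- The embedding `H_{p,q}(B_n × S_k) → H_{p,q}(B_{n+k})`. -/
def inclBS (n k : ℕ) (p q : ℂ) : HeckeBS n k p q →ₐ[ℂ] HeckeB (n + k) p q :=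
  parabolicIncl (typeB (n + k)) (paramB (n + k) p q) (idxBS n k)

/-- `H_{p,q}(B_n × S_k)` as a left module over `H_q(S_k)`, by left multiplication. -/
instance (n k : ℕ) (p q : ℂ) : Module (HeckeS n k p q) (HeckeBS n k p q) :=
  Module.compHom (HeckeBS n k p q)
    (parabolicInclOfLE (typeB (n + k)) (paramB (n + k) p q) (idxS_subset n k)).toRingHom

/-- The trivial right module `ℂ_triv` of `H_q(S_k)`. -/
abbrev TrivS (n k : ℕ) (p q : ℂ) : Type :=
  TrivModule (parabolic (typeB (n + k)) (idxS n k)) (fun i => paramB (n + k) p q i)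

/-- The element `1_triv ⊗ z` of `ℂ_triv ⊗_{H_q(S_k)} H_{p,q}(B_n × S_k)`. -/
def trivTensor (n k : ℕ) (p q : ℂ) (z : HeckeBS n k p q) :
    BalancedTensor (HeckeS n k p q) (TrivS n k p q) (HeckeBS n k p q) :=
  pureTensor (HeckeS n k p q) (oneTriv _ _ : TrivS n k p q) z

/-- The set `X_{n,k}` of distinguished right coset representatives of `B_n × S_k` in `B_{n+k}`. -/
abbrev X (n k : ℕ) : Set (signedPerm (n + k)) :=
  distinguishedReps (simpleRefl (n + k)) (idxBS n k)

instance (n k : ℕ) : Fintype (X n k) := Fintype.ofFinite _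

theorem exists_longest (n k : ℕ) : ∃ w : X n k, ∀ x : X n k,
    wordLength (simpleRefl (n + k)) (x : signedPerm (n + k)) ≤
      wordLength (simpleRefl (n + k)) (w : signedPerm (n + k)) := by
  have h1 : wordLength (simpleRefl (n + k)) 1 = 0 :=
    Nat.sInf_eq_zero.mpr (Or.inl ⟨[], rfl, rfl⟩)
  have : Nonempty (X n k) := ⟨⟨1, fun u _ => by rw [h1]; exact Nat.zero_le _⟩⟩
  exact Finite.exists_max fun x : X n k =>
    wordLength (simpleRefl (n + k)) (x : signedPerm (n + k))

/-- The element `w_{n,k}` of maximal length in `X_{n,k}`. -/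
def longestRep (n k : ℕ) : X n k := (exists_longest n k).choose

end TypeBHecke

end

open TypeBHecke

noncomputable section

namespace TypeBHecke

/-! ### Descents and length in the group of signed permutations -/

/-! Write `W_J` for `B_n × S_k`. By Deodhar's lemma, for `x` distinguished and `s_i` simple, either
`x s_i` is distinguished, or `x s_i = s_j x` with `s_j` in `W_J` (`mul_mem_X`,
`exists_root_of_entry_eq`). This dictates a right action of the Hecke algebra on an induced module.
Given an algebra homomorphism `f` from `H_{p,q}(B_n × S_k)` to `A`, take the free left `A`-module
with basis `e_x`, `x ∈ X_{n,k}`, and let `T_i` send `e_x` to `e_{x s_i}` (going up in `X`), to `(1 -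
q_i) e_x + q_i e_{x s_i}` (going down), or to `f(T_j) e_x` (if `x s_i = s_j x`). The braid relations
hold (`braidFamily_actGen`), and `e_1 · (z T_x) = f(z) e_x`. So if `h = ∑ z_x T_x`, then `f(z_y)` is
the coordinate at `y` of `e_1 h` (`coeff_eq`). With `f = id` this gives uniqueness of the
coefficients; they exist because the span of the products `z T_x` contains `1` and is stable under
right multiplication (`exists_coeff`).

For the value of `z_w`, `w = w_{n,k}`, take for `f` the endomorphism `projS` that sends the
generators of `S_k` to `1`. It does not change `1_triv ⊗ z` (`trivTensor_projS`). Since `e_1 T_w =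
e_w`, what is wanted is the coordinate at `w` of `e_w T_w` in a module where `S_k` acts trivially.

A representative `x` is determined by its pattern: at each position `i` record `0` if `|x(i)| ≤ n`,
and otherwise the sign of `x(i)` (`eq_of_entry_eq`). The `s_i` exchange neighbouring entries and `t`
negates the entry at position 1. The identity has pattern `0^n 1^k`, and `w` has pattern `0^n
(-1)^k`. Hence a recursive word for `T_w` (`T_longestRep`): carry the last `0` to the right over the
block, apply `T_{w_{n-1,k}}`, carry the `0` back; for `n = 0` the signs are flipped one at a time.

The key computation is `TrivOnS.act_upWord_of_invariant`. Carrying an entry to the right past `r`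
entries `-1` is a chain of descents, and each of them leaves an error term. The rest of the word
intertwines the generators of the block with generators that act trivially on the final coordinate,
so all error terms have the same value there, and the total is `q^r e_y + (1 - q^r) e_x`. For `r =
k` we have `q^k = 1`, so only the pattern with the shifted block survives, and `n` drops by one
(`TrivOnS.act_longWord`). For `n = 0` the same formula, applied after a flip by `t`, gives the
three-term recursion of the Rogers–Szegő polynomials at `-p` (`TrivOnS.act_flipWord`). These are `∑
[k, j]_q (-p)^j` with Gaussian binomials, which vanish for `0 < j < k` at a primitive `k`-th root of
unity; `1 + (-p)^k` remains. -/

/-- The smaller entry of the simple root of index `i`, the larger one being `i + 1`. -/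
def rootLo (i : ℕ) : ℤ := if i = 0 then -1 else i

theorem simplePerm_apply (i : ℕ) (j : ℤ) :
    simplePerm i j = if i = 0 then (if j = 1 ∨ j = -1 then -j else j) else
      if j = i then (i : ℤ) + 1 else if j = i + 1 then (i : ℤ) else
      if j = -i then -((i : ℤ) + 1) else if j = -(i + 1) then -(i : ℤ) else j := by
  unfold simplePerm
  by_cases h : i = 0
  · simp only [h, if_true, Equiv.swap_apply_def]
    split_ifs <;> omega
  · simp only [h, if_false, Equiv.Perm.mul_apply, Equiv.swap_apply_def]
    split_ifs <;> omega

theorem simplePerm_rootLo (i : ℕ) : simplePerm i (rootLo i) = i + 1 := by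
  rw [simplePerm_apply, rootLo]; split_ifs <;> omega

theorem simplePerm_rootHi (i : ℕ) : simplePerm i (i + 1) = rootLo i := by
  rw [simplePerm_apply, rootLo]; split_ifs <;> omega

theorem simplePerm_simplePerm (i : ℕ) (j : ℤ) : simplePerm i (simplePerm i j) = j := by
  simp only [simplePerm_apply]; split_ifs <;> omega

theorem simplePerm_neg (i : ℕ) (j : ℤ) : simplePerm i (-j) = -simplePerm i j := by
  simp only [simplePerm_apply]; split_ifs <;> omega

theorem simplePerm_of_lt {i : ℕ} {j : ℤ} (h : (i : ℤ) + 1 < j) : simplePerm i j = j := by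
  rw [simplePerm_apply]; split_ifs <;> omega

/-- A simple reflection only reverses the order of its own root. -/
theorem eq_root_of_simplePerm_lt {i : ℕ} {a b : ℤ} (ha : a ≠ 0) (hb : b ≠ 0) (hab : a < b)
    (h : simplePerm i b < simplePerm i a) :
    (a = rootLo i ∧ b = i + 1) ∨ (b = -rootLo i ∧ a = -(i + 1)) := by
  simp only [simplePerm_apply] at h
  unfold rootLo
  split_ifs at h ⊢ <;> omega

variable {N : ℕ}

theorem simpleRefl_apply (i : Fin N) (j : ℤ) : (simpleRefl N i).1 j = simplePerm i j := rfl

theorem mul_simpleRefl_apply (w : signedPerm N) (i : Fin N) (j : ℤ) :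
    (w * simpleRefl N i).1 j = w.1 (simplePerm i j) := rfl

theorem simpleRefl_mul_self (i : Fin N) : simpleRefl N i * simpleRefl N i = 1 := by
  ext j; exact simplePerm_simplePerm i j

theorem simpleRefl_inv (i : Fin N) : (simpleRefl N i)⁻¹ = simpleRefl N i :=
  inv_eq_of_mul_eq_one_left (simpleRefl_mul_self i)

theorem mul_simpleRefl_cancel (w : signedPerm N) (i : Fin N) :
    w * simpleRefl N i * simpleRefl N i = w := by
  rw [mul_assoc, simpleRefl_mul_self, mul_one]

theorem signed_neg (w : signedPerm N) (j : ℤ) : w.1 (-j) = -w.1 j := w.2.1 j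

theorem signed_zero (w : signedPerm N) : w.1 0 = 0 := by
  have := signed_neg w 0
  simp only [neg_zero] at this; omega

theorem signed_ne_zero (w : signedPerm N) {j : ℤ} (h : j ≠ 0) : w.1 j ≠ 0 := fun h' =>
  h (w.1.injective (h'.trans (signed_zero w).symm))

theorem signed_ne (w : signedPerm N) {a b : ℤ} (h : a ≠ b) : w.1 a ≠ w.1 b :=
  w.1.injective.ne h

theorem signed_abs_le (w : signedPerm N) {j : ℤ} (h : |j| ≤ N) : |w.1 j| ≤ N := by
  by_contra hc
  have := w.1.injective (w.2.2 _ (not_le.mp hc))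
  rw [this] at hc
  exact hc h

theorem signed_apply_inv (w : signedPerm N) (j : ℤ) : w.1 ((w⁻¹).1 j) = j :=
  w.1.apply_symm_apply j

theorem signed_inv_apply (w : signedPerm N) (j : ℤ) : (w⁻¹).1 (w.1 j) = j :=
  w.1.symm_apply_apply j

/-! ### Positive roots and inversions -/

/-- The positive roots of type `B_N`, as pairs `(a, b)` with `-b ≤ a < b` and `a ≠ 0`. -/
def posRoots (N : ℕ) : Finset (ℤ × ℤ) :=
  (Finset.Icc (-(N : ℤ)) N ×ˢ Finset.Icc 1 (N : ℤ)).filter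
    fun r => -r.2 ≤ r.1 ∧ r.1 < r.2 ∧ r.1 ≠ 0

theorem mem_posRoots {r : ℤ × ℤ} :
    r ∈ posRoots N ↔ 1 ≤ r.2 ∧ r.2 ≤ N ∧ -r.2 ≤ r.1 ∧ r.1 < r.2 ∧ r.1 ≠ 0 := by
  simp only [posRoots, Finset.mem_filter, Finset.mem_product, Finset.mem_Icc]
  omega

/-- The positive roots made negative by `w`. -/
def inversions (w : signedPerm N) : Finset (ℤ × ℤ) :=
  (posRoots N).filter fun r => w.1 r.2 < w.1 r.1

theorem mem_inversions {w : signedPerm N} {r : ℤ × ℤ} :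
    r ∈ inversions w ↔ r ∈ posRoots N ∧ w.1 r.2 < w.1 r.1 := by
  simp [inversions]

/-- The action of a simple reflection on the positive roots other than its own. -/
def reflRoot (i : ℕ) (r : ℤ × ℤ) : ℤ × ℤ :=
  -- The pair `(a, b)` stands for the root `e_b - e_a`, where `e_{-a} = -e_a`. Applied entrywise to
  -- this exceptional pair, `s_i` gives `(-(i+1), i)`: the same root `e_{i+1} + e_i`, but out of
  -- normal form.
  if r = (-(i : ℤ), (i : ℤ) + 1) then r else (simplePerm i r.1, simplePerm i r.2)

theorem reflRoot_mem (i : Fin N) {r : ℤ × ℤ} (h : r ∈ posRoots N)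
    (hne : r ≠ (rootLo i, (i : ℤ) + 1)) :
    reflRoot i r ∈ posRoots N ∧ reflRoot i r ≠ (rootLo i, (i : ℤ) + 1) ∧
      reflRoot i (reflRoot i r) = r := by
  obtain ⟨a, b⟩ := r
  have hi := i.2
  rw [mem_posRoots] at h ⊢
  simp only [ne_eq, Prod.mk.injEq, rootLo] at h hne
  unfold reflRoot
  by_cases h1 : (a, b) = (-(i : ℤ), (i : ℤ) + 1)
  · simp only [h1, if_true]
    simp only [Prod.mk.injEq] at h1
    refine ⟨by omega, ?_, trivial⟩
    simp only [ne_eq, Prod.mk.injEq, rootLo]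
    split_ifs at hne ⊢ <;> omega
  · simp only [h1, if_false, simplePerm_simplePerm]
    simp only [Prod.mk.injEq, rootLo, simplePerm_apply, ne_eq] at h1 ⊢
    by_cases h0 : (i : ℕ) = 0
    · simp only [h0, if_true] at h1 hne ⊢
      refine ⟨?_, ?_, ?_⟩
      · split_ifs <;> omega
      · split_ifs <;> omega
      · rw [if_neg]; split_ifs <;> omega
    · simp only [h0, if_false] at h1 hne ⊢
      refine ⟨?_, ?_, ?_⟩
      · split_ifs <;> omega
      · split_ifs <;> omega
      · rw [if_neg]; split_ifs <;> omega

theorem reflRoot_lt (w : signedPerm N) (i : Fin N) {r : ℤ × ℤ} (hr : r.1 ≠ 0) :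
    (w * simpleRefl N i).1 (reflRoot i r).2 < (w * simpleRefl N i).1 (reflRoot i r).1 ↔
      w.1 r.2 < w.1 r.1 := by
  unfold reflRoot
  split_ifs with h
  · subst h
    have h0 : (i : ℕ) ≠ 0 := by simpa using hr
    simp only [mul_simpleRefl_apply, signed_neg]
    simp [simplePerm_apply, h0]; omega
  · simp only [mul_simpleRefl_apply, simplePerm_simplePerm]

/-- `s_i` permutes the positive roots other than its own, and a root is an inversion of `w` exactly
when its image is one of `w s_i`. The root of `s_i` itself is the one new inversion. -/
theorem card_inversions_mul_of_lt {w : signedPerm N} {i : Fin N}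
    (h : w.1 (rootLo i) < w.1 (i + 1)) :
    (inversions (w * simpleRefl N i)).card = (inversions w).card + 1 := by
  have hα : ((rootLo i, (i : ℤ) + 1) : ℤ × ℤ) ∈ inversions (w * simpleRefl N i) := by
    rw [mem_inversions, mem_posRoots]
    have := i.2
    refine ⟨?_, ?_⟩
    · simp only [rootLo]; split_ifs <;> omega
    · simpa only [mul_simpleRefl_apply, simplePerm_rootLo, simplePerm_rootHi] using h
  rw [← Finset.card_erase_add_one hα, add_left_inj]
  have hne : ∀ r ∈ inversions w, r ≠ (rootLo i, (i : ℤ) + 1) := by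
    rintro r hr rfl
    exact lt_asymm h (mem_inversions.mp hr).2
  refine (Finset.card_nbij' (reflRoot i) (reflRoot i) ?_ ?_ ?_ ?_).symm
  · intro r hr
    have h1 := reflRoot_mem i (mem_inversions.mp hr).1 (hne r hr)
    rw [Finset.mem_coe, Finset.mem_erase, mem_inversions]
    exact ⟨h1.2.1, h1.1, (reflRoot_lt w i
      (mem_posRoots.mp (mem_inversions.mp hr).1).2.2.2.2).mpr (mem_inversions.mp hr).2⟩
  · intro r hr
    rw [Finset.mem_coe, Finset.mem_erase, mem_inversions] at hr
    have h1 := reflRoot_mem i hr.2.1 hr.1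
    rw [Finset.mem_coe, mem_inversions]
    refine ⟨h1.1, ?_⟩
    have h2 := (reflRoot_lt (w * simpleRefl N i) i
      (mem_posRoots.mp hr.2.1).2.2.2.2).mpr hr.2.2
    rwa [mul_simpleRefl_cancel] at h2
  · intro r hr
    exact (reflRoot_mem i (mem_inversions.mp hr).1 (hne r hr)).2.2
  · intro r hr
    rw [Finset.mem_coe, Finset.mem_erase, mem_inversions] at hr
    exact (reflRoot_mem i hr.2.1 hr.1).2.2

theorem card_inversions_mul_of_gt {w : signedPerm N} {i : Fin N}
    (h : w.1 (i + 1) < w.1 (rootLo i)) :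
    (inversions (w * simpleRefl N i)).card + 1 = (inversions w).card := by
  have h1 : (w * simpleRefl N i).1 (rootLo i) < (w * simpleRefl N i).1 (i + 1) := by
    simpa only [mul_simpleRefl_apply, simplePerm_rootLo, simplePerm_rootHi] using h
  have h2 := card_inversions_mul_of_lt h1
  rw [mul_simpleRefl_cancel] at h2
  exact h2.symm

theorem root_ne (w : signedPerm N) (i : Fin N) : w.1 (rootLo i) ≠ w.1 (i + 1) := by
  apply signed_ne; unfold rootLo; split_ifs <;> omega

theorem inversions_one : inversions (1 : signedPerm N) = ∅ := by
  ext r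
  rw [mem_inversions, mem_posRoots]
  simp; omega

/-- A strictly increasing map of an integer interval to itself is the identity. -/
theorem eq_self_of_strictMono_Icc {f : ℤ → ℤ} {a b : ℤ}
    (hm : ∀ i, a ≤ i → i < b → f i < f (i + 1))
    (hf : ∀ i, a ≤ i → i ≤ b → a ≤ f i ∧ f i ≤ b) : ∀ i, a ≤ i → i ≤ b → f i = i := by
  intro i hai hib
  have h1 : ∀ m : ℕ, a + m ≤ b → a + m ≤ f (a + m) := by
    intro m
    induction m with
    | zero => intro h; simpa using (hf a le_rfl (by simpa using h)).1
    | succ m ih =>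
      intro h
      push_cast at h ⊢
      have := ih (by omega)
      have := hm (a + m) (by omega) (by omega)
      rw [← add_assoc]; omega
  have h2 : ∀ m : ℕ, a ≤ b - m → f (b - m) ≤ b - m := by
    intro m
    induction m with
    | zero => intro h; simpa using (hf b (by simpa using h) le_rfl).2
    | succ m ih =>
      intro h
      push_cast at h ⊢
      have := ih (by omega)
      have := hm (b - (m + 1)) (by omega) (by omega)
      rw [show b - ((m : ℤ) + 1) + 1 = b - m by ring] at this
      omega
  have e1 := h1 (i - a).toNat (by omega)
  have e2 := h2 (b - i).toNat (by omega)
  rw [show a + ((i - a).toNat : ℤ) = i by omega] at e1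
  rw [show b - ((b - i).toNat : ℤ) = i by omega] at e2
  omega

theorem lt_of_forall_lt_succ {f : ℤ → ℤ} {a b : ℤ}
    (hm : ∀ i, a ≤ i → i < b → f i < f (i + 1)) {i j : ℤ} (hi : a ≤ i) (hij : i < j)
    (hj : j ≤ b) : f i < f j := by
  have h : ∀ m : ℕ, i + m + 1 ≤ b → f i < f (i + m + 1) := by
    intro m
    induction m with
    | zero => intro h; simpa using hm i hi (by push_cast at h; omega)
    | succ m ih =>
      intro h
      push_cast at h ⊢
      have h1 := ih (by omega)
      have h2 := hm (i + m + 1) (by omega) (by omega)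
      rw [show i + ((m : ℤ) + 1) + 1 = i + m + 1 + 1 by ring]
      omega
  have := h (j - i - 1).toNat (by omega)
  rwa [show i + ((j - i - 1).toNat : ℤ) + 1 = j by omega] at this

theorem signed_ext {w w' : signedPerm N} (h : ∀ i : ℤ, 1 ≤ i → i ≤ N → w.1 i = w'.1 i) :
    w = w' := by
  ext i
  rcases lt_trichotomy i 0 with h0 | h0 | h0
  · by_cases h1 : -i ≤ N
    · have := h (-i) (by omega) h1
      rw [signed_neg, signed_neg] at this
      omega
    · rw [w.2.2 i (by rw [abs_of_neg h0]; omega), w'.2.2 i (by rw [abs_of_neg h0]; omega)]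
  · rw [h0, signed_zero, signed_zero]
  · by_cases h1 : i ≤ N
    · exact h i (by omega) h1
    · rw [w.2.2 i (by rw [abs_of_pos h0]; omega), w'.2.2 i (by rw [abs_of_pos h0]; omega)]

/-- Without descents, `w(-1) < w(1)` forces `w(1) > 0`, and then `w` is increasing from `{1, …, N}`
to itself, hence the identity. -/
theorem exists_descent {w : signedPerm N} (hw : w ≠ 1) :
    ∃ i : Fin N, w.1 (i + 1) < w.1 (rootLo i) := by
  by_contra! hc
  apply hw
  have hlt : ∀ i : Fin N, w.1 (rootLo i) < w.1 (i + 1) := fun i =>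
    lt_of_le_of_ne (hc i) (root_ne w i)
  have hm : ∀ i : ℤ, 1 ≤ i → i < N → w.1 i < w.1 (i + 1) := by
    intro i h1 h2
    have := hlt ⟨i.toNat, by omega⟩
    simp only [rootLo, show ¬ i.toNat = 0 by omega, if_false, show ((i.toNat : ℕ) : ℤ) = i by omega]
      at this
    exact this
  apply signed_ext
  refine eq_self_of_strictMono_Icc hm ?_
  intro i h1 h2
  have habs := signed_abs_le w (j := i) (by rw [abs_of_pos (by omega)]; exact h2)
  refine ⟨?_, (abs_le.mp habs).2⟩
  have h0 := hlt ⟨0, by omega⟩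
  simp only [rootLo, if_true] at h0
  have e : w.1 (-1) = - w.1 1 := signed_neg w 1
  simp only [Nat.cast_zero, zero_add] at h0
  rcases eq_or_lt_of_le h1 with h | h
  · subst h; omega
  · have := lt_of_forall_lt_succ hm le_rfl h h2
    omega

/-! ### The length is the number of inversions -/

theorem card_inversions_prod_le (ω : List (Fin N)) :
    (inversions (ω.map (simpleRefl N)).prod).card ≤ ω.length := by
  induction ω using List.reverseRecOn with
  | nil => simp [inversions_one]
  | append_singleton ω i ih =>
    simp only [List.map_append, List.map_cons, List.map_nil, List.prod_append, List.prod_cons,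
      List.prod_nil, mul_one, List.length_append, List.length_cons, List.length_nil]
    rcases lt_or_gt_of_ne (root_ne (ω.map (simpleRefl N)).prod i) with h | h
    · have := card_inversions_mul_of_lt h; omega
    · have := card_inversions_mul_of_gt h; omega

/-- Removing a descent on the right costs exactly one inversion, so descents can be stripped until
the identity is reached. -/
theorem exists_word (w : signedPerm N) : ∃ ω : List (Fin N),
    ω.length = (inversions w).card ∧ (ω.map (simpleRefl N)).prod = w := by
  induction hc : (inversions w).card using Nat.strong_induction_on generalizing w with
  | _ c ih =>
    by_cases hw : w = 1
    · subst hw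
      exact ⟨[], by simpa [inversions_one] using hc, rfl⟩
    · obtain ⟨i, hi⟩ := exists_descent hw
      have h1 := card_inversions_mul_of_gt hi
      obtain ⟨ω, h2, h3⟩ := ih _ (by omega) (w * simpleRefl N i) rfl
      refine ⟨ω ++ [i], by simp; omega, ?_⟩
      simp [h3, mul_simpleRefl_cancel]

theorem wordLength_eq (w : signedPerm N) :
    wordLength (simpleRefl N) w = (inversions w).card := by
  apply le_antisymm
  · exact Nat.sInf_le (exists_word w)
  · refine le_csInf ⟨_, exists_word w⟩ ?_
    rintro l ⟨ω, rfl, h⟩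
    rw [← h]
    exact card_inversions_prod_le ω

theorem reducedWord_spec (w : signedPerm N) :
    (reducedWord (simpleRefl N) w).length = wordLength (simpleRefl N) w ∧
      ((reducedWord (simpleRefl N) w).map (simpleRefl N)).prod = w := by
  obtain ⟨ω, h1, h2⟩ := exists_word w
  exact Classical.epsilon_spec
    (p := fun ω : List (Fin N) => ω.length = wordLength (simpleRefl N) w ∧
      (ω.map (simpleRefl N)).prod = w) ⟨ω, h1.trans (wordLength_eq w).symm, h2⟩

theorem wordLength_mul_of_lt {w : signedPerm N} {i : Fin N} (h : w.1 (rootLo i) < w.1 (i + 1)) :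
    wordLength (simpleRefl N) (w * simpleRefl N i) = wordLength (simpleRefl N) w + 1 := by
  rw [wordLength_eq, wordLength_eq, card_inversions_mul_of_lt h]

theorem wordLength_mul_of_gt {w : signedPerm N} {i : Fin N} (h : w.1 (i + 1) < w.1 (rootLo i)) :
    wordLength (simpleRefl N) (w * simpleRefl N i) + 1 = wordLength (simpleRefl N) w := by
  rw [wordLength_eq, wordLength_eq, card_inversions_mul_of_gt h]

theorem prod_reverse (ω : List (Fin N)) :
    (ω.reverse.map (simpleRefl N)).prod = ((ω.map (simpleRefl N)).prod)⁻¹ := by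
  rw [List.prod_inv_reverse, List.map_map, List.map_reverse]
  congr 2
  exact List.map_congr_left fun i _ => (simpleRefl_inv i).symm

theorem wordLength_inv (w : signedPerm N) :
    wordLength (simpleRefl N) w⁻¹ = wordLength (simpleRefl N) w := by
  have key : ∀ w : signedPerm N,
      wordLength (simpleRefl N) w⁻¹ ≤ wordLength (simpleRefl N) w := by
    intro w
    obtain ⟨h1, h2⟩ := reducedWord_spec w
    refine Nat.sInf_le ⟨(reducedWord (simpleRefl N) w).reverse, by simpa using h1, ?_⟩
    rw [prod_reverse, h2]
  exact le_antisymm (key w) (by simpa using key w⁻¹)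

theorem wordLength_simpleRefl_mul (w : signedPerm N) (i : Fin N) :
    wordLength (simpleRefl N) (simpleRefl N i * w) =
      wordLength (simpleRefl N) (w⁻¹ * simpleRefl N i) := by
  rw [← wordLength_inv, mul_inv_rev, simpleRefl_inv]

/-! ### Independence of the reduced expression -/

theorem simplePerm_self {i : ℕ} (h : i ≠ 0) : simplePerm i i = i + 1 := by
  rw [simplePerm_apply, if_neg h, if_pos rfl]

theorem simplePerm_succ {i : ℕ} (h : i ≠ 0) : simplePerm i (i + 1) = i := by
  rw [simplePerm_rootHi, rootLo, if_neg h]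

theorem simplePerm_other {i : ℕ} {a : ℤ} (h : a ≠ i) (h' : a ≠ i + 1) (h'' : a ≠ -i)
    (h3 : a ≠ -(i + 1)) : simplePerm i a = a := by
  rw [simplePerm_apply]; split_ifs <;> omega

theorem simplePerm_zero_one : simplePerm 0 1 = -1 := by simp [simplePerm_apply]

theorem simpleRefl_comm {i j : Fin N} (h : (i : ℕ) + 1 < j) :
    simpleRefl N i * simpleRefl N j = simpleRefl N j * simpleRefl N i := by
  have hj : (j : ℕ) ≠ 0 := by omega
  apply signed_ext
  intro a ha _
  rw [mul_simpleRefl_apply, mul_simpleRefl_apply, simpleRefl_apply, simpleRefl_apply]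
  by_cases h1 : a = j
  · rw [h1, simplePerm_self hj, simplePerm_of_lt (i := i) (j := (j : ℕ) + 1) (by omega),
      simplePerm_of_lt (i := i) (j := (j : ℕ)) (by omega), simplePerm_self hj]
  by_cases h2 : a = j + 1
  · rw [h2, simplePerm_succ hj, simplePerm_of_lt (i := i) (j := (j : ℕ)) (by omega),
      simplePerm_of_lt (i := i) (j := (j : ℕ) + 1) (by omega), simplePerm_succ hj]
  have h3 : simplePerm i a ≠ j ∧ simplePerm i a ≠ j + 1 ∧ simplePerm i a ≠ -j ∧
      simplePerm i a ≠ -(j + 1) := by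
    rw [simplePerm_apply]; split_ifs <;> omega
  rw [simplePerm_other h3.1 h3.2.1 h3.2.2.1 h3.2.2.2,
    simplePerm_other h1 h2 (by omega) (by omega)]

theorem simpleRefl_braid_three {i j : Fin N} (h0 : (i : ℕ) ≠ 0) (h : (i : ℕ) + 1 = j) :
    simpleRefl N i * simpleRefl N j * simpleRefl N i =
      simpleRefl N j * simpleRefl N i * simpleRefl N j := by
  have hj : (j : ℕ) ≠ 0 := by omega
  have hij : ((i : ℕ) : ℤ) + 1 = (j : ℕ) := by exact_mod_cast h
  apply signed_ext
  intro a ha _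
  simp only [mul_simpleRefl_apply, simpleRefl_apply]
  by_cases h1 : a = i
  · rw [h1, simplePerm_self h0, hij, simplePerm_self hj, simplePerm_of_lt (by omega),
      simplePerm_other (a := (i : ℕ)) (by omega) (by omega) (by omega) (by omega),
      simplePerm_self h0, hij, simplePerm_self hj]
  by_cases h2 : a = j
  · rw [h2, ← hij, simplePerm_succ h0, hij, simplePerm_self hj,
      simplePerm_other (a := (i : ℕ)) (by omega) (by omega) (by omega) (by omega),
      simplePerm_self h0, simplePerm_of_lt (i := i) (by omega), simplePerm_succ hj, hij]
  by_cases h3 : a = j + 1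
  · rw [h3, simplePerm_of_lt (i := i) (j := (j : ℕ) + 1) (by omega), simplePerm_succ hj, ← hij,
      simplePerm_succ h0,
      simplePerm_other (i := j) (a := (i : ℕ)) (by omega) (by omega) (by omega) (by omega)]
  rw [simplePerm_other (i := i) h1 (by omega) (by omega) (by omega),
    simplePerm_other (i := j) h2 h3 (by omega) (by omega),
    simplePerm_other (i := i) h1 (by omega) (by omega) (by omega),
    simplePerm_other (i := j) h2 h3 (by omega) (by omega)]

theorem simpleRefl_braid_four {i j : Fin N} (h0 : (i : ℕ) = 0) (h : (j : ℕ) = 1) :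
    simpleRefl N i * simpleRefl N j * simpleRefl N i * simpleRefl N j =
      simpleRefl N j * simpleRefl N i * simpleRefl N j * simpleRefl N i := by
  apply signed_ext
  intro a ha _
  simp only [mul_simpleRefl_apply, simpleRefl_apply, h0, h]
  have e1 : simplePerm 1 1 = 2 := by simp [simplePerm_apply]
  have e2 : simplePerm 1 2 = 1 := by simp [simplePerm_apply]
  have e3 : simplePerm 0 2 = 2 := by simp [simplePerm_apply]
  have e4 : simplePerm 0 1 = -1 := by simp [simplePerm_apply]
  have d1 : simplePerm 1 (-1) = -2 := by rw [simplePerm_neg, e1]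
  have d2 : simplePerm 1 (-2) = -1 := by rw [simplePerm_neg, e2]
  have d3 : simplePerm 0 (-2) = -2 := by rw [simplePerm_neg, e3]
  by_cases h1 : a = 1
  · simp [h1, e1, e2, e3, e4, d1, d2, d3]
  by_cases h2 : a = 2
  · simp [h2, e2, e3, e4, d1, d3]
  have f1 : simplePerm 1 a = a :=
    simplePerm_other (by push_cast; omega) (by push_cast; omega) (by push_cast; omega)
      (by push_cast; omega)
  have f2 : simplePerm 0 a = a :=
    simplePerm_other (by push_cast; omega) (by push_cast; omega) (by push_cast; omega)
      (by push_cast; omega)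
  simp [f1, f2]

/-- The braid relations of type `B`, for a family indexed by the simple reflections. -/
structure BraidFamily {R : Type*} [Monoid R] (g : Fin N → R) : Prop where
  comm : ∀ i j : Fin N, (i : ℕ) + 1 < j → g i * g j = g j * g i
  three : ∀ i j : Fin N, (i : ℕ) ≠ 0 → (i : ℕ) + 1 = j → g i * g j * g i = g j * g i * g j
  four : ∀ i j : Fin N, (i : ℕ) = 0 → (j : ℕ) = 1 →
    g i * g j * g i * g j = g j * g i * g j * g i

theorem wordLength_prod_le (ω : List (Fin N)) :
    wordLength (simpleRefl N) (ω.map (simpleRefl N)).prod ≤ ω.length :=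
  Nat.sInf_le ⟨ω, rfl, rfl⟩

/-- If the last letter were an ascent, removing it would give an element longer than the remaining
word. -/
theorem descent_of_reduced {ω : List (Fin N)} {i : Fin N} {w : signedPerm N}
    (hw : (ω.map (simpleRefl N)).prod * simpleRefl N i = w)
    (h : wordLength (simpleRefl N) w = ω.length + 1) :
    w.1 (i + 1) < w.1 (rootLo i) := by
  rcases lt_or_gt_of_ne (root_ne w i) with h1 | h1
  · have h2 := wordLength_mul_of_lt h1
    have h3 := wordLength_prod_le ω
    rw [← hw, mul_simpleRefl_cancel, hw] at h2
    omega
  · exact h1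

/-- The induction step for `prod_eq_of_reduced`: two reduced words with different last letters. -/
theorem prod_eq_of_reduced_of_lt {R : Type*} [Monoid R] {g : Fin N → R} (hg : BraidFamily g)
    {l : ℕ}
    (ih : ∀ (ω ω' : List (Fin N)), ω.length = l → ω'.length = l →
      (ω'.map (simpleRefl N)).prod = (ω.map (simpleRefl N)).prod →
      wordLength (simpleRefl N) (ω.map (simpleRefl N)).prod = l →
      (ω.map g).prod = (ω'.map g).prod)
    {ω ω' : List (Fin N)} {i j : Fin N} {w : signedPerm N} (hij : (i : ℕ) < j)
    (hω : ω.length = l) (hω' : ω'.length = l)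
    (hw : (ω.map (simpleRefl N)).prod * simpleRefl N i = w)
    (hw' : (ω'.map (simpleRefl N)).prod * simpleRefl N j = w)
    (hl : wordLength (simpleRefl N) w = l + 1) :
    (ω.map g).prod * g i = (ω'.map g).prod * g j := by
  have hi := descent_of_reduced hw (hω ▸ hl)
  have hj := descent_of_reduced hw' (hω' ▸ hl)
  have ei : (ω.map (simpleRefl N)).prod = w * simpleRefl N i := by
    rw [← hw, mul_simpleRefl_cancel]
  have ej : (ω'.map (simpleRefl N)).prod = w * simpleRefl N j := by
    rw [← hw', mul_simpleRefl_cancel]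
  have li := wordLength_mul_of_gt hi
  have lj := wordLength_mul_of_gt hj
  have hj0 : (j : ℕ) ≠ 0 := by omega
  -- Matsumoto's argument: `w` is `u` times the longest element of the dihedral group of `s_i` and
  -- `s_j`. By induction both prefixes may be replaced by a reduced word of `u` followed by an
  -- alternating word, and the two alternating words differ by one braid relation.
  have key : ∀ (u : signedPerm N) (η η' : List (Fin N)),
      u * (η.map (simpleRefl N)).prod = w * simpleRefl N i →
      u * (η'.map (simpleRefl N)).prod = w * simpleRefl N j →
      wordLength (simpleRefl N) u + η.length = l → η'.length = η.length →
      (η.map g).prod * g i = (η'.map g).prod * g j →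
      (ω.map g).prod * g i = (ω'.map g).prod * g j := by
    intro u η η' h1 h2 h3 h4 h5
    obtain ⟨r1, r2⟩ := reducedWord_spec u
    rw [ih ω (reducedWord (simpleRefl N) u ++ η) hω (by rw [List.length_append]; omega)
        (by rw [List.map_append, List.prod_append, r2, h1, ei]) (by rw [ei]; omega),
      ih ω' (reducedWord (simpleRefl N) u ++ η') hω' (by rw [List.length_append]; omega)
        (by rw [List.map_append, List.prod_append, r2, h2, ej]) (by rw [ej]; omega)]
    simp only [List.map_append, List.prod_append, mul_assoc, h5]
  by_cases c2 : (i : ℕ) + 1 < j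
  · have d1 : (w * simpleRefl N i).1 (j + 1) < (w * simpleRefl N i).1 (rootLo j) := by
      rw [mul_simpleRefl_apply, mul_simpleRefl_apply, simplePerm_of_lt (by omega),
        simplePerm_of_lt (by rw [rootLo, if_neg hj0]; omega)]
      exact hj
    have l1 := wordLength_mul_of_gt d1
    refine key (w * simpleRefl N i * simpleRefl N j) [j] [i] ?_ ?_ ?_ rfl ?_
    · simp [mul_simpleRefl_cancel]
    · rw [mul_assoc w, simpleRefl_comm c2, ← mul_assoc]
      simp [mul_simpleRefl_cancel]
    · simp only [List.length_cons, List.length_nil]; omega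
    · simpa using (hg.comm i j c2).symm
  have c3 : (i : ℕ) + 1 = j := by omega
  have hij' : ((i : ℕ) : ℤ) + 1 = (j : ℕ) := by exact_mod_cast c3
  by_cases hi0 : (i : ℕ) = 0
  · have hj1 : (j : ℕ) = 1 := by omega
    have e1 : simplePerm 1 1 = 2 := by simp [simplePerm_apply]
    have e2 : simplePerm 1 2 = 1 := by simp [simplePerm_apply]
    have e3 : simplePerm 0 2 = 2 := by simp [simplePerm_apply]
    have e4 : simplePerm 0 1 = -1 := by simp [simplePerm_apply]
    simp only [hi0, hj1, rootLo, if_true, one_ne_zero, if_false, Nat.cast_zero, Nat.cast_one,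
      zero_add, one_add_one_eq_two, signed_neg] at hi hj
    have d1 : (w * simpleRefl N i).1 (j + 1) < (w * simpleRefl N i).1 (rootLo j) := by
      simp only [mul_simpleRefl_apply, hi0, hj1, rootLo, one_ne_zero, if_false, Nat.cast_one,
        one_add_one_eq_two, e3, e4, signed_neg]
      omega
    have l1 := wordLength_mul_of_gt d1
    have d2 : (w * simpleRefl N i * simpleRefl N j).1 (i + 1) <
        (w * simpleRefl N i * simpleRefl N j).1 (rootLo i) := by
      simp only [mul_simpleRefl_apply, hi0, hj1, rootLo, if_true, Nat.cast_zero,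
        zero_add, e3, e1, signed_neg]
      omega
    have l2 := wordLength_mul_of_gt d2
    have d3 : (w * simpleRefl N i * simpleRefl N j * simpleRefl N i).1 (j + 1) <
        (w * simpleRefl N i * simpleRefl N j * simpleRefl N i).1 (rootLo j) := by
      simp only [mul_simpleRefl_apply, hi0, hj1, rootLo, one_ne_zero, if_false, Nat.cast_one,
        one_add_one_eq_two, e1, e2, e3, e4, signed_neg]
      omega
    have l3 := wordLength_mul_of_gt d3
    refine key (w * simpleRefl N i * simpleRefl N j * simpleRefl N i * simpleRefl N j)
      [j, i, j] [i, j, i] ?_ ?_ ?_ rfl ?_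
    · simp [← mul_assoc, mul_simpleRefl_cancel]
    · have := simpleRefl_braid_four (N := N) hi0 hj1
      rw [show w * simpleRefl N i * simpleRefl N j * simpleRefl N i * simpleRefl N j =
        w * simpleRefl N j * simpleRefl N i * simpleRefl N j * simpleRefl N i by
          simpa only [mul_assoc, mul_right_inj] using this]
      simp [← mul_assoc, mul_simpleRefl_cancel]
    · simp only [List.length_cons, List.length_nil]; omega
    · simpa [mul_assoc] using (hg.four i j hi0 hj1).symm
  · simp only [rootLo, hi0, hj0, if_false] at hi hj
    have d1 : (w * simpleRefl N i).1 (j + 1) < (w * simpleRefl N i).1 (rootLo j) := by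
      simp only [mul_simpleRefl_apply, rootLo, hj0, if_false]
      rw [simplePerm_of_lt (by omega), ← hij', simplePerm_succ hi0, hij']
      rw [hij'] at hi
      omega
    have l1 := wordLength_mul_of_gt d1
    have d2 : (w * simpleRefl N i * simpleRefl N j).1 (i + 1) <
        (w * simpleRefl N i * simpleRefl N j).1 (rootLo i) := by
      simp only [mul_simpleRefl_apply, rootLo, hi0, if_false]
      rw [hij', simplePerm_self hj0, simplePerm_of_lt (by omega),
        simplePerm_other (i := j) (by omega) (by omega) (by omega) (by omega),
        simplePerm_self hi0, hij']
      exact hj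
    have l2 := wordLength_mul_of_gt d2
    have hb := simpleRefl_braid_three (N := N) hi0 c3
    refine key (w * simpleRefl N i * simpleRefl N j * simpleRefl N i) [i, j] [j, i] ?_ ?_ ?_ rfl ?_
    · simp [← mul_assoc, mul_simpleRefl_cancel]
    · rw [show w * simpleRefl N i * simpleRefl N j * simpleRefl N i =
        w * simpleRefl N j * simpleRefl N i * simpleRefl N j by
          simpa only [mul_assoc, mul_right_inj] using hb]
      simp [← mul_assoc, mul_simpleRefl_cancel]
    · simp only [List.length_cons, List.length_nil]; omega
    · simpa [mul_assoc] using hg.three i j hi0 c3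

/-- Two reduced expressions of the same element have the same product in every monoid with a family
satisfying the braid relations. -/
theorem prod_eq_of_reduced {R : Type*} [Monoid R] {g : Fin N → R} (hg : BraidFamily g) {l : ℕ}
    (ω ω' : List (Fin N)) (hω : ω.length = l) (hω' : ω'.length = l)
    (hp : (ω'.map (simpleRefl N)).prod = (ω.map (simpleRefl N)).prod)
    (hl : wordLength (simpleRefl N) (ω.map (simpleRefl N)).prod = l) :
    (ω.map g).prod = (ω'.map g).prod := by
  induction l generalizing ω ω' with
  | zero => rw [List.length_eq_zero_iff.mp hω, List.length_eq_zero_iff.mp hω']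
  | succ l ih =>
    rcases List.eq_nil_or_concat ω with rfl | ⟨η, i, rfl⟩
    · simp at hω
    rcases List.eq_nil_or_concat ω' with rfl | ⟨η', j, rfl⟩
    · simp at hω'
    simp only [List.concat_eq_append, List.length_append, List.length_cons, List.length_nil,
      zero_add, add_left_inj, List.map_append, List.prod_append, List.map_cons, List.map_nil,
      List.prod_cons, List.prod_nil, mul_one] at hω hω' hp hl ⊢
    rcases lt_trichotomy (i : ℕ) j with h | h | h
    · exact prod_eq_of_reduced_of_lt hg ih h hω hω' rfl hp hl
    · obtain rfl := Fin.ext h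
      rw [mul_left_inj] at hp
      have hd := descent_of_reduced rfl (hω ▸ hl)
      have h1 := wordLength_mul_of_gt hd
      rw [mul_simpleRefl_cancel] at h1
      rw [ih η η' hω hω' hp (by omega)]
    · exact (prod_eq_of_reduced_of_lt hg ih h hω' hω rfl hp.symm (hp ▸ hl)).symm

end TypeBHecke
end

noncomputable section

namespace TypeBHecke

/-! ### Multiplication of standard basis elements -/

section Relations

universe u
variable {B : Type u} {M : CoxeterMatrix B} {q : B → ℂ}

theorem gen_comm_of_eq_two {i j : B} (hij : i ≠ j) (h : M i j = 2) :
    gen M q i * gen M q j = gen M q j * gen M q i := by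
  simpa [h, CoxeterSystem.alternatingWord] using gen_braid M q i j hij

theorem gen_braid_of_eq_three {i j : B} (hij : i ≠ j) (h : M i j = 3) :
    gen M q i * gen M q j * gen M q i = gen M q j * gen M q i * gen M q j := by
  simpa [h, CoxeterSystem.alternatingWord, mul_assoc] using (gen_braid M q i j hij).symm

theorem gen_braid_of_eq_four {i j : B} (hij : i ≠ j) (h : M i j = 4) :
    gen M q i * gen M q j * gen M q i * gen M q j =
      gen M q j * gen M q i * gen M q j * gen M q i := by
  simpa [h, CoxeterSystem.alternatingWord, mul_assoc] using gen_braid M q i j hij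

theorem gen_mul_gen (i : B) :
    gen M q i * gen M q i = (1 - q i) • gen M q i + q i • (1 : HeckeAlgebra M q) := by
  have h := gen_quadratic M q i
  rw [sub_mul, mul_add, mul_add, one_mul, one_mul, ← Algebra.commutes,
    ← Algebra.smul_def, sub_eq_zero] at h
  rw [eq_sub_of_add_eq h, Algebra.algebraMap_eq_smul_one]
  module

end Relations

variable {N : ℕ} {p q : ℂ}

theorem typeB_eq_two {i j : Fin N} (h : (i : ℕ) + 1 < j ∨ (j : ℕ) + 1 < i) : typeB N i j = 2 := by
  rw [typeB_apply, if_neg (by rw [Fin.ext_iff]; omega), if_neg (by omega), if_neg (by omega)]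

theorem typeB_eq_three {i j : Fin N} (h0 : (i : ℕ) ≠ 0) (h1 : (j : ℕ) ≠ 0)
    (h : (i : ℕ) + 1 = j ∨ (j : ℕ) + 1 = i) : typeB N i j = 3 := by
  rw [typeB_apply, if_neg (by rw [Fin.ext_iff]; omega), if_neg (by omega), if_pos (by omega)]

theorem typeB_eq_four {i j : Fin N} (h0 : (i : ℕ) = 0) (h : (j : ℕ) = 1) : typeB N i j = 4 := by
  rw [typeB_apply, if_neg (by rw [Fin.ext_iff]; omega), if_pos (by omega)]

theorem braidFamily_gen (N : ℕ) (p q : ℂ) : BraidFamily (gen (typeB N) (paramB N p q)) where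
  comm i j h := gen_comm_of_eq_two (by rw [ne_eq, Fin.ext_iff]; omega) (typeB_eq_two (Or.inl h))
  three i j h0 h := gen_braid_of_eq_three (by rw [ne_eq, Fin.ext_iff]; omega)
    (typeB_eq_three h0 (by omega) (Or.inl h))
  four i j h0 h := gen_braid_of_eq_four (by rw [ne_eq, Fin.ext_iff]; omega) (typeB_eq_four h0 h)

theorem T_eq_prod {ω : List (Fin N)} {w : signedPerm N} (hw : (ω.map (simpleRefl N)).prod = w)
    (hl : ω.length = wordLength (simpleRefl N) w) :
    T N p q w = (ω.map (gen (typeB N) (paramB N p q))).prod := by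
  subst hw
  obtain ⟨h1, h2⟩ := reducedWord_spec (ω.map (simpleRefl N)).prod
  exact (prod_eq_of_reduced (braidFamily_gen N p q) ω _ hl h1 h2 rfl).symm

theorem wordLength_one : wordLength (simpleRefl N) 1 = 0 := by
  rw [wordLength_eq, inversions_one, Finset.card_empty]

theorem T_one : T N p q 1 = 1 :=
  T_eq_prod (ω := []) rfl wordLength_one.symm

theorem T_mul_gen {w : signedPerm N} {i : Fin N} (h : w.1 (rootLo i) < w.1 (i + 1)) :
    T N p q w * gen (typeB N) (paramB N p q) i = T N p q (w * simpleRefl N i) := by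
  obtain ⟨h1, h2⟩ := reducedWord_spec w
  rw [T_eq_prod (w := w * simpleRefl N i) (ω := reducedWord (simpleRefl N) w ++ [i]) (by simp [h2])
    (by rw [wordLength_mul_of_lt h, List.length_append, h1]; rfl)]
  simp [T]

theorem gen_mul_T {w : signedPerm N} {i : Fin N} (h : (w⁻¹).1 (rootLo i) < (w⁻¹).1 (i + 1)) :
    gen (typeB N) (paramB N p q) i * T N p q w = T N p q (simpleRefl N i * w) := by
  obtain ⟨h1, h2⟩ := reducedWord_spec w
  rw [T_eq_prod (w := simpleRefl N i * w) (ω := i :: reducedWord (simpleRefl N) w) (by simp [h2])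
    (by rw [wordLength_simpleRefl_mul, wordLength_mul_of_lt h, wordLength_inv, List.length_cons,
      h1])]
  simp [T]

theorem mul_simpleRefl_lt_iff {w : signedPerm N} {i : Fin N} :
    (w * simpleRefl N i).1 (rootLo i) < (w * simpleRefl N i).1 (i + 1) ↔
      w.1 (i + 1) < w.1 (rootLo i) := by
  rw [mul_simpleRefl_apply, mul_simpleRefl_apply, simplePerm_rootLo, simplePerm_rootHi]

theorem T_mul_gen_of_gt {w : signedPerm N} {i : Fin N} (h : w.1 (i + 1) < w.1 (rootLo i)) :
    T N p q w * gen (typeB N) (paramB N p q) i =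
      (1 - paramB N p q i) • T N p q w + paramB N p q i • T N p q (w * simpleRefl N i) := by
  have h1 := T_mul_gen (p := p) (q := q) (mul_simpleRefl_lt_iff.mpr h)
  rw [mul_simpleRefl_cancel] at h1
  rw [← h1, mul_assoc, gen_mul_gen, mul_add, mul_smul_comm, mul_smul_comm, mul_one]

/-! ### Distinguished coset representatives -/

/-- The class of an integer: `1` above `n`, `-1` below `-n`, and `0` in between. -/
def cls (n : ℕ) (a : ℤ) : ℤ := if (n : ℤ) < a then 1 else if a < -n then -1 else 0

theorem cls_cases (n : ℕ) (a : ℤ) : (cls n a = 1 ∧ (n : ℤ) < a) ∨ (cls n a = -1 ∧ a < -n) ∨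
    (cls n a = 0 ∧ -n ≤ a ∧ a ≤ n) := by
  unfold cls; split_ifs <;> omega

theorem cls_neg (n : ℕ) (a : ℤ) : cls n (-a) = -cls n a := by
  unfold cls; split_ifs <;> omega

theorem lt_of_cls_lt {n : ℕ} {a b : ℤ} (h : cls n a < cls n b) : a < b := by
  have := cls_cases n a
  have := cls_cases n b
  omega

/-- Only `s_n` carries an integer across the border between `n` and `n + 1`. For `n = 0` the
excluded reflection is `t`; for `n > 0` the integers `±1` moved by `t` both have class `0`. -/
theorem cls_simplePerm {n j : ℕ} (h : j ≠ n) (a : ℤ) : cls n (simplePerm j a) = cls n a := by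
  rw [simplePerm_apply]
  unfold cls
  split_ifs <;> omega

theorem cls_rootLo {n j : ℕ} (h : j ≠ n) : cls n (rootLo j) = cls n (j + 1) := by
  rw [← simplePerm_rootHi, cls_simplePerm h]

variable {n k : ℕ}

theorem cls_parabolic {u : signedPerm (n + k)}
    (hu : u ∈ parabolicSubgroup (simpleRefl (n + k)) (idxBS n k)) (a : ℤ) :
    cls n (u.1 a) = cls n a := by
  induction hu using Subgroup.closure_induction generalizing a with
  | mem x hx =>
    obtain ⟨j, hj, rfl⟩ := hx
    exact cls_simplePerm hj a
  | one => rfl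
  | mul x y _ _ hx hy => exact (hx _).trans (hy a)
  | inv x _ hx => rw [← hx, signed_apply_inv]

/-- `x` has no left descent in `B_n × S_k`. -/
def NoLeftDescent (x : signedPerm (n + k)) : Prop :=
  ∀ j : Fin (n + k), (j : ℕ) ≠ n → (x⁻¹).1 (rootLo j) < (x⁻¹).1 (j + 1)

/-- The integers of one class form an interval, and the simple roots of `B_n × S_k` compare the
neighbours in it; the class `-1` is the mirror image of the class `1`. -/
theorem NoLeftDescent.inv_lt {x : signedPerm (n + k)} (hx : NoLeftDescent x) {a b : ℤ}
    (hab : a < b) (ha : |a| ≤ n + k) (hb : |b| ≤ n + k) (h : cls n a = cls n b) :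
    (x⁻¹).1 a < (x⁻¹).1 b := by
  rw [abs_le] at ha hb
  have h1 : ∀ i : ℤ, 1 ≤ i → i < n + k → i ≠ n → (x⁻¹).1 i < (x⁻¹).1 (i + 1) := by
    intro i h1 h2 h3
    have := hx ⟨i.toNat, by omega⟩ (by simp only; omega)
    simpa only [rootLo, show ¬ i.toNat = 0 by omega, if_false,
      show ((i.toNat : ℕ) : ℤ) = i by omega] using this
  have h2 : ∀ i : ℤ, (n : ℤ) + 1 ≤ i → i < n + k → (x⁻¹).1 i < (x⁻¹).1 (i + 1) :=
    fun i hi hi' => h1 i (by omega) hi' (by omega)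
  -- The class `0` is crossed at the origin: the root of `t` gives `x⁻¹(1) > 0 = x⁻¹(0)`, and the
  -- negative half follows by oddness.
  have h3 : ∀ i : ℤ, -(n : ℤ) ≤ i → i < n → (x⁻¹).1 i < (x⁻¹).1 (i + 1) := by
    intro i hi hi'
    have hn : 0 < n := by omega
    have h0 := hx ⟨0, by omega⟩ (by simp only; omega)
    simp only [rootLo, if_true, Nat.cast_zero, zero_add, signed_neg] at h0
    have hz := signed_zero x⁻¹
    rcases lt_trichotomy i 0 with hi0 | hi0 | hi0
    · by_cases h5 : i = -1
      · rw [h5, signed_neg, show (-1 : ℤ) + 1 = 0 by rfl]; omega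
      · have := h1 (-(i + 1)) (by omega) (by omega) (by omega)
        rw [show -(i + 1) + 1 = -i by ring, signed_neg, signed_neg] at this
        omega
    · rw [hi0, zero_add]; omega
    · exact h1 i (by omega) (by omega) (by omega)
  rcases cls_cases n a with ⟨e, ha'⟩ | ⟨e, ha'⟩ | ⟨e, ha'⟩ <;>
    rcases cls_cases n b with ⟨e', hb'⟩ | ⟨e', hb'⟩ | ⟨e', hb'⟩ <;> try omega
  · exact lt_of_forall_lt_succ h2 (by omega) hab (by omega)
  · have := lt_of_forall_lt_succ h2 (i := -b) (j := -a) (by omega) (by omega) (by omega)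
    rw [signed_neg, signed_neg] at this
    omega
  · exact lt_of_forall_lt_succ h3 (by omega) hab (by omega)

/-- A representative without left descents in `B_n × S_k` inverts only pairs of values of different
classes. Every `u` in `B_n × S_k` preserves classes, so all these inversions persist in `u x`, which
is therefore at least as long. -/
theorem mem_X_iff {x : signedPerm (n + k)} : x ∈ X n k ↔ NoLeftDescent x := by
  constructor
  · intro hx j hj
    rcases lt_or_gt_of_ne (root_ne x⁻¹ j) with h | h
    · exact h
    · have h1 := hx (simpleRefl (n + k) j) (Subgroup.subset_closure ⟨j, hj, rfl⟩)
      have h2 := wordLength_mul_of_gt h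
      rw [wordLength_simpleRefl_mul] at h1
      rw [wordLength_inv] at h2
      omega
  · intro hx u hu
    rw [wordLength_eq, wordLength_eq]
    apply Finset.card_le_card
    intro r hr
    rw [mem_inversions] at hr ⊢
    refine ⟨hr.1, ?_⟩
    have hr1 := mem_posRoots.mp hr.1
    have a1 := signed_abs_le x (j := r.1) (by rw [abs_le]; omega)
    have a2 := signed_abs_le x (j := r.2) (by rw [abs_le]; omega)
    push_cast at a1 a2
    have hne : cls n (x.1 r.2) ≠ cls n (x.1 r.1) := by
      intro h
      have := hx.inv_lt hr.2 a2 a1 h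
      rw [signed_inv_apply, signed_inv_apply] at this
      omega
    apply lt_of_cls_lt (n := n)
    change cls n (u.1 (x.1 r.2)) < cls n (u.1 (x.1 r.1))
    rw [cls_parabolic hu, cls_parabolic hu]
    have := cls_cases n (x.1 r.2)
    have := cls_cases n (x.1 r.1)
    have := hr.2
    omega

/-! ### Patterns of classes and Deodhar's lemma -/

/-- The class of the entry of `x` at the position `i`. -/
def entry (x : signedPerm (n + k)) (i : ℤ) : ℤ := cls n (x.1 i)

theorem entry_neg (x : signedPerm (n + k)) (i : ℤ) : entry x (-i) = -entry x i := by
  rw [entry, signed_neg, cls_neg, entry]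

theorem entry_mul (x : signedPerm (n + k)) (i : Fin (n + k)) (j : ℤ) :
    entry (x * simpleRefl (n + k) i) j = entry x (simplePerm i j) := rfl

theorem entry_cases (x : signedPerm (n + k)) (i : ℤ) :
    entry x i = 1 ∨ entry x i = -1 ∨ entry x i = 0 := by
  have := cls_cases n (x.1 i); unfold entry; omega

theorem lt_of_entry_lt {x : signedPerm (n + k)} {i j : ℤ} (h : entry x i < entry x j) :
    x.1 i < x.1 j := lt_of_cls_lt h

theorem rootLo_lt (i : ℕ) : rootLo i < i + 1 := by unfold rootLo; split_ifs <;> omega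

theorem rootLo_ne_zero (i : ℕ) : rootLo i ≠ 0 := by unfold rootLo; split_ifs <;> omega

theorem abs_rootLo_le (i : Fin N) : |rootLo i| ≤ N := by
  have := i.2
  rw [abs_le]; unfold rootLo; split_ifs <;> omega

theorem abs_rootHi_le (i : Fin N) : |((i : ℕ) : ℤ) + 1| ≤ N := by
  have := i.2
  rw [abs_le]; omega

theorem lt_of_entry_eq {x : signedPerm (n + k)} (hx : NoLeftDescent x) {i j : ℤ} (hij : i < j)
    (hi : |i| ≤ n + k) (hj : |j| ≤ n + k) (h : entry x i = entry x j) : x.1 i < x.1 j := by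
  rcases lt_or_gt_of_ne (signed_ne x hij.ne) with h1 | h1
  · exact h1
  · have := hx.inv_lt h1 (by exact_mod_cast signed_abs_le x (by exact_mod_cast hj))
      (by exact_mod_cast signed_abs_le x (by exact_mod_cast hi)) h.symm
    rw [signed_inv_apply, signed_inv_apply] at this
    omega

/-- If `x s_i` has a left descent `s_j` that `x` does not have, then `x s_i = s_j x`. -/
theorem root_of_descent {x : signedPerm (n + k)} (hx : NoLeftDescent x) {i : Fin (n + k)}
    (h : ¬ NoLeftDescent (x * simpleRefl (n + k) i)) :
    ∃ j : Fin (n + k), (j : ℕ) ≠ n ∧ ((x.1 (rootLo i) = rootLo j ∧ x.1 (i + 1) = j + 1) ∨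
      (x.1 (rootLo i) = -(j + 1) ∧ x.1 (i + 1) = -rootLo j)) := by
  unfold NoLeftDescent at h
  push Not at h
  obtain ⟨j, hj, h⟩ := h
  refine ⟨j, hj, ?_⟩
  have h1 := lt_of_le_of_ne h (root_ne _ j).symm
  rw [mul_inv_rev, simpleRefl_inv] at h1
  change simplePerm i ((x⁻¹).1 (j + 1)) < simplePerm i ((x⁻¹).1 (rootLo j)) at h1
  rcases eq_root_of_simplePerm_lt (signed_ne_zero _ (rootLo_ne_zero j))
    (signed_ne_zero _ (by omega)) (hx j hj) h1 with ⟨e1, e2⟩ | ⟨e1, e2⟩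
  · left
    rw [← e1, ← e2, signed_apply_inv, signed_apply_inv]
    exact ⟨rfl, rfl⟩
  · right
    have e3 : ((i : ℕ) : ℤ) + 1 = -(x⁻¹).1 (rootLo j) := by omega
    have e4 : rootLo i = -(x⁻¹).1 (j + 1) := by omega
    rw [e3, e4, signed_neg, signed_neg, signed_apply_inv, signed_apply_inv]
    exact ⟨rfl, rfl⟩

theorem simplePerm_eq_self {i : ℕ} {a : ℤ} (h1 : a ≠ rootLo i) (h2 : a ≠ i + 1)
    (h3 : a ≠ -rootLo i) (h4 : a ≠ -(i + 1)) : simplePerm i a = a := by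
  rw [simplePerm_apply]; unfold rootLo at *; split_ifs at * <;> omega

theorem mul_simpleRefl_eq_of_root {x : signedPerm N} {i j : Fin N}
    (h : (x.1 (rootLo i) = rootLo j ∧ x.1 (i + 1) = j + 1) ∨
      (x.1 (rootLo i) = -(j + 1) ∧ x.1 (i + 1) = -rootLo j)) :
    x * simpleRefl N i = simpleRefl N j * x := by
  ext a
  change x.1 (simplePerm i a) = simplePerm j (x.1 a)
  by_cases h1 : a = rootLo i
  · subst h1
    rw [simplePerm_rootLo]
    rcases h with ⟨e1, e2⟩ | ⟨e1, e2⟩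
    · rw [e1, e2, simplePerm_rootLo]
    · rw [e1, e2, simplePerm_neg, simplePerm_rootHi]
  by_cases h2 : a = i + 1
  · subst h2
    rw [simplePerm_rootHi]
    rcases h with ⟨e1, e2⟩ | ⟨e1, e2⟩
    · rw [e1, e2, simplePerm_rootHi]
    · rw [e1, e2, simplePerm_neg, simplePerm_rootLo]
  by_cases h3 : a = -rootLo i
  · subst h3
    rw [simplePerm_neg, simplePerm_rootLo, signed_neg, signed_neg]
    rcases h with ⟨e1, e2⟩ | ⟨e1, e2⟩
    · rw [e1, e2, simplePerm_neg, simplePerm_rootLo]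
    · rw [e1, e2, neg_neg, neg_neg, simplePerm_rootHi]
  by_cases h4 : a = -(i + 1)
  · subst h4
    rw [simplePerm_neg, simplePerm_rootHi, signed_neg, signed_neg]
    rcases h with ⟨e1, e2⟩ | ⟨e1, e2⟩
    · rw [e1, e2, simplePerm_neg, simplePerm_rootHi]
    · rw [e1, e2, neg_neg, neg_neg, simplePerm_rootLo]
  rw [simplePerm_eq_self h1 h2 h3 h4]
  have g1 := signed_ne x h1
  have g2 := signed_ne x h2
  have g3 := signed_ne x h3
  have g4 := signed_ne x h4
  rw [signed_neg] at g3 g4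
  rw [simplePerm_eq_self] <;> rcases h with ⟨e1, e2⟩ | ⟨e1, e2⟩ <;> rw [e1] at g1 g3 <;>
    rw [e2] at g2 g4 <;> omega

/-- A new left descent `s_j` of `x s_i` would make `x` carry the root of `s_i` to that of `s_j` up
to sign, and the two values in the latter have equal classes because `j ≠ n`. -/
theorem mul_mem_X {x : signedPerm (n + k)} (hx : x ∈ X n k) {i : Fin (n + k)}
    (h : entry x (rootLo i) ≠ entry x (i + 1)) : x * simpleRefl (n + k) i ∈ X n k := by
  rw [mem_X_iff] at hx ⊢
  by_contra hc
  obtain ⟨j, hj, hr⟩ := root_of_descent hx hc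
  apply h
  unfold entry
  rcases hr with ⟨e1, e2⟩ | ⟨e1, e2⟩
  · rw [e1, e2, cls_rootLo hj]
  · rw [e1, e2, cls_neg, cls_neg, cls_rootLo hj]

/-- A distinguished representative is increasing along positions of equal class. `x` and `x s_i`
order the two positions oppositely, so they cannot both be distinguished. -/
theorem exists_root_of_entry_eq {x : signedPerm (n + k)} (hx : x ∈ X n k) {i : Fin (n + k)}
    (h : entry x (rootLo i) = entry x (i + 1)) :
    ∃ j : Fin (n + k), (j : ℕ) ≠ n ∧ ((x.1 (rootLo i) = rootLo j ∧ x.1 (i + 1) = j + 1) ∨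
      (x.1 (rootLo i) = -(j + 1) ∧ x.1 (i + 1) = -rootLo j)) := by
  rw [mem_X_iff] at hx
  apply root_of_descent hx
  intro hc
  have := lt_of_entry_eq hc (rootLo_lt i) (by exact_mod_cast abs_rootLo_le i)
    (by exact_mod_cast abs_rootHi_le i)
    (by rw [entry_mul, entry_mul, simplePerm_rootLo, simplePerm_rootHi, h])
  have h2 := lt_of_entry_eq hx (rootLo_lt i) (by exact_mod_cast abs_rootLo_le i)
    (by exact_mod_cast abs_rootHi_le i) h
  rw [mul_simpleRefl_lt_iff] at this
  omega

/-- `y x⁻¹` maps each class to itself and is increasing on it, so it is the identity. -/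
theorem eq_of_entry_eq {x y : signedPerm (n + k)} (hx : x ∈ X n k) (hy : y ∈ X n k)
    (h : ∀ i : ℤ, 1 ≤ i → i ≤ n + k → entry x i = entry y i) : x = y := by
  rw [mem_X_iff] at hx hy
  have h' : ∀ i : ℤ, |i| ≤ n + k → entry x i = entry y i := by
    intro i hi
    rw [abs_le] at hi
    rcases lt_trichotomy i 0 with h0 | h0 | h0
    · have := h (-i) (by omega) (by omega)
      rw [entry_neg, entry_neg] at this
      omega
    · rw [h0, entry, entry, signed_zero, signed_zero]
    · exact h i (by omega) (by omega)
  have hcls : ∀ a : ℤ, |a| ≤ n + k → cls n (y.1 ((x⁻¹).1 a)) = cls n a := by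
    intro a ha
    have := h' ((x⁻¹).1 a) (by exact_mod_cast signed_abs_le x⁻¹ (by exact_mod_cast ha))
    rw [entry, signed_apply_inv] at this
    exact this.symm
  have hmono : ∀ a : ℤ, |a| ≤ n + k → |a + 1| ≤ n + k → cls n a = cls n (a + 1) →
      y.1 ((x⁻¹).1 a) < y.1 ((x⁻¹).1 (a + 1)) := by
    intro a ha ha' hc
    refine lt_of_entry_eq hy (hx.inv_lt (by omega) ha ha' hc)
      (by exact_mod_cast signed_abs_le x⁻¹ (by exact_mod_cast ha))
      (by exact_mod_cast signed_abs_le x⁻¹ (by exact_mod_cast ha')) ?_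
    rw [entry, entry, hcls a ha, hcls _ ha', hc]
  have habs : ∀ a : ℤ, |a| ≤ n + k → |y.1 ((x⁻¹).1 a)| ≤ n + k := fun a ha => by
    exact_mod_cast signed_abs_le y (signed_abs_le x⁻¹ (by exact_mod_cast ha))
  have key : y * x⁻¹ = 1 := by
    apply signed_ext
    intro a h1 h2
    push_cast at h2
    change y.1 ((x⁻¹).1 a) = a
    by_cases hn : a ≤ n
    · refine eq_self_of_strictMono_Icc (f := fun a => y.1 ((x⁻¹).1 a)) (a := -n) (b := n)
        ?_ ?_ a (by omega) hn
      · intro i hi hi'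
        refine hmono i (by rw [abs_le]; omega) (by rw [abs_le]; omega) ?_
        have := cls_cases n i
        have := cls_cases n (i + 1)
        omega
      · intro i hi hi'
        have e := hcls i (by rw [abs_le]; omega)
        have := cls_cases n i
        have := cls_cases n (y.1 ((x⁻¹).1 i))
        omega
    · refine eq_self_of_strictMono_Icc (f := fun a => y.1 ((x⁻¹).1 a)) (a := n + 1) (b := n + k)
        ?_ ?_ a (by omega) h2
      · intro i hi hi'
        refine hmono i (by rw [abs_le]; omega) (by rw [abs_le]; omega) ?_
        have := cls_cases n i
        have := cls_cases n (i + 1)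
        omega
      · intro i hi hi'
        have e := hcls i (by rw [abs_le]; omega)
        have := cls_cases n i
        have := cls_cases n (y.1 ((x⁻¹).1 i))
        have := abs_le.mp (habs i (by rw [abs_le]; omega))
        omega
  exact (mul_inv_eq_one.mp key).symm

/-- `i ↦ |x(i)|` permutes the positive positions, and the entries of class `0` are those with
absolute value in `{1, …, n}`. -/
theorem card_entry_eq_zero (x : signedPerm (n + k)) :
    ((Finset.Icc 1 ((n : ℤ) + k)).filter fun i => entry x i = 0).card = n := by
  have hc : (Finset.Icc 1 (n : ℤ)).card = n := by simp
  refine Eq.trans ?_ hc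
  have inj : ∀ (w : signedPerm (n + k)) (a : ℤ), |(w⁻¹).1 (|w.1 a|)| = |a| := by
    intro w a
    rcases abs_choice (w.1 a) with h | h
    · rw [h, signed_inv_apply]
    · rw [h, signed_neg, signed_inv_apply, abs_neg]
  refine Finset.card_nbij' (fun i => |x.1 i|) (fun a => |(x⁻¹).1 a|) ?_ ?_ ?_ ?_
  · intro i hi
    rw [Finset.mem_coe, Finset.mem_filter, Finset.mem_Icc, entry] at hi
    simp only [Finset.coe_Icc, Set.mem_Icc]
    have h1 := cls_cases n (x.1 i)
    have h2 := signed_ne_zero x (j := i) (by omega)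
    refine ⟨Int.one_le_abs h2, abs_le.mpr (by omega)⟩
  · intro a ha
    simp only [Finset.coe_Icc, Set.mem_Icc] at ha
    rw [Finset.mem_coe, Finset.mem_filter, Finset.mem_Icc]
    refine ⟨⟨Int.one_le_abs (signed_ne_zero _ (by omega)), ?_⟩, ?_⟩
    · exact_mod_cast signed_abs_le x⁻¹ (j := a) (by rw [abs_le]; omega)
    · have h0 : cls n a = 0 := by have := cls_cases n a; omega
      change entry x (|(x⁻¹).1 a|) = 0
      rcases abs_choice ((x⁻¹).1 a) with h | h
      · rw [h, entry, signed_apply_inv, h0]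
      · rw [h, entry_neg, entry, signed_apply_inv, h0, neg_zero]
  · intro i hi
    rw [Finset.mem_coe, Finset.mem_filter, Finset.mem_Icc] at hi
    simp only [inj]
    exact abs_of_pos (by omega)
  · intro a ha
    simp only [Finset.coe_Icc, Set.mem_Icc] at ha
    have := inj x⁻¹ a
    rw [inv_inv] at this
    simp only [this]
    exact abs_of_pos (by omega)

/-- The longest distinguished representative has `n` entries of class `0`, followed by `k` entries
of class `-1`. -/
theorem entry_longestRep {i : ℤ} (h1 : 1 ≤ i) (h2 : i ≤ n + k) :
    entry (longestRep n k : signedPerm (n + k)) i = if i ≤ n then 0 else -1 := by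
  set w : signedPerm (n + k) := (longestRep n k : signedPerm (n + k)) with hw
  -- A strict ascent of the pattern at `j` would make `w s_j` a longer element of `X_{n,k}`.
  have hmax : ∀ j : Fin (n + k), entry w (j + 1) ≤ entry w (rootLo j) := by
    intro j
    by_contra! hc
    have h3 := (exists_longest n k).choose_spec ⟨_, mul_mem_X (longestRep n k).2 hc.ne⟩
    have h4 := wordLength_mul_of_lt (lt_of_entry_lt hc)
    change wordLength _ (w * _) ≤ wordLength _ w at h3
    omega
  have hanti : ∀ j : ℤ, 1 ≤ j → j < n + k → entry w (j + 1) ≤ entry w j := by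
    intro j h3 h4
    have := hmax ⟨j.toNat, by omega⟩
    simpa only [rootLo, show ¬ j.toNat = 0 by omega, if_false,
      show ((j.toNat : ℕ) : ℤ) = j by omega] using this
  have hanti' : ∀ (j : ℤ) (m : ℕ), 1 ≤ j → j + m ≤ n + k → entry w (j + m) ≤ entry w j := by
    intro j m h3
    induction m with
    | zero => simp
    | succ m ih =>
      intro h4
      push_cast at h4 ⊢
      have := ih (by omega)
      have := hanti (j + m) (by omega) (by omega)
      rw [← add_assoc]; omega
  have hle : ∀ a b : ℤ, 1 ≤ a → a ≤ b → b ≤ n + k → entry w b ≤ entry w a := by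
    intro a b h3 h4 h5
    have := hanti' a (b - a).toNat h3 (by omega)
    rwa [show a + ((b - a).toNat : ℤ) = b by omega] at this
  have h0 : entry w 1 ≤ 0 := by
    have := hmax ⟨0, by omega⟩
    simp only [rootLo, if_true, Nat.cast_zero, zero_add, entry_neg] at this
    omega
  have hneg : ∀ a : ℤ, 1 ≤ a → a ≤ n + k → entry w a = 0 ∨ entry w a = -1 := by
    intro a h3 h4
    have := hle 1 a le_rfl h3 h4
    have := entry_cases w a
    omega
  have hcard := card_entry_eq_zero w
  set Z := (Finset.Icc 1 ((n : ℤ) + k)).filter fun i => entry w i = 0 with hZ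
  -- The pattern decreases weakly and takes only the values `0` and `-1`, so its zeros form an
  -- initial segment, and there are `n` of them.
  have hsub : Z ⊆ Finset.Icc 1 (n : ℤ) := by
    intro a ha
    rw [hZ, Finset.mem_filter, Finset.mem_Icc] at ha
    rw [Finset.mem_Icc]
    refine ⟨ha.1.1, ?_⟩
    have hs : Finset.Icc 1 a ⊆ Z := by
      intro b hb
      rw [Finset.mem_Icc] at hb
      rw [hZ, Finset.mem_filter, Finset.mem_Icc]
      have := hle b a hb.1 hb.2 ha.1.2
      have := hneg b hb.1 (by omega)
      refine ⟨by omega, by omega⟩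
    have := Finset.card_le_card hs
    rw [hcard, Int.card_Icc] at this
    omega
  have hZeq : Z = Finset.Icc 1 (n : ℤ) :=
    Finset.eq_of_subset_of_card_le hsub (by rw [hcard]; simp)
  have hmem : i ∈ Z ↔ i ≤ n := by
    rw [hZeq, Finset.mem_Icc]; omega
  rw [hZ, Finset.mem_filter, Finset.mem_Icc] at hmem
  have := hneg i h1 h2
  split_ifs with h
  · exact (hmem.mpr h).2
  · rcases this with h' | h'
    · exact absurd (hmem.mp ⟨⟨h1, h2⟩, h'⟩) h
    · exact h'

end TypeBHecke
end

noncomputable section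

namespace TypeBHecke

/-! ### The module induced from `H_{p,q}(B_n × S_k)` -/

theorem prod_alternatingWord_of_braidFamily {N : ℕ} {R : Type*} [Monoid R] {g : Fin N → R}
    (hg : BraidFamily g) (i j : Fin N) (hij : i ≠ j) :
    ((CoxeterSystem.alternatingWord i j (typeB N i j)).map g).prod =
      ((CoxeterSystem.alternatingWord j i (typeB N i j)).map g).prod := by
  rw [ne_eq, Fin.ext_iff] at hij
  by_cases h2 : (i : ℕ) + 1 < j ∨ (j : ℕ) + 1 < i
  · rw [typeB_eq_two h2]
    rcases h2 with h | h
    · simpa [CoxeterSystem.alternatingWord] using hg.comm i j h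
    · simpa [CoxeterSystem.alternatingWord] using (hg.comm j i h).symm
  by_cases h0 : (i : ℕ) = 0
  · have h1 : (j : ℕ) = 1 := by omega
    rw [typeB_eq_four h0 h1]
    simpa [CoxeterSystem.alternatingWord, mul_assoc] using hg.four i j h0 h1
  by_cases h1 : (j : ℕ) = 0
  · have h1' : (i : ℕ) = 1 := by omega
    rw [CoxeterMatrix.symmetric, typeB_eq_four h1 h1']
    simpa [CoxeterSystem.alternatingWord, mul_assoc] using (hg.four j i h1 h1').symm
  · rw [typeB_eq_three h0 h1 (by omega)]
    rcases (show (i : ℕ) + 1 = j ∨ (j : ℕ) + 1 = i by omega) with h | h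
    · simpa [CoxeterSystem.alternatingWord, mul_assoc] using (hg.three i j h0 h).symm
    · simpa [CoxeterSystem.alternatingWord, mul_assoc] using hg.three j i h1 h

theorem simpleRefl_injective {N : ℕ} : Function.Injective (simpleRefl N) := by
  have key : ∀ i j : Fin N, (i : ℕ) < j → simpleRefl N i ≠ simpleRefl N j := by
    intro i j h e
    have h1 : (simpleRefl N i).1 (j + 1) = (simpleRefl N j).1 (j + 1) := by rw [e]
    rw [simpleRefl_apply, simpleRefl_apply, simplePerm_of_lt (by omega), simplePerm_rootHi] at h1
    have := rootLo_lt j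
    omega
  intro i j e
  rcases lt_trichotomy (i : ℕ) j with h | h | h
  · exact absurd e (key i j h)
  · exact Fin.ext h
  · exact absurd e.symm (key j i h)

variable {n k : ℕ} {p q : ℂ} {A : Type*} [Ring A] [Algebra ℂ A]

/-- The image in `A` of the generator of `H_{p,q}(B_n × S_k)` with index `j`. -/
def parGen (f : HeckeBS n k p q →ₐ[ℂ] A) (j : Fin (n + k)) (hj : (j : ℕ) ≠ n) : A :=
  f (gen _ _ ⟨j, hj⟩)

theorem parGen_mul_self (f : HeckeBS n k p q →ₐ[ℂ] A) (j : Fin (n + k)) (hj : (j : ℕ) ≠ n) :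
    parGen f j hj * parGen f j hj =
      (1 - paramB (n + k) p q j) • parGen f j hj + paramB (n + k) p q j • (1 : A) := by
  have h := congrArg f (gen_mul_gen (M := parabolic (typeB (n + k)) (idxBS n k))
    (q := fun i => paramB (n + k) p q i) ⟨j, hj⟩)
  rw [map_mul, map_add, map_smul, map_smul, map_one] at h
  exact h

theorem parGen_comm (f : HeckeBS n k p q →ₐ[ℂ] A) {i j : Fin (n + k)} (hi : (i : ℕ) ≠ n)
    (hj : (j : ℕ) ≠ n) (h : (i : ℕ) + 1 < j ∨ (j : ℕ) + 1 < i) :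
    parGen f i hi * parGen f j hj = parGen f j hj * parGen f i hi := by
  have h := congrArg f (gen_comm_of_eq_two (M := parabolic (typeB (n + k)) (idxBS n k))
    (q := fun i => paramB (n + k) p q i) (i := ⟨i, hi⟩) (j := ⟨j, hj⟩)
    (by rw [ne_eq, Subtype.ext_iff, Fin.ext_iff]; simp only; omega) (typeB_eq_two h))
  rwa [map_mul, map_mul] at h

theorem parGen_three (f : HeckeBS n k p q →ₐ[ℂ] A) {i j : Fin (n + k)} (hi : (i : ℕ) ≠ n)
    (hj : (j : ℕ) ≠ n) (hi0 : (i : ℕ) ≠ 0) (hj0 : (j : ℕ) ≠ 0)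
    (h : (i : ℕ) + 1 = j ∨ (j : ℕ) + 1 = i) :
    parGen f i hi * parGen f j hj * parGen f i hi =
      parGen f j hj * parGen f i hi * parGen f j hj := by
  have h := congrArg f (gen_braid_of_eq_three (M := parabolic (typeB (n + k)) (idxBS n k))
    (q := fun i => paramB (n + k) p q i) (i := ⟨i, hi⟩) (j := ⟨j, hj⟩)
    (by rw [ne_eq, Subtype.ext_iff, Fin.ext_iff]; simp only; omega) (typeB_eq_three hi0 hj0 h))
  rwa [map_mul, map_mul, map_mul, map_mul] at h

theorem parGen_four (f : HeckeBS n k p q →ₐ[ℂ] A) {i j : Fin (n + k)} (hi : (i : ℕ) ≠ n)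
    (hj : (j : ℕ) ≠ n) (hi0 : (i : ℕ) = 0) (hj1 : (j : ℕ) = 1) :
    parGen f i hi * parGen f j hj * parGen f i hi * parGen f j hj =
      parGen f j hj * parGen f i hi * parGen f j hj * parGen f i hi := by
  have h := congrArg f (gen_braid_of_eq_four (M := parabolic (typeB (n + k)) (idxBS n k))
    (q := fun i => paramB (n + k) p q i) (i := ⟨i, hi⟩) (j := ⟨j, hj⟩)
    (by rw [ne_eq, Subtype.ext_iff, Fin.ext_iff]; simp only; omega) (typeB_eq_four hi0 hj1))
  rwa [map_mul, map_mul, map_mul, map_mul, map_mul, map_mul] at h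

theorem exists_conj_of_entry_eq {x : signedPerm (n + k)} (hx : x ∈ X n k) {i : Fin (n + k)}
    (h : entry x (rootLo i) = entry x (i + 1)) :
    ∃ j : Fin (n + k), (j : ℕ) ≠ n ∧ x * simpleRefl (n + k) i = simpleRefl (n + k) j * x := by
  obtain ⟨j, hj, hr⟩ := exists_root_of_entry_eq hx h
  exact ⟨j, hj, mul_simpleRefl_eq_of_root hr⟩

theorem entry_eq_of_conj {x : signedPerm (n + k)} {i j : Fin (n + k)} (hj : (j : ℕ) ≠ n)
    (h : x * simpleRefl (n + k) i = simpleRefl (n + k) j * x) :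
    entry x (rootLo i) = entry x (i + 1) := by
  have h1 : (x * simpleRefl (n + k) i).1 (i + 1) = simplePerm j (x.1 (i + 1)) := by rw [h]; rfl
  rw [mul_simpleRefl_apply, simplePerm_rootHi] at h1
  rw [entry, h1, cls_simplePerm hj, entry]

/-- The root of `t` is the only simple root whose two entries are opposite, and the odd map `x`
preserves this property. It ensures that `T_i` and the generator `T_j` that replaces it have the
same parameter. -/
theorem zero_iff_of_conj {x : signedPerm (n + k)} (hx : x ∈ X n k) {i j : Fin (n + k)}
    (hj : (j : ℕ) ≠ n) (h : x * simpleRefl (n + k) i = simpleRefl (n + k) j * x) :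
    (i : ℕ) = 0 ↔ (j : ℕ) = 0 := by
  obtain ⟨j', hj', hr⟩ := exists_root_of_entry_eq hx (entry_eq_of_conj hj h)
  have h1 := mul_simpleRefl_eq_of_root hr
  rw [h, mul_left_inj] at h1
  rw [simpleRefl_injective h1]
  have key : x.1 (rootLo i) = -x.1 (i + 1) ↔ (i : ℕ) = 0 := by
    rw [← signed_neg, x.1.injective.eq_iff]
    unfold rootLo; split_ifs <;> omega
  rw [← key]
  have := rootLo_lt j'
  have h2 : rootLo j' = -(j' + 1) ↔ (j' : ℕ) = 0 := by unfold rootLo; split_ifs <;> omega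
  rw [← h2]
  omega

/-! ### The operators of the induced module -/

/-- The representative `x s_i` if it is distinguished, else `x`. -/
def shift (i : Fin (n + k)) (x : X n k) : X n k :=
  if h : entry (x : signedPerm (n + k)) (rootLo i) ≠ entry (x : signedPerm (n + k)) (i + 1) then
    ⟨x * simpleRefl (n + k) i, mul_mem_X x.2 h⟩ else x

theorem shift_coe {i : Fin (n + k)} {x : X n k}
    (h : entry (x : signedPerm (n + k)) (rootLo i) ≠ entry (x : signedPerm (n + k)) (i + 1)) :
    (shift i x : signedPerm (n + k)) = x * simpleRefl (n + k) i := by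
  rw [shift, dif_pos h]

theorem entry_shift_lo {i : Fin (n + k)} {x : X n k}
    (h : entry (x : signedPerm (n + k)) (rootLo i) ≠ entry (x : signedPerm (n + k)) (i + 1)) :
    entry (shift i x : signedPerm (n + k)) (rootLo i) = entry (x : signedPerm (n + k)) (i + 1) := by
  rw [shift_coe h, entry_mul, simplePerm_rootLo]

theorem entry_shift_hi {i : Fin (n + k)} {x : X n k}
    (h : entry (x : signedPerm (n + k)) (rootLo i) ≠ entry (x : signedPerm (n + k)) (i + 1)) :
    entry (shift i x : signedPerm (n + k)) (i + 1) = entry (x : signedPerm (n + k)) (rootLo i) := by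
  rw [shift_coe h, entry_mul, simplePerm_rootHi]

theorem shift_shift {i : Fin (n + k)} {x : X n k}
    (h : entry (x : signedPerm (n + k)) (rootLo i) ≠ entry (x : signedPerm (n + k)) (i + 1)) :
    shift i (shift i x) = x := by
  apply Subtype.ext
  rw [shift_coe, shift_coe h, mul_simpleRefl_cancel]
  rw [entry_shift_lo h, entry_shift_hi h]
  exact h.symm

/-- The image in `A` of the generator `s_j` of `B_n × S_k` with `x s_i = s_j x`, if there is one. -/
def twist (f : HeckeBS n k p q →ₐ[ℂ] A) (i : Fin (n + k)) (x : X n k) : A :=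
  if h : entry (x : signedPerm (n + k)) (rootLo i) = entry (x : signedPerm (n + k)) (i + 1) then
    parGen f (exists_conj_of_entry_eq x.2 h).choose (exists_conj_of_entry_eq x.2 h).choose_spec.1
  else 0

theorem twist_eq (f : HeckeBS n k p q →ₐ[ℂ] A) {i j : Fin (n + k)} {x : X n k} (hj : (j : ℕ) ≠ n)
    (h : (x : signedPerm (n + k)) * simpleRefl (n + k) i = simpleRefl (n + k) j * x) :
    twist f i x = parGen f j hj := by
  have h1 := entry_eq_of_conj hj h
  have h2 := (exists_conj_of_entry_eq x.2 h1).choose_spec.2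
  have h3 := mul_right_cancel (h.symm.trans h2)
  rw [twist, dif_pos h1]
  congr 1
  exact (simpleRefl_injective h3).symm

/-- The right action of the generator `T_i` on the induced module with basis `X_{n,k}`. -/
def actGen (f : HeckeBS n k p q →ₐ[ℂ] A) (i : Fin (n + k)) : Module.End A (X n k → A) where
  toFun v x :=
    -- The cases are the transpose of the action on basis vectors: the coordinate at `x` of `v T_i`
    -- collects what comes from `e_{x s_i}` and from `e_x`. Hence the parameter appears as a factor
    -- of `v(x s_i)` when `x` is the shorter of the two.
    if entry (x : signedPerm (n + k)) (i + 1) < entry (x : signedPerm (n + k)) (rootLo i) then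
      v (shift i x) + (1 - paramB (n + k) p q i) • v x
    else if entry (x : signedPerm (n + k)) (rootLo i) < entry (x : signedPerm (n + k)) (i + 1) then
      paramB (n + k) p q i • v (shift i x)
    else v x * twist f i x
  map_add' v w := by
    funext x
    simp only [Pi.add_apply]
    split_ifs
    · rw [smul_add]; abel
    · rw [smul_add]
    · rw [add_mul]
  map_smul' a v := by
    funext x
    simp only [Pi.smul_apply, smul_eq_mul, RingHom.id_apply]
    split_ifs
    · rw [mul_add, mul_smul_comm]
    · rw [mul_smul_comm]
    · rw [mul_assoc]

section ActGen

variable (f : HeckeBS n k p q →ₐ[ℂ] A) {i : Fin (n + k)} {x : X n k} (v : X n k → A)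

theorem actGen_apply_gt
    (h : entry (x : signedPerm (n + k)) (i + 1) < entry (x : signedPerm (n + k)) (rootLo i)) :
    actGen f i v x = v (shift i x) + (1 - paramB (n + k) p q i) • v x := if_pos h

theorem actGen_apply_lt
    (h : entry (x : signedPerm (n + k)) (rootLo i) < entry (x : signedPerm (n + k)) (i + 1)) :
    actGen f i v x = paramB (n + k) p q i • v (shift i x) :=
  (if_neg h.le.not_gt).trans (if_pos h)

theorem actGen_apply_eq
    (h : entry (x : signedPerm (n + k)) (rootLo i) = entry (x : signedPerm (n + k)) (i + 1)) :
    actGen f i v x = v x * twist f i x :=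
  (if_neg h.le.not_gt).trans (if_neg h.ge.not_gt)

theorem actGen_actGen :
    actGen f i (actGen f i v) =
      (1 - paramB (n + k) p q i) • actGen f i v + paramB (n + k) p q i • v := by
  funext x
  rw [Pi.add_apply, Pi.smul_apply, Pi.smul_apply]
  rcases lt_trichotomy (entry (x : signedPerm (n + k)) (rootLo i))
    (entry (x : signedPerm (n + k)) (i + 1)) with h | h | h
  · rw [actGen_apply_lt f _ h, actGen_apply_gt, actGen_apply_lt f _ h, shift_shift h.ne]
    · module
    · rwa [entry_shift_lo h.ne, entry_shift_hi h.ne]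
  · obtain ⟨j, hj, hc⟩ := exists_conj_of_entry_eq x.2 h
    have hp : paramB (n + k) p q j = paramB (n + k) p q i := by
      unfold paramB; simp only [zero_iff_of_conj x.2 hj hc]
    rw [actGen_apply_eq f _ h, actGen_apply_eq f _ h, twist_eq f hj hc, mul_assoc,
      parGen_mul_self, mul_add, mul_smul_comm, mul_smul_comm, mul_one, hp]
  · rw [actGen_apply_gt f _ h, actGen_apply_lt, shift_shift h.ne', add_comm]
    rwa [entry_shift_lo h.ne', entry_shift_hi h.ne']

end ActGen

instance (n k : ℕ) : DecidableEq (X n k) := Classical.decEq _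

/-- The basis vector of the induced module attached to `x`. -/
def basisVec (A : Type*) [Ring A] (x : X n k) : X n k → A := Pi.single x 1

theorem basisVec_self {A : Type*} [Ring A] (x : X n k) : basisVec A x x = 1 := Pi.single_eq_same x 1

theorem basisVec_of_ne {A : Type*} [Ring A] {x y : X n k} (h : y ≠ x) : basisVec A x y = 0 := Pi.single_eq_of_ne h 1

section Basis

variable (f : HeckeBS n k p q →ₐ[ℂ] A) {i : Fin (n + k)} {x y : X n k}

theorem actGen_basisVec_lt
    (h : entry (x : signedPerm (n + k)) (rootLo i) < entry (x : signedPerm (n + k)) (i + 1))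
    (hy : (y : signedPerm (n + k)) = x * simpleRefl (n + k) i) :
    actGen f i (basisVec A x) = basisVec A y := by
  have hys : shift i x = y := Subtype.ext ((shift_coe h.ne).trans hy.symm)
  have hxs : shift i y = x := by rw [← hys, shift_shift h.ne]
  have hy' : entry (y : signedPerm (n + k)) (i + 1) < entry (y : signedPerm (n + k)) (rootLo i) := by
    rwa [← hys, entry_shift_lo h.ne, entry_shift_hi h.ne]
  have hne : x ≠ y := by rintro rfl; omega
  funext z
  by_cases hz : z = y
  · subst hz
    rw [actGen_apply_gt f _ hy', hxs, basisVec_self, basisVec_self, basisVec_of_ne hne.symm,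
      smul_zero, add_zero]
  rw [basisVec_of_ne hz]
  by_cases hz' : z = x
  · subst hz'
    rw [actGen_apply_lt f _ h, hys, basisVec_of_ne hne.symm, smul_zero]
  rcases lt_trichotomy (entry (z : signedPerm (n + k)) (rootLo i))
    (entry (z : signedPerm (n + k)) (i + 1)) with h1 | h1 | h1
  · rw [actGen_apply_lt f _ h1, basisVec_of_ne, smul_zero]
    intro e; apply hz; rw [← hys, ← e, shift_shift h1.ne]
  · rw [actGen_apply_eq f _ h1, basisVec_of_ne hz', zero_mul]
  · rw [actGen_apply_gt f _ h1, basisVec_of_ne hz', basisVec_of_ne, smul_zero, add_zero]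
    intro e; apply hz; rw [← hys, ← e, shift_shift h1.ne']

theorem actGen_basisVec_gt
    (h : entry (x : signedPerm (n + k)) (i + 1) < entry (x : signedPerm (n + k)) (rootLo i))
    (hy : (y : signedPerm (n + k)) = x * simpleRefl (n + k) i) :
    actGen f i (basisVec A y) = basisVec A x ∧ actGen f i (basisVec A x) =
      (1 - paramB (n + k) p q i) • basisVec A x + paramB (n + k) p q i • basisVec A y := by
  have h1 : actGen f i (basisVec A y) = basisVec A x := by
    apply actGen_basisVec_lt
    · rwa [hy, entry_mul, entry_mul, simplePerm_rootLo, simplePerm_rootHi]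
    · rw [hy, mul_simpleRefl_cancel]
  refine ⟨h1, ?_⟩
  -- Since `e_x = e_y T_i`, the quadratic relation determines `e_x T_i`.
  rw [← h1, actGen_actGen]

theorem actGen_basisVec_eq {j : Fin (n + k)} (hj : (j : ℕ) ≠ n)
    (h : (x : signedPerm (n + k)) * simpleRefl (n + k) i = simpleRefl (n + k) j * x) :
    actGen f i (basisVec A x) = parGen f j hj • basisVec A x := by
  have h0 := entry_eq_of_conj hj h
  funext z
  rw [Pi.smul_apply, smul_eq_mul]
  by_cases hz : z = x
  · subst hz
    rw [actGen_apply_eq f _ h0, basisVec_self, one_mul, mul_one, twist_eq f hj h]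
  rw [basisVec_of_ne hz, mul_zero]
  rcases lt_trichotomy (entry (z : signedPerm (n + k)) (rootLo i))
    (entry (z : signedPerm (n + k)) (i + 1)) with h1 | h1 | h1
  · rw [actGen_apply_lt f _ h1, basisVec_of_ne, smul_zero]
    intro e
    rw [← e, entry_shift_lo h1.ne, entry_shift_hi h1.ne] at h0
    exact h1.ne h0.symm
  · rw [actGen_apply_eq f _ h1, basisVec_of_ne hz, zero_mul]
  · rw [actGen_apply_gt f _ h1, basisVec_of_ne hz, basisVec_of_ne, smul_zero, add_zero]
    intro e
    rw [← e, entry_shift_lo h1.ne', entry_shift_hi h1.ne'] at h0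
    exact h1.ne h0

end Basis

theorem linearMap_ext_basisVec {A : Type*} [Ring A] {F G : Module.End A (X n k → A)}
    (h : ∀ x, F (basisVec A x) = G (basisVec A x)) : F = G := by
  refine LinearMap.pi_ext fun x a => ?_
  have : (Pi.single x a : X n k → A) = a • basisVec A x := by
    rw [basisVec, ← Pi.single_smul, smul_eq_mul, mul_one]
  rw [this, map_smul, map_smul, h]

/-- To prove a property of all basis vectors that is stable under `T_i` and `T_j`, it suffices to
treat the representatives without descents at `i` and `j`. -/
theorem basisVec_induction (f : HeckeBS n k p q →ₐ[ℂ] A) (i j : Fin (n + k))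
    {P : (X n k → A) → Prop} (hi : ∀ v, P v → P (actGen f i v)) (hj : ∀ v, P v → P (actGen f j v))
    (h0 : ∀ x : X n k,
      entry (x : signedPerm (n + k)) (rootLo i) ≤ entry (x : signedPerm (n + k)) (i + 1) →
      entry (x : signedPerm (n + k)) (rootLo j) ≤ entry (x : signedPerm (n + k)) (j + 1) →
      P (basisVec A x)) (x : X n k) : P (basisVec A x) := by
  -- A strict descent at `i` gives `e_x = e_{x s_i} T_i` with `x s_i` shorter, and likewise for `j`.
  induction hl : wordLength (simpleRefl (n + k)) (x : signedPerm (n + k))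
    using Nat.strong_induction_on generalizing x with
  | _ l ih =>
    by_cases h1 : entry (x : signedPerm (n + k)) (rootLo i) ≤ entry (x : signedPerm (n + k)) (i + 1)
    · by_cases h2 :
          entry (x : signedPerm (n + k)) (rootLo j) ≤ entry (x : signedPerm (n + k)) (j + 1)
      · exact h0 x h1 h2
      · rw [not_le] at h2
        have h3 := wordLength_mul_of_gt (lt_of_entry_lt h2)
        rw [← (actGen_basisVec_gt f h2 (shift_coe h2.ne')).1]
        exact hj _ (ih _ (by rw [← hl, ← h3, shift_coe h2.ne']; omega) _ rfl)
    · rw [not_le] at h1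
      have h3 := wordLength_mul_of_gt (lt_of_entry_lt h1)
      rw [← (actGen_basisVec_gt f h1 (shift_coe h1.ne')).1]
      exact hi _ (ih _ (by rw [← hl, ← h3, shift_coe h1.ne']; omega) _ rfl)

end TypeBHecke
end

noncomputable section

namespace TypeBHecke

variable {n k : ℕ} {p q : ℂ} {A : Type*} [Ring A] [Algebra ℂ A]

theorem actGen_smul (f : HeckeBS n k p q →ₐ[ℂ] A) (i : Fin (n + k)) (c : ℂ) (v : X n k → A) :
    actGen f i (c • v) = c • actGen f i v := LinearMap.map_smul_of_tower _ c v

/-! ### The braid relations on the induced module -/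

theorem simplePerm_rootLo_of_lt {i j : ℕ} (h : i + 1 < j) : simplePerm i (rootLo j) = rootLo j := by
  rw [rootLo, if_neg (by omega), simplePerm_of_lt (by omega)]

theorem simplePerm_rootLo_of_gt {i j : ℕ} (h : i + 1 < j) : simplePerm j (rootLo i) = rootLo i := by
  have : rootLo i = i ∨ (rootLo i = -1 ∧ i = 0) := by unfold rootLo; split_ifs <;> omega
  exact simplePerm_other (by omega) (by omega) (by omega) (by omega)

theorem simplePerm_rootHi_of_gt {i j : ℕ} (h : i + 1 < j) : simplePerm j (i + 1) = i + 1 := by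
  rw [simplePerm_apply]; split_ifs <;> omega

/-- At a representative without strict descents, a strict ascent moves the basis vector upwards and
both sides meet by the relation in the group. A tie contributes a scalar `f(T_a)` with `x s_i = s_a
x`, and the group relation shows that the same scalar reappears at the other end of the path. With
two ties the relation becomes one between generators of `H_{p,q}(B_n × S_k)`. The other two braid
relations follow the same scheme. -/
theorem actGen_comm_basisVec (f : HeckeBS n k p q →ₐ[ℂ] A) {i j : Fin (n + k)}
    (h : (i : ℕ) + 1 < j) (x : X n k)
    (hi : entry (x : signedPerm (n + k)) (rootLo i) ≤ entry (x : signedPerm (n + k)) (i + 1))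
    (hj : entry (x : signedPerm (n + k)) (rootLo j) ≤ entry (x : signedPerm (n + k)) (j + 1)) :
    actGen f j (actGen f i (basisVec A x)) = actGen f i (actGen f j (basisVec A x)) := by
  have hc := simpleRefl_comm h
  have hc' : ∀ y : signedPerm (n + k), y * simpleRefl (n + k) i * simpleRefl (n + k) j =
      y * simpleRefl (n + k) j * simpleRefl (n + k) i := fun y => by
    rw [mul_assoc, hc, mul_assoc]
  have eij : ∀ y : signedPerm (n + k), entry (y * simpleRefl (n + k) i) (rootLo j) =
      entry y (rootLo j) := fun y => by rw [entry_mul, simplePerm_rootLo_of_lt h]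
  have eij' : ∀ y : signedPerm (n + k), entry (y * simpleRefl (n + k) i) (j + 1) =
      entry y (j + 1) := fun y => by rw [entry_mul, simplePerm_of_lt (by omega)]
  have eji : ∀ y : signedPerm (n + k), entry (y * simpleRefl (n + k) j) (rootLo i) =
      entry y (rootLo i) := fun y => by rw [entry_mul, simplePerm_rootLo_of_gt h]
  have eji' : ∀ y : signedPerm (n + k), entry (y * simpleRefl (n + k) j) (i + 1) =
      entry y (i + 1) := fun y => by rw [entry_mul, simplePerm_rootHi_of_gt h]
  rcases eq_or_lt_of_le hi with hi | hi <;> rcases eq_or_lt_of_le hj with hj | hj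
  · obtain ⟨a, ha, hra⟩ := exists_root_of_entry_eq x.2 hi
    obtain ⟨b, hb, hrb⟩ := exists_root_of_entry_eq x.2 hj
    -- The values of `x` on the two roots are disjoint up to sign, so the simple roots of index `a`
    -- and `b` have no entry in common.
    have hne : (a : ℕ) + 1 < b ∨ (b : ℕ) + 1 < a := by
      have e1 := signed_ne x.1 (a := rootLo i) (b := rootLo j)
        (by unfold rootLo; split_ifs <;> omega)
      have e2 := signed_ne x.1 (a := rootLo i) (b := j + 1)
        (by unfold rootLo; split_ifs <;> omega)
      have e3 := signed_ne x.1 (a := i + 1) (b := rootLo j)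
        (by unfold rootLo; split_ifs <;> omega)
      have e4 := signed_ne x.1 (a := i + 1) (b := j + 1) (by omega)
      have e5 := signed_ne x.1 (a := rootLo i) (b := -rootLo j)
        (by unfold rootLo; split_ifs <;> omega)
      have e6 := signed_ne x.1 (a := rootLo i) (b := -(j + 1))
        (by unfold rootLo; split_ifs <;> omega)
      have e7 := signed_ne x.1 (a := i + 1) (b := -rootLo j)
        (by unfold rootLo; split_ifs <;> omega)
      have e8 := signed_ne x.1 (a := i + 1) (b := -(j + 1)) (by omega)
      rw [signed_neg] at e5 e6 e7 e8
      have la : rootLo a = a ∨ (rootLo a = -1 ∧ (a : ℕ) = 0) := by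
        unfold rootLo; split_ifs <;> omega
      have lb : rootLo b = b ∨ (rootLo b = -1 ∧ (b : ℕ) = 0) := by
        unfold rootLo; split_ifs <;> omega
      omega
    have ca := mul_simpleRefl_eq_of_root hra
    have cb := mul_simpleRefl_eq_of_root hrb
    rw [actGen_basisVec_eq f ha ca, actGen_basisVec_eq f hb cb, map_smul, map_smul,
      actGen_basisVec_eq f ha ca, actGen_basisVec_eq f hb cb, smul_smul, smul_smul,
      parGen_comm f ha hb hne]
  · obtain ⟨a, ha, ca⟩ := exists_conj_of_entry_eq x.2 hi
    have hy := shift_coe hj.ne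
    rw [actGen_basisVec_eq f ha ca, map_smul, actGen_basisVec_lt f hj hy,
      actGen_basisVec_eq f ha]
    rw [hy, ← hc', ca, mul_assoc]
  · obtain ⟨b, hb, cb⟩ := exists_conj_of_entry_eq x.2 hj
    have hy := shift_coe hi.ne
    rw [actGen_basisVec_eq f hb cb, map_smul, actGen_basisVec_lt f hi hy,
      actGen_basisVec_eq f hb]
    rw [hy, hc', cb, mul_assoc]
  · have hy := shift_coe hi.ne
    have hz := shift_coe hj.ne
    have hy' : entry (shift i x : signedPerm (n + k)) (rootLo j) <
        entry (shift i x : signedPerm (n + k)) (j + 1) := by rwa [hy, eij, eij']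
    have hz' : entry (shift j x : signedPerm (n + k)) (rootLo i) <
        entry (shift j x : signedPerm (n + k)) (i + 1) := by rwa [hz, eji, eji']
    rw [actGen_basisVec_lt f hi hy, actGen_basisVec_lt f hj hz,
      actGen_basisVec_lt f hy' (shift_coe hy'.ne), actGen_basisVec_lt f hz' (y := shift j (shift i x))]
    rw [shift_coe hy'.ne, hy, hz, hc']

theorem actGen_three_basisVec (f : HeckeBS n k p q →ₐ[ℂ] A) {i j : Fin (n + k)}
    (h0 : (i : ℕ) ≠ 0) (h : (i : ℕ) + 1 = j) (x : X n k)
    (hi : entry (x : signedPerm (n + k)) (rootLo i) ≤ entry (x : signedPerm (n + k)) (i + 1))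
    (hj : entry (x : signedPerm (n + k)) (rootLo j) ≤ entry (x : signedPerm (n + k)) (j + 1)) :
    actGen f i (actGen f j (actGen f i (basisVec A x))) =
      actGen f j (actGen f i (actGen f j (basisVec A x))) := by
  have hj0 : (j : ℕ) ≠ 0 := by omega
  have hc : ∀ y : signedPerm (n + k),
      y * simpleRefl (n + k) i * simpleRefl (n + k) j * simpleRefl (n + k) i =
      y * simpleRefl (n + k) j * simpleRefl (n + k) i * simpleRefl (n + k) j := fun y => by
    simpa only [mul_assoc, mul_right_inj] using simpleRefl_braid_three h0 h
  have hlo : rootLo i = (i : ℕ) := by rw [rootLo, if_neg h0]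
  have hlo' : rootLo j = (j : ℕ) := by rw [rootLo, if_neg hj0]
  have hij : ((i : ℕ) : ℤ) + 1 = (j : ℕ) := by exact_mod_cast h
  have s1 : simplePerm i (i : ℕ) = (j : ℕ) := by rw [simplePerm_self h0, hij]
  have s2 : simplePerm i (j : ℕ) = (i : ℕ) := by rw [← hij, simplePerm_succ h0]
  have s3 : simplePerm i ((j : ℕ) + 1) = (j : ℕ) + 1 := simplePerm_of_lt (by omega)
  have t1 : simplePerm j (i : ℕ) = (i : ℕ) :=
    simplePerm_other (by omega) (by omega) (by omega) (by omega)
  have t2 : simplePerm j (j : ℕ) = (j : ℕ) + 1 := simplePerm_self hj0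
  have t3 : simplePerm j ((j : ℕ) + 1) = (j : ℕ) := simplePerm_succ hj0
  rcases eq_or_lt_of_le hi with hi | hi <;> rcases eq_or_lt_of_le hj with hj | hj
  · obtain ⟨a, ha, hra⟩ := exists_root_of_entry_eq x.2 hi
    obtain ⟨b, hb, hrb⟩ := exists_root_of_entry_eq x.2 hj
    have ca := mul_simpleRefl_eq_of_root hra
    have cb := mul_simpleRefl_eq_of_root hrb
    have ha0 : (a : ℕ) ≠ 0 := fun e => h0 ((zero_iff_of_conj x.2 ha ca).mpr e)
    have hb0 : (b : ℕ) ≠ 0 := fun e => hj0 ((zero_iff_of_conj x.2 hb cb).mpr e)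
    -- The roots of `s_i` and `s_j` share the position `j`, so their images share the value `x(j)`.
    have hab : (a : ℕ) + 1 = b ∨ (b : ℕ) + 1 = a := by
      have e1 := signed_ne x.1 (a := (i : ℕ)) (b := (j : ℕ) + 1) (by omega)
      rw [hlo, hij, rootLo, if_neg ha0] at hra
      rw [hlo', rootLo, if_neg hb0] at hrb
      omega
    simp only [actGen_basisVec_eq f ha ca, actGen_basisVec_eq f hb cb, map_smul, smul_smul]
    rw [parGen_three f ha hb ha0 hb0 hab]
  · obtain ⟨a, ha, ca⟩ := exists_conj_of_entry_eq x.2 hi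
    have hy := shift_coe hj.ne
    have hy' : entry (shift j x : signedPerm (n + k)) (rootLo i) <
        entry (shift j x : signedPerm (n + k)) (i + 1) := by
      rw [hy, entry_mul, entry_mul, hlo, hij, t1, t2, ← hlo, hi, hij]
      rwa [hlo'] at hj
    have hz := shift_coe hy'.ne
    rw [actGen_basisVec_eq f ha ca, map_smul, map_smul, actGen_basisVec_lt f hj hy,
      actGen_basisVec_lt f hy' hz, actGen_basisVec_eq f ha]
    rw [hz, hy, ← hc, ca]; simp only [mul_assoc]
  · obtain ⟨b, hb, cb⟩ := exists_conj_of_entry_eq x.2 hj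
    have hy := shift_coe hi.ne
    have hy' : entry (shift i x : signedPerm (n + k)) (rootLo j) <
        entry (shift i x : signedPerm (n + k)) (j + 1) := by
      rw [hy, entry_mul, entry_mul, hlo', s2, s3, ← hlo, ← hj, hlo', ← hij]
      exact hi
    have hz := shift_coe hy'.ne
    rw [actGen_basisVec_eq f hb cb, map_smul, map_smul, actGen_basisVec_lt f hi hy,
      actGen_basisVec_lt f hy' hz, actGen_basisVec_eq f hb]
    rw [hz, hy, hc, cb]; simp only [mul_assoc]
  · rw [hlo, hij] at hi
    rw [hlo'] at hj
    have y1 := shift_coe (i := i) (x := x) (by rw [hlo, hij]; exact hi.ne)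
    have z1 := shift_coe (i := j) (x := x) (by rw [hlo']; exact hj.ne)
    have hy2 : entry (shift i x : signedPerm (n + k)) (rootLo j) <
        entry (shift i x : signedPerm (n + k)) (j + 1) := by
      rw [y1, entry_mul, entry_mul, hlo', s2, s3]; omega
    have hz2 : entry (shift j x : signedPerm (n + k)) (rootLo i) <
        entry (shift j x : signedPerm (n + k)) (i + 1) := by
      rw [z1, entry_mul, entry_mul, hlo, hij, t1, t2]; omega
    have y2 := shift_coe hy2.ne
    have z2 := shift_coe hz2.ne
    have hy3 : entry (shift j (shift i x) : signedPerm (n + k)) (rootLo i) <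
        entry (shift j (shift i x) : signedPerm (n + k)) (i + 1) := by
      rw [y2, y1, entry_mul, entry_mul, entry_mul, entry_mul, hlo, hij, t1, t2, s1, s3]; exact hj
    have hz3 : entry (shift i (shift j x) : signedPerm (n + k)) (rootLo j) <
        entry (shift i (shift j x) : signedPerm (n + k)) (j + 1) := by
      rw [z2, z1, entry_mul, entry_mul, entry_mul, entry_mul, hlo', s2, s3, t1, t3]; exact hi
    rw [actGen_basisVec_lt f (by rwa [hlo, hij]) y1, actGen_basisVec_lt f (by rwa [hlo']) z1,
      actGen_basisVec_lt f hy2 y2, actGen_basisVec_lt f hz2 z2,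
      actGen_basisVec_lt f hy3 (shift_coe hy3.ne),
      actGen_basisVec_lt f hz3 (y := shift i (shift j (shift i x)))]
    rw [shift_coe hy3.ne, y2, y1, z2, z1, hc]

theorem actGen_four_basisVec (f : HeckeBS n k p q →ₐ[ℂ] A) {i j : Fin (n + k)}
    (h0 : (i : ℕ) = 0) (h1 : (j : ℕ) = 1) (x : X n k)
    (hi : entry (x : signedPerm (n + k)) (rootLo i) ≤ entry (x : signedPerm (n + k)) (i + 1))
    (hj : entry (x : signedPerm (n + k)) (rootLo j) ≤ entry (x : signedPerm (n + k)) (j + 1)) :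
    actGen f j (actGen f i (actGen f j (actGen f i (basisVec A x)))) =
      actGen f i (actGen f j (actGen f i (actGen f j (basisVec A x)))) := by
  have hc : ∀ y : signedPerm (n + k),
      y * simpleRefl (n + k) i * simpleRefl (n + k) j * simpleRefl (n + k) i *
        simpleRefl (n + k) j =
      y * simpleRefl (n + k) j * simpleRefl (n + k) i * simpleRefl (n + k) j *
        simpleRefl (n + k) i := fun y => by
    simpa only [mul_assoc, mul_right_inj] using simpleRefl_braid_four h0 h1
  have hlo : rootLo i = -1 := by rw [rootLo, if_pos h0]
  have hhi : ((i : ℕ) : ℤ) + 1 = 1 := by rw [h0]; rfl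
  have hlo' : rootLo j = 1 := by rw [rootLo, if_neg (by omega), h1]; rfl
  have hhi' : ((j : ℕ) : ℤ) + 1 = 2 := by rw [h1]; rfl
  have s1 : simplePerm i 1 = -1 := by rw [h0]; simp [simplePerm_apply]
  have s2 : simplePerm i 2 = 2 := by rw [h0]; simp [simplePerm_apply]
  have t1 : simplePerm j 1 = 2 := by rw [h1]; simp [simplePerm_apply]
  have t2 : simplePerm j 2 = 1 := by rw [h1]; simp [simplePerm_apply]
  have ei : ∀ y : signedPerm (n + k), entry (y * simpleRefl (n + k) i) 1 = -entry y 1 :=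
    fun y => by rw [entry_mul, s1, entry_neg]
  have ei' : ∀ y : signedPerm (n + k), entry (y * simpleRefl (n + k) i) 2 = entry y 2 :=
    fun y => by rw [entry_mul, s2]
  have ej : ∀ y : signedPerm (n + k), entry (y * simpleRefl (n + k) j) 1 = entry y 2 :=
    fun y => by rw [entry_mul, t1]
  have ej' : ∀ y : signedPerm (n + k), entry (y * simpleRefl (n + k) j) 2 = entry y 1 :=
    fun y => by rw [entry_mul, t2]
  have asci : ∀ y : X n k, 0 < entry (y : signedPerm (n + k)) 1 →
      entry (y : signedPerm (n + k)) (rootLo i) < entry (y : signedPerm (n + k)) (i + 1) := by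
    intro y hy
    rw [hlo, hhi, entry_neg]; omega
  have ascj : ∀ y : X n k,
      entry (y : signedPerm (n + k)) 1 < entry (y : signedPerm (n + k)) 2 →
      entry (y : signedPerm (n + k)) (rootLo j) < entry (y : signedPerm (n + k)) (j + 1) := by
    intro y hy
    rwa [hlo', hhi']
  rw [hlo, hhi, entry_neg] at hi
  rw [hlo', hhi'] at hj
  -- The first two entries satisfy `0 ≤ x_1 ≤ x_2 ≤ 1`, so the patterns are `00`, `01` and `11`. At
  -- least one generator is always tied, and no case with two strict ascents arises.
  have c1 := entry_cases x.1 1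
  have c2 := entry_cases x.1 2
  by_cases e1 : entry (x : signedPerm (n + k)) 1 = 0
  · obtain ⟨a, ha, hra⟩ := exists_root_of_entry_eq (i := i) x.2 (by rw [hlo, hhi, entry_neg]; omega)
    have ca := mul_simpleRefl_eq_of_root hra
    have ha0 := (zero_iff_of_conj x.2 ha ca).mp h0
    by_cases e2 : entry (x : signedPerm (n + k)) 2 = 0
    · obtain ⟨b, hb, hrb⟩ := exists_root_of_entry_eq (i := j) x.2 (by rw [hlo', hhi']; omega)
      have cb := mul_simpleRefl_eq_of_root hrb
      have hb0 : (b : ℕ) ≠ 0 := fun e => by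
        have := (zero_iff_of_conj x.2 hb cb).mpr e
        omega
      have hb1 : (b : ℕ) = 1 := by
        rw [hlo, hhi, signed_neg, rootLo, if_pos ha0, ha0] at hra
        rw [hlo', hhi', rootLo, if_neg hb0] at hrb
        push_cast at hra
        omega
      simp only [actGen_basisVec_eq f ha ca, actGen_basisVec_eq f hb cb, map_smul, smul_smul]
      rw [parGen_four f ha hb ha0 hb1]
    · have a1 := ascj x (by omega)
      have y1 := shift_coe a1.ne
      have a2 := asci (shift j x) (by rw [y1, ej]; omega)
      have y2 := shift_coe a2.ne
      have a3 := ascj (shift i (shift j x)) (by rw [y2, y1, ei, ei', ej, ej']; omega)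
      have y3 := shift_coe a3.ne
      rw [actGen_basisVec_eq f ha ca, map_smul, map_smul, map_smul, actGen_basisVec_lt f a1 y1,
        actGen_basisVec_lt f a2 y2, actGen_basisVec_lt f a3 y3, actGen_basisVec_eq f ha]
      rw [y3, y2, y1, ← hc, ca]; simp only [mul_assoc]
  · have e2 : entry (x : signedPerm (n + k)) 2 = 1 := by omega
    obtain ⟨b, hb, cb⟩ := exists_conj_of_entry_eq (i := j) x.2 (by rw [hlo', hhi']; omega)
    have a1 := asci x (by omega)
    have y1 := shift_coe a1.ne
    have a2 := ascj (shift i x) (by rw [y1, ei, ei']; omega)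
    have y2 := shift_coe a2.ne
    have a3 := asci (shift j (shift i x)) (by rw [y2, y1, ej, ei']; omega)
    have y3 := shift_coe a3.ne
    rw [actGen_basisVec_eq f hb cb, map_smul, map_smul, map_smul, actGen_basisVec_lt f a1 y1,
      actGen_basisVec_lt f a2 y2, actGen_basisVec_lt f a3 y3, actGen_basisVec_eq f hb]
    rw [y3, y2, y1, hc, cb]; simp only [mul_assoc]

theorem paramB_eq_of_ne_zero {N : ℕ} {i j : Fin N} (hi : (i : ℕ) ≠ 0) (hj : (j : ℕ) ≠ 0) :
    paramB N p q i = paramB N p q j := by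
  rw [paramB, paramB, if_neg hi, if_neg hj]

/-- If both sides of a braid relation agree on `v`, the quadratic relation makes them agree on `v
T_i` and `v T_j`, so minimal representatives suffice. For the relation of length three the two sides
produce squares of different generators, which is why `q_i = q_j` is needed there. -/
theorem braidFamily_actGen (f : HeckeBS n k p q →ₐ[ℂ] A) :
    BraidFamily fun i => MulOpposite.op (actGen f i) where
  comm i j h := by
    rw [← MulOpposite.op_mul, ← MulOpposite.op_mul]
    congr 1
    refine linearMap_ext_basisVec (basisVec_induction f i j
      (P := fun v => actGen f j (actGen f i v) = actGen f i (actGen f j v)) ?_ ?_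
      (actGen_comm_basisVec f h))
    · intro v hv
      rw [hv, actGen_actGen, actGen_actGen, map_add, actGen_smul, actGen_smul, hv]
    · intro v hv
      rw [← hv, actGen_actGen, actGen_actGen, map_add, actGen_smul, actGen_smul, hv]
  three i j h0 h := by
    simp only [← MulOpposite.op_mul]
    congr 1
    have hp : paramB (n + k) p q i = paramB (n + k) p q j :=
      paramB_eq_of_ne_zero h0 (by omega)
    refine linearMap_ext_basisVec (basisVec_induction f i j
      (P := fun v => actGen f i (actGen f j (actGen f i v)) =
        actGen f j (actGen f i (actGen f j v))) ?_ ?_ (actGen_three_basisVec f h0 h))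
    · intro v hv
      rw [hv, actGen_actGen, actGen_actGen]
      simp only [map_add, actGen_smul, hv, hp]
    · intro v hv
      rw [← hv, actGen_actGen, actGen_actGen]
      simp only [map_add, actGen_smul, hv, hp]
  four i j h0 h := by
    simp only [← MulOpposite.op_mul]
    congr 1
    refine linearMap_ext_basisVec (basisVec_induction f i j
      (P := fun v => actGen f j (actGen f i (actGen f j (actGen f i v))) =
        actGen f i (actGen f j (actGen f i (actGen f j v)))) ?_ ?_ (actGen_four_basisVec f h0 h))
    · intro v hv
      rw [hv, actGen_actGen, actGen_actGen]
      simp only [map_add, actGen_smul, hv]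
    · intro v hv
      rw [← hv, actGen_actGen, actGen_actGen]
      simp only [map_add, actGen_smul, hv]

/-! ### The right module structure -/

/-- The induced module as a right module over `H_{p,q}(B_{n+k})`. -/
def actHom (f : HeckeBS n k p q →ₐ[ℂ] A) :
    HeckeB (n + k) p q →ₐ[ℂ] (Module.End A (X n k → A))ᵐᵒᵖ :=
  lift _ _ (fun i => MulOpposite.op (actGen f i))
    (prod_alternatingWord_of_braidFamily (braidFamily_actGen f)) (by
      intro i
      apply MulOpposite.unop_injective
      refine LinearMap.ext fun v => ?_
      simp only [MulOpposite.unop_mul, MulOpposite.unop_sub, MulOpposite.unop_add,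
        MulOpposite.unop_op, MulOpposite.unop_one, MulOpposite.unop_zero,
        MulOpposite.algebraMap_apply]
      simp only [Module.End.mul_apply, LinearMap.add_apply, LinearMap.sub_apply, Module.End.one_apply,
        LinearMap.zero_apply, Module.algebraMap_end_apply, map_sub, actGen_actGen]
      module)

/-- The right action of `h` on the vector `v` of the induced module. -/
def act (f : HeckeBS n k p q →ₐ[ℂ] A) (v : X n k → A) (h : HeckeB (n + k) p q) : X n k → A :=
  (actHom f h).unop v

variable (f : HeckeBS n k p q →ₐ[ℂ] A)

theorem act_gen (v : X n k → A) (i : Fin (n + k)) : act f v (gen _ _ i) = actGen f i v := by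
  rw [act, actHom, lift_gen]; rfl

theorem act_mul (v : X n k → A) (h h' : HeckeB (n + k) p q) :
    act f v (h * h') = act f (act f v h) h' := by
  rw [act, map_mul]; rfl

theorem act_one (v : X n k → A) : act f v 1 = v := by
  rw [act, map_one]; rfl

theorem act_add (v : X n k → A) (h h' : HeckeB (n + k) p q) :
    act f v (h + h') = act f v h + act f v h' := by
  rw [act, map_add]; rfl

theorem act_algebraMap (v : X n k → A) (c : ℂ) : act f v (algebraMap ℂ _ c) = c • v := by
  rw [act, AlgHom.commutes]; rfl

theorem act_sum {ι : Type*} (s : Finset ι) (v : X n k → A) (h : ι → HeckeB (n + k) p q) :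
    act f v (∑ i ∈ s, h i) = ∑ i ∈ s, act f v (h i) :=
  map_sum (AddMonoidHom.mk' (act f v) (act_add f v)) h s

theorem add_act (v w : X n k → A) (h : HeckeB (n + k) p q) :
    act f (v + w) h = act f v h + act f w h := map_add _ v w

theorem smul_act (a : A) (v : X n k → A) (h : HeckeB (n + k) p q) :
    act f (a • v) h = a • act f v h := map_smul _ a v

theorem complex_smul_act (c : ℂ) (v : X n k → A) (h : HeckeB (n + k) p q) :
    act f (c • v) h = c • act f v h := LinearMap.map_smul_of_tower _ c v

end TypeBHecke
end

noncomputable section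

namespace TypeBHecke

/-! ### Freeness over `H_{p,q}(B_n × S_k)` -/

theorem hecke_induction {B : Type*} {M : CoxeterMatrix B} {q : B → ℂ}
    {P : HeckeAlgebra M q → Prop} (algebraMap : ∀ c : ℂ, P (algebraMap ℂ _ c))
    (gen : ∀ i, P (gen M q i)) (add : ∀ a b, P a → P b → P (a + b))
    (mul : ∀ a b, P a → P b → P (a * b)) (h : HeckeAlgebra M q) : P h := by
  obtain ⟨a, rfl⟩ := RingQuot.mkAlgHom_surjective ℂ (HeckeRel M q) h
  induction a using FreeAlgebra.induction with
  | grade0 c => rw [AlgHom.commutes]; exact algebraMap c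
  | grade1 i => exact gen i
  | mul a b ha hb => rw [map_mul]; exact mul _ _ ha hb
  | add a b ha hb => rw [map_add]; exact add _ _ ha hb

variable {n k : ℕ} {p q : ℂ} {A : Type*} [Ring A] [Algebra ℂ A]

theorem inclBS_gen (j : idxBS n k) :
    inclBS n k p q (gen _ _ j) = gen (typeB (n + k)) (paramB (n + k) p q) j := by
  simp [inclBS, parabolicIncl, lift, gen]

theorem parabolicInclOfLE_gen {B : Type*} (M : CoxeterMatrix B) (q : B → ℂ) {K J : Set B}
    (h : K ⊆ J) (i : K) : parabolicInclOfLE M q h (gen _ _ i) = gen _ _ (Set.inclusion h i) := by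
  simp [parabolicInclOfLE, lift, gen]

theorem one_mem_X : (1 : signedPerm (n + k)) ∈ X n k := by
  rw [mem_X_iff]
  intro j _
  rw [inv_one]
  exact rootLo_lt j

/-- The identity as a distinguished representative. -/
def oneRep (n k : ℕ) : X n k := ⟨1, one_mem_X⟩

theorem entry_lt_of_descent {x : signedPerm (n + k)} (hx : x ∈ X n k) {i : Fin (n + k)}
    (h : x.1 (i + 1) < x.1 (rootLo i)) : entry x (i + 1) < entry x (rootLo i) := by
  rcases lt_trichotomy (entry x (rootLo i)) (entry x (i + 1)) with h1 | h1 | h1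
  · exact absurd (lt_of_entry_lt h1) h.le.not_gt
  · exact absurd (lt_of_entry_eq (mem_X_iff.mp hx) (rootLo_lt i)
      (by exact_mod_cast abs_rootLo_le i) (by exact_mod_cast abs_rootHi_le i) h1) h.le.not_gt
  · exact h1

/-- A descent of a distinguished `x` is a strict descent of its pattern, so removing it stays in
`X_{n,k}`. Thus `e_1` climbs to `e_x` along a reduced word, by ascents only. -/
theorem act_T (f : HeckeBS n k p q →ₐ[ℂ] A) (x : X n k) :
    act f (basisVec A (oneRep n k)) (T (n + k) p q x) = basisVec A x := by
  induction hl : wordLength (simpleRefl (n + k)) (x : signedPerm (n + k))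
    using Nat.strong_induction_on generalizing x with
  | _ l ih =>
    by_cases hx : (x : signedPerm (n + k)) = 1
    · rw [hx, T_one, act_one, show x = oneRep n k from Subtype.ext hx]
    · obtain ⟨i, hi⟩ := exists_descent hx
      have hd := entry_lt_of_descent x.2 hi
      have h3 := wordLength_mul_of_gt hi
      have hy := shift_coe hd.ne'
      have h4 := T_mul_gen (p := p) (q := q) (mul_simpleRefl_lt_iff.mpr hi)
      rw [mul_simpleRefl_cancel, ← hy] at h4
      rw [← h4, act_mul, ih _ (by rw [← hl, ← h3, hy]; omega) _ rfl, act_gen,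
        (actGen_basisVec_gt f hd hy).1]

/-- At `x = 1` each generator of `B_n × S_k` is its own conjugate, so it acts on `e_1` through `f`.
-/
theorem act_inclBS (f : HeckeBS n k p q →ₐ[ℂ] A) (z : HeckeBS n k p q) :
    act f (basisVec A (oneRep n k)) (inclBS n k p q z) = f z • basisVec A (oneRep n k) := by
  induction z using hecke_induction with
  | algebraMap c => rw [AlgHom.commutes, act_algebraMap, AlgHom.commutes, algebraMap_smul]
  | gen j =>
    rw [inclBS_gen, act_gen]
    exact actGen_basisVec_eq f j.2 (by rw [oneRep, one_mul, mul_one])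
  | add a b ha hb => rw [map_add, act_add, ha, hb, map_add, add_smul]
  | mul a b ha hb => rw [map_mul, act_mul, ha, smul_act, hb, map_mul, mul_smul]

/-- The coefficients of an element with respect to the basis `T_x`, `x ∈ X_{n,k}`, are those of its
action on the generator of the induced module. -/
theorem coeff_eq (f : HeckeBS n k p q →ₐ[ℂ] A) {h : HeckeB (n + k) p q}
    {z : X n k → HeckeBS n k p q}
    (hz : h = ∑ x : X n k, inclBS n k p q (z x) * T (n + k) p q x) (y : X n k) :
    f (z y) = act f (basisVec A (oneRep n k)) h y := by
  rw [hz, act_sum, Finset.sum_apply, Finset.sum_eq_single y]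
  · rw [act_mul, act_inclBS, smul_act, act_T, Pi.smul_apply, basisVec_self, smul_eq_mul, mul_one]
  · intro x _ hx
    rw [act_mul, act_inclBS, smul_act, act_T, Pi.smul_apply, basisVec_of_ne hx.symm, smul_zero]
  · intro hy
    exact absurd (Finset.mem_univ y) hy

/-- The map `(z_x) ↦ ∑ z_x T_x`. -/
def sumT (n k : ℕ) (p q : ℂ) : (X n k → HeckeBS n k p q) →+ HeckeB (n + k) p q where
  toFun z := ∑ x : X n k, inclBS n k p q (z x) * T (n + k) p q x
  map_zero' := by simp
  map_add' z z' := by simp [add_mul, Finset.sum_add_distrib]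

theorem inclBS_mul_T_mem (a : HeckeBS n k p q) (x : X n k) :
    inclBS n k p q a * T (n + k) p q x ∈ (sumT n k p q).range := by
  refine ⟨Pi.single x a, ?_⟩
  change ∑ y : X n k, inclBS n k p q ((Pi.single x a : X n k → HeckeBS n k p q) y) *
    T (n + k) p q y = _
  rw [Finset.sum_eq_single x]
  · rw [Pi.single_eq_same]
  · intro y _ hy
    rw [Pi.single_eq_of_ne hy, map_zero, zero_mul]
  · intro hx
    exact absurd (Finset.mem_univ x) hx

/-- The three cases of Deodhar's lemma; in a tie `T_x T_i = T_{x s_i} = T_{s_j x} = T_j T_x`, and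
`T_j` is absorbed into the coefficient. -/
theorem inclBS_mul_T_mul_gen_mem (a : HeckeBS n k p q) (x : X n k) (i : Fin (n + k)) :
    inclBS n k p q a * T (n + k) p q x * gen _ _ i ∈ (sumT n k p q).range := by
  rcases lt_trichotomy (entry (x : signedPerm (n + k)) (rootLo i))
    (entry (x : signedPerm (n + k)) (i + 1)) with h | h | h
  · rw [mul_assoc, T_mul_gen (lt_of_entry_lt h), ← shift_coe h.ne]
    exact inclBS_mul_T_mem a _
  · obtain ⟨j, hj, hc⟩ := exists_conj_of_entry_eq x.2 h
    have h1 := lt_of_entry_eq (mem_X_iff.mp x.2) (rootLo_lt i)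
      (by exact_mod_cast abs_rootLo_le i) (by exact_mod_cast abs_rootHi_le i) h
    have h2 : inclBS n k p q (gen _ _ ⟨j, hj⟩) = gen (typeB (n + k)) (paramB (n + k) p q) j :=
      inclBS_gen _
    rw [mul_assoc, T_mul_gen h1, hc, ← gen_mul_T (mem_X_iff.mp x.2 j hj), ← mul_assoc, ← h2,
      ← map_mul]
    exact inclBS_mul_T_mem _ _
  · rw [mul_assoc, T_mul_gen_of_gt (lt_of_entry_lt h), ← shift_coe h.ne', mul_add,
      mul_smul_comm, mul_smul_comm, ← smul_mul_assoc, ← smul_mul_assoc, ← map_smul, ← map_smul]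
    exact add_mem (inclBS_mul_T_mem _ _) (inclBS_mul_T_mem _ _)

theorem exists_coeff (h : HeckeB (n + k) p q) :
    ∃ z : X n k → HeckeBS n k p q,
      h = ∑ x : X n k, inclBS n k p q (z x) * T (n + k) p q x := by
  have key : ∀ h : HeckeB (n + k) p q,
      ∀ a ∈ (sumT n k p q).range, a * h ∈ (sumT n k p q).range := by
    intro h
    induction h using hecke_induction with
    | algebraMap c =>
      rintro _ ⟨z, rfl⟩
      refine ⟨c • z, ?_⟩
      change ∑ x : X n k, inclBS n k p q (c • z x) * _ = (∑ x : X n k, _) * _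
      rw [← Algebra.commutes, ← Algebra.smul_def, Finset.smul_sum]
      exact Finset.sum_congr rfl fun x _ => by rw [map_smul, smul_mul_assoc]
    | gen i =>
      rintro _ ⟨z, rfl⟩
      change (∑ x : X n k, _) * _ ∈ _
      rw [Finset.sum_mul]
      exact sum_mem fun x _ => inclBS_mul_T_mul_gen_mem _ _ _
    | add b c hb hc =>
      intro a ha
      rw [mul_add]
      exact add_mem (hb a ha) (hc a ha)
    | mul b c hb hc =>
      intro a ha
      rw [← mul_assoc]
      exact hc _ (hb a ha)
  have h1 : (1 : HeckeB (n + k) p q) ∈ (sumT n k p q).range := by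
    have := inclBS_mul_T_mem (p := p) (q := q) 1 (oneRep n k)
    rwa [map_one, one_mul, oneRep, T_one] at this
  obtain ⟨z, hz⟩ := key h 1 h1
  rw [one_mul] at hz
  exact ⟨z, hz.symm⟩

/-! ### The tensor product with the trivial module -/

theorem map_alternatingWord_congr {B R : Type*} {f g : B → R} {i j : B} (hi : f i = g i)
    (hj : f j = g j) (m : ℕ) : (CoxeterSystem.alternatingWord i j m).map f =
      (CoxeterSystem.alternatingWord i j m).map g := by
  induction m generalizing i j with
  | zero => rfl
  | succ m ih => simp [CoxeterSystem.alternatingWord, ih hj hi, hj]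

/-- The endomorphism of `H_{p,q}(B_n × S_k)` that maps the generators of `H_q(S_k)` to `1`. -/
def projS (n k : ℕ) (p q : ℂ) : HeckeBS n k p q →ₐ[ℂ] HeckeBS n k p q :=
  lift _ _ (fun j => if ((j : Fin (n + k)) : ℕ) < n then gen _ _ j else 1)
    (by
      intro i j hij
      have hi : ((i : Fin (n + k)) : ℕ) ≠ n := i.2
      have hj : ((j : Fin (n + k)) : ℕ) ≠ n := j.2
      by_cases h1 : ((i : Fin (n + k)) : ℕ) < n <;> by_cases h2 : ((j : Fin (n + k)) : ℕ) < n
      · rw [map_alternatingWord_congr (i := i) (j := j) (g := gen _ _) (if_pos h1) (if_pos h2),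
          map_alternatingWord_congr (i := j) (j := i) (g := gen _ _) (if_pos h2) (if_pos h1)]
        exact gen_braid _ _ i j hij
      -- Indices on different sides of the missing `n` are not adjacent, so the relation is a
      -- commutation, and `1` commutes with everything.
      · rw [show parabolic (typeB (n + k)) (idxBS n k) i j = 2 from
          typeB_eq_two (Or.inl (by omega))]
        simp [CoxeterSystem.alternatingWord, h1, h2]
      · rw [show parabolic (typeB (n + k)) (idxBS n k) i j = 2 from
          typeB_eq_two (Or.inr (by omega))]
        simp [CoxeterSystem.alternatingWord, h1, h2]
      · rw [map_alternatingWord_congr (i := i) (j := j) (g := fun _ => 1) (if_neg h1) (if_neg h2),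
          map_alternatingWord_congr (i := j) (j := i) (g := fun _ => 1) (if_neg h2) (if_neg h1)]
        simp)
    (by
      intro i
      split_ifs
      · exact gen_quadratic _ _ i
      · rw [sub_self, zero_mul])

theorem projS_gen (j : idxBS n k) : projS n k p q (gen _ _ j) =
    if ((j : Fin (n + k)) : ℕ) < n then gen _ _ j else 1 := by
  rw [projS, lift_gen]

theorem parGen_projS_of_gt {j : Fin (n + k)} (hj : (j : ℕ) ≠ n) (h : n < (j : ℕ)) :
    parGen (projS n k p q) j hj = 1 := by
  rw [parGen, projS_gen, if_neg (by simp only; omega)]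

theorem trivTensor_add (a b : HeckeBS n k p q) :
    trivTensor n k p q (a + b) = trivTensor n k p q a + trivTensor n k p q b := by
  rw [trivTensor, pureTensor, TensorProduct.tmul_add, map_add]; rfl

theorem trivTensor_gen_mul {j : Fin (n + k)} (hj : n < (j : ℕ)) (a : HeckeBS n k p q) :
    trivTensor n k p q (gen _ _ ⟨j, Nat.ne_of_gt hj⟩ * a) = trivTensor n k p q a := by
  have h1 : (gen _ _ ⟨j, hj⟩ : HeckeS n k p q) • a = gen _ _ ⟨j, Nat.ne_of_gt hj⟩ * a := by
    change parabolicInclOfLE _ _ (idxS_subset n k) (gen _ _ ⟨j, hj⟩) * a = _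
    rw [parabolicInclOfLE_gen]
  have h2 : MulOpposite.op (gen _ _ ⟨j, hj⟩ : HeckeS n k p q) • (oneTriv _ _ : TrivS n k p q) =
      oneTriv _ _ := by
    change trivChar (parabolic (typeB (n + k)) (idxS n k)) (fun i => paramB (n + k) p q i)
      (gen _ _ ⟨j, hj⟩) * (1 : ℂ) = (1 : ℂ)
    rw [trivChar, lift_gen, one_mul]
  have h3 : (MulOpposite.op (gen _ _ ⟨j, hj⟩ : HeckeS n k p q) • (oneTriv _ _ : TrivS n k p q)) ⊗ₜ[ℤ]
      a - (oneTriv _ _ : TrivS n k p q) ⊗ₜ[ℤ] ((gen _ _ ⟨j, hj⟩ : HeckeS n k p q) • a) ∈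
      balancedRelations (HeckeS n k p q) (TrivS n k p q) (HeckeBS n k p q) :=
    Submodule.subset_span ⟨_, _, _, rfl⟩
  rw [h1, h2] at h3
  exact ((Submodule.Quotient.eq _).mpr h3).symm

/-- Left multiplication by an element that commutes with the image of `H_q(S_k)` preserves the
balancing relations, so it descends to the tensor product. -/
theorem trivTensor_mul_congr {g : HeckeBS n k p q}
    (hg : ∀ s : HeckeS n k p q, g * parabolicInclOfLE _ _ (idxS_subset n k) s =
      parabolicInclOfLE _ _ (idxS_subset n k) s * g)
    {a b : HeckeBS n k p q} (hab : trivTensor n k p q a = trivTensor n k p q b) :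
    trivTensor n k p q (g * a) = trivTensor n k p q (g * b) := by
  let F : (TrivS n k p q ⊗[ℤ] HeckeBS n k p q) →ₗ[ℤ] (TrivS n k p q ⊗[ℤ] HeckeBS n k p q) :=
    (TensorProduct.map LinearMap.id (LinearMap.mulLeft ℤ g)).toAddMonoidHom.toIntLinearMap
  have hF : ∀ x y, F (x ⊗ₜ[ℤ] y) = x ⊗ₜ[ℤ] (g * y) := fun x y => TensorProduct.map_tmul _ _ x y
  have hle : balancedRelations (HeckeS n k p q) (TrivS n k p q) (HeckeBS n k p q) ≤
      (balancedRelations (HeckeS n k p q) (TrivS n k p q) (HeckeBS n k p q)).comap F := by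
    refine Submodule.span_le.mpr ?_
    rintro _ ⟨x, s, y, rfl⟩
    rw [SetLike.mem_coe, Submodule.mem_comap, map_sub, hF, hF]
    refine Submodule.subset_span ⟨x, s, g * y, ?_⟩
    have : g * (s • y) = s • (g * y) := by
      change g * (parabolicInclOfLE _ _ (idxS_subset n k) s * y) =
        parabolicInclOfLE _ _ (idxS_subset n k) s * (g * y)
      rw [← mul_assoc, hg, mul_assoc]
    rw [this]
  exact congrArg (Submodule.mapQ _ _ _ hle) hab

/-- A leading generator of `S_k` moves across the tensor sign and acts by `1`, while a generator of
`B_n` commutes with `H_q(S_k)` and can be kept as a left multiplication. -/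
theorem trivTensor_projS (h : HeckeBS n k p q) :
    trivTensor n k p q h = trivTensor n k p q (projS n k p q h) := by
  -- The right factors `a` and `b` are needed to make the claim multiplicative in `h`.
  have key : ∀ h a b : HeckeBS n k p q, trivTensor n k p q a = trivTensor n k p q b →
      trivTensor n k p q (h * a) = trivTensor n k p q (projS n k p q h * b) := by
    intro h
    induction h using hecke_induction with
    | algebraMap c =>
      intro a b hab
      rw [AlgHom.commutes]
      exact trivTensor_mul_congr (fun s => Algebra.commutes c _) hab
    | gen j =>
      intro a b hab
      rw [projS_gen]
      split_ifs with hj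
      · refine trivTensor_mul_congr (fun s => ?_) hab
        induction s using hecke_induction with
        | algebraMap c => rw [AlgHom.commutes]; exact (Algebra.commutes c _).symm
        | gen i =>
          rw [parabolicInclOfLE_gen]
          have hi : n < ((i : Fin (n + k)) : ℕ) := i.2
          refine gen_comm_of_eq_two (fun e => ?_) (typeB_eq_two (Or.inl ?_))
          · rw [e] at hj
            exact absurd hj (not_lt.mpr hi.le)
          · change ((j : Fin (n + k)) : ℕ) + 1 < ((i : Fin (n + k)) : ℕ)
            omega
        | add b c hb hc => rw [map_add, mul_add, hb, hc, add_mul]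
        | mul b c hb hc => rw [map_mul, ← mul_assoc, hb, mul_assoc, hc, mul_assoc]
      · have hj' : n < ((j : Fin (n + k)) : ℕ) := lt_of_le_of_ne (not_lt.mp hj) (Ne.symm j.2)
        rw [one_mul, ← hab]
        exact trivTensor_gen_mul hj' a
    | add b c hb hc =>
      intro x y hxy
      rw [map_add, add_mul, add_mul, trivTensor_add, trivTensor_add, hb _ _ hxy, hc _ _ hxy]
    | mul b c hb hc =>
      intro x y hxy
      rw [map_mul, mul_assoc, mul_assoc]
      exact hb _ _ (hc _ _ hxy)
  have := key h 1 1 rfl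
  rwa [mul_one, mul_one] at this

end TypeBHecke
end

noncomputable section

namespace TypeBHecke

/-! ### Words in the generators -/

section Words

variable {N : ℕ} {p q : ℂ}

/-- The generator of index `i`, indexed by the natural numbers. -/
def natGen (N : ℕ) (p q : ℂ) (i : ℕ) : HeckeB N p q :=
  if h : i < N then gen _ _ ⟨i, h⟩ else 1

theorem natGen_of_lt {i : ℕ} (h : i < N) :
    natGen N p q i = gen (typeB N) (paramB N p q) ⟨i, h⟩ := dif_pos h

theorem natGen_comm {i j : ℕ} (h : i + 1 < j) (hj : j < N) :
    natGen N p q i * natGen N p q j = natGen N p q j * natGen N p q i := by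
  rw [natGen_of_lt hj, natGen_of_lt (by omega : i < N)]
  exact (braidFamily_gen N p q).comm _ _ h

theorem natGen_three {i : ℕ} (h : 1 ≤ i) (hi : i + 1 < N) :
    natGen N p q i * natGen N p q (i + 1) * natGen N p q i =
      natGen N p q (i + 1) * natGen N p q i * natGen N p q (i + 1) := by
  rw [natGen_of_lt hi, natGen_of_lt (by omega : i < N)]
  exact (braidFamily_gen N p q).three _ _ (by simp only; omega) rfl

theorem natGen_four (h : 1 < N) :
    natGen N p q 0 * natGen N p q 1 * natGen N p q 0 * natGen N p q 1 =
      natGen N p q 1 * natGen N p q 0 * natGen N p q 1 * natGen N p q 0 := by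
  rw [natGen_of_lt h, natGen_of_lt (by omega : 0 < N)]
  exact (braidFamily_gen N p q).four _ _ rfl rfl

/-- The product `T_a T_{a+1} ⋯ T_{a+r-1}`. -/
def upWord (N : ℕ) (p q : ℂ) (a : ℕ) : ℕ → HeckeB N p q
  | 0 => 1
  | r + 1 => upWord N p q a r * natGen N p q (a + r)

/-- The product `T_{a+r-1} ⋯ T_{a+1} T_a`. -/
def downWord (N : ℕ) (p q : ℂ) (a : ℕ) : ℕ → HeckeB N p q
  | 0 => 1
  | r + 1 => natGen N p q (a + r) * downWord N p q a r

theorem upWord_zero (a : ℕ) : upWord N p q a 0 = 1 := rfl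

theorem upWord_succ (a r : ℕ) :
    upWord N p q a (r + 1) = upWord N p q a r * natGen N p q (a + r) := rfl

theorem downWord_zero (a : ℕ) : downWord N p q a 0 = 1 := rfl

theorem downWord_succ (a r : ℕ) :
    downWord N p q a (r + 1) = natGen N p q (a + r) * downWord N p q a r := rfl

theorem upWord_succ' (a r : ℕ) :
    upWord N p q a (r + 1) = natGen N p q a * upWord N p q (a + 1) r := by
  induction r with
  | zero => simp [upWord]
  | succ r ih =>
    rw [upWord_succ, ih, upWord_succ, mul_assoc, show a + (r + 1) = a + 1 + r by ring]

theorem natGen_comm_upWord {a r i : ℕ} (h : a + r < i) (hi : i < N) :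
    natGen N p q i * upWord N p q a r = upWord N p q a r * natGen N p q i := by
  induction r with
  | zero => rw [upWord_zero, mul_one, one_mul]
  | succ r ih =>
    rw [upWord_succ, ← mul_assoc, ih (by omega), mul_assoc, mul_assoc,
      natGen_comm (by omega) hi]

theorem natGen_comm_downWord {a r i : ℕ} (h : a + r < i) (hi : i < N) :
    natGen N p q i * downWord N p q a r = downWord N p q a r * natGen N p q i := by
  induction r with
  | zero => rw [downWord_zero, mul_one, one_mul]
  | succ r ih =>
    rw [downWord_succ, ← mul_assoc, ← natGen_comm (i := a + r) (by omega) hi, mul_assoc,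
      ih (by omega), mul_assoc]

/-- `T_{i+1}` commutes past the letters before `T_i`, becomes `T_i` by the braid relation with `T_i
T_{i+1}`, and commutes past the rest. -/
theorem natGen_mul_upWord {a r i : ℕ} (h1 : 1 ≤ i) (ha : a ≤ i) (hi : i + 1 < a + r)
    (hr : a + r ≤ N) :
    natGen N p q (i + 1) * upWord N p q a r = upWord N p q a r * natGen N p q i := by
  induction r with
  | zero => omega
  | succ r ih =>
    rw [upWord_succ, ← mul_assoc]
    by_cases h : i + 1 < a + r
    · rw [ih h (by omega), mul_assoc, mul_assoc, natGen_comm h (by omega)]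
    · obtain ⟨r, rfl⟩ : ∃ r', r = r' + 1 := ⟨r - 1, by omega⟩
      have e : a + r = i := by omega
      rw [upWord_succ, ← add_assoc, e, ← mul_assoc,
        natGen_comm_upWord (by omega) (by omega), mul_assoc, mul_assoc, mul_assoc, mul_assoc,
        ← mul_assoc (natGen N p q (i + 1)), ← natGen_three h1 (by omega), mul_assoc]

theorem natGen_mul_downWord {a r i : ℕ} (h1 : 1 ≤ i) (ha : a ≤ i) (hi : i + 1 < a + r)
    (hr : a + r ≤ N) :
    natGen N p q i * downWord N p q a r = downWord N p q a r * natGen N p q (i + 1) := by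
  induction r with
  | zero => omega
  | succ r ih =>
    rw [downWord_succ, ← mul_assoc]
    by_cases h : i + 1 < a + r
    · rw [natGen_comm h (by omega), mul_assoc, ih h (by omega), mul_assoc]
    · obtain ⟨r, rfl⟩ : ∃ r', r = r' + 1 := ⟨r - 1, by omega⟩
      have e : a + r = i := by omega
      rw [downWord_succ, ← add_assoc, e, ← mul_assoc, natGen_three h1 (by omega), mul_assoc,
        natGen_comm_downWord (by omega) (by omega)]
      simp only [mul_assoc]

/-- The product `T_{w_{0,m}}`, as `(T_0 ⋯ T_{m-1}) (T_0 ⋯ T_{m-2}) ⋯ T_0`. -/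
def flipWord (N : ℕ) (p q : ℂ) : ℕ → HeckeB N p q
  | 0 => 1
  | m + 1 => upWord N p q 0 (m + 1) * flipWord N p q m

theorem flipWord_succ (m : ℕ) :
    flipWord N p q (m + 1) = upWord N p q 0 (m + 1) * flipWord N p q m := rfl

theorem natGen_comm_flipWord {m i : ℕ} (h : m < i) (hi : i < N) :
    natGen N p q i * flipWord N p q m = flipWord N p q m * natGen N p q i := by
  induction m with
  | zero => simp [flipWord]
  | succ m ih =>
    rw [flipWord_succ, ← mul_assoc, natGen_comm_upWord (by omega) hi, mul_assoc, ih (by omega),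
      mul_assoc]

/-- This is where the relation of length four between `t` and `s_1` enters. A longer pair of words
is the shorter pair times `T_{m+2} T_{m+1}`, and one more braid relation raises the index. -/
theorem natGen_one_mul_upWord {m : ℕ} (h : m + 1 < N) :
    natGen N p q 1 * (upWord N p q 0 (m + 2) * upWord N p q 0 (m + 1)) =
      upWord N p q 0 (m + 2) * upWord N p q 0 (m + 1) * natGen N p q (m + 1) := by
  induction m with
  | zero =>
    have := natGen_four (p := p) (q := q) h
    simp only [upWord, mul_assoc, one_mul, zero_add] at this ⊢
    exact this.symm
  | succ m ih =>
    have e : upWord N p q 0 (m + 1 + 2) * upWord N p q 0 (m + 1 + 1) =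
        upWord N p q 0 (m + 2) * upWord N p q 0 (m + 1) *
          (natGen N p q (m + 2) * natGen N p q (m + 1)) := by
      rw [upWord_succ 0 (m + 2), upWord_succ 0 (m + 1)]
      simp only [zero_add, mul_assoc]
      rw [← mul_assoc (natGen N p q (m + 2)), natGen_comm_upWord (by omega) (by omega)]
      simp only [mul_assoc]
    rw [e, ← mul_assoc, ih (by omega)]
    simp only [mul_assoc]
    rw [← mul_assoc (natGen N p q (m + 1)), natGen_three (by omega) (by omega)]
    simp only [mul_assoc]

/-- Conjugation by `w_{0,m}`, which sends `a` to `a - m - 1` on `{1, …, m}`, exchanges `s_j` and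
`s_{m-j}`. -/
theorem natGen_mul_flipWord {i j : ℕ} (hi : 1 ≤ i) (hj : 1 ≤ j) (h : i + j ≤ N) :
    natGen N p q i * flipWord N p q (i + j) = flipWord N p q (i + j) * natGen N p q j := by
  induction i, hi using Nat.le_induction with
  | base =>
    obtain ⟨m, rfl⟩ : ∃ m, j = m + 1 := ⟨j - 1, by omega⟩
    rw [show 1 + (m + 1) = m + 1 + 1 by ring, flipWord_succ, flipWord_succ, ← mul_assoc (upWord _ _ _ _ _),
      ← mul_assoc, natGen_one_mul_upWord (by omega), mul_assoc,
      natGen_comm_flipWord (by omega) (by omega), mul_assoc, mul_assoc, mul_assoc]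
  | succ i hi ih =>
    rw [show i + 1 + j = i + j + 1 by ring, flipWord_succ, ← mul_assoc,
      natGen_mul_upWord hi (by omega) (by omega) (by omega), mul_assoc, ih (by omega), mul_assoc]

/-- The product `T_{w_{j,k}}`. -/
def longWord (N : ℕ) (p q : ℂ) (k : ℕ) : ℕ → HeckeB N p q
  | 0 => flipWord N p q k
  | j + 1 => upWord N p q (j + 1) k * (longWord N p q k j * downWord N p q (j + 1) k)

theorem longWord_succ (k j : ℕ) : longWord N p q k (j + 1) =
    upWord N p q (j + 1) k * (longWord N p q k j * downWord N p q (j + 1) k) := rfl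

/-- On the block of positions `j+1, …, j+k`, `w_{j,k}` acts like `w_{0,k}`, so it reverses the
generators of the block. In the recursion the two outer words lower and raise the indices by one. -/
theorem natGen_mul_longWord {k j i i' : ℕ} (hi : j < i) (hi' : j < i') (h : i + i' = 2 * j + k)
    (hk : j + k ≤ N) :
    natGen N p q i * longWord N p q k j = longWord N p q k j * natGen N p q i' := by
  induction j generalizing i i' with
  | zero =>
    obtain rfl : k = i + i' := by omega
    exact natGen_mul_flipWord hi hi' (by omega)
  | succ j ih =>
    obtain ⟨a, rfl⟩ : ∃ a, i = a + 1 := ⟨i - 1, by omega⟩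
    obtain ⟨b, rfl⟩ : ∃ b, i' = b + 1 := ⟨i' - 1, by omega⟩
    rw [longWord_succ, ← mul_assoc, natGen_mul_upWord (by omega) (by omega) (by omega) (by omega),
      mul_assoc, ← mul_assoc (natGen N p q a), ih (i' := b) (by omega) (by omega) (by omega)
      (by omega), mul_assoc (longWord N p q k j),
      natGen_mul_downWord (by omega) (by omega) (by omega) (by omega)]
    simp only [mul_assoc]

end Words

/-! ### The longest representative as a word -/

variable {n k : ℕ} {p q : ℂ}

theorem simplePerm_of_pos {a : ℕ} (ha : 1 ≤ a) {b : ℤ} (hb : 1 ≤ b) :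
    simplePerm a b = if b = a then (a : ℤ) + 1 else if b = a + 1 then (a : ℤ) else b := by
  rw [simplePerm_apply]; split_ifs <;> omega

theorem rootLo_of_pos {a : ℕ} (ha : 1 ≤ a) : rootLo a = a := by
  rw [rootLo, if_neg (by omega)]

theorem entry_mul_of_pos {x y : signedPerm (n + k)} {a : ℕ} (ha : 1 ≤ a) (haN : a < n + k)
    (hy : y = x * simpleRefl (n + k) ⟨a, haN⟩) {b : ℤ} (hb : 1 ≤ b) :
    entry y b = if b = a then entry x (a + 1) else if b = a + 1 then entry x a
      else entry x b := by
  rw [hy, entry_mul, simplePerm_of_pos ha hb]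
  split_ifs <;> rfl

theorem T_mul_natGen {x : X n k} {a : ℕ} (ha : 1 ≤ a) (haN : a < n + k)
    (h : entry (x : signedPerm (n + k)) a < entry (x : signedPerm (n + k)) (a + 1)) :
    T (n + k) p q x * natGen (n + k) p q a = T (n + k) p q (shift ⟨a, haN⟩ x) ∧
      ∀ b : ℤ, 1 ≤ b → entry (shift ⟨a, haN⟩ x : signedPerm (n + k)) b =
        if b = a then entry (x : signedPerm (n + k)) (a + 1) else
        if b = a + 1 then entry (x : signedPerm (n + k)) a
        else entry (x : signedPerm (n + k)) b := by
  have h' : entry (x : signedPerm (n + k)) (rootLo (⟨a, haN⟩ : Fin (n + k))) <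
      entry (x : signedPerm (n + k)) ((⟨a, haN⟩ : Fin (n + k)) + 1) := by
    simp only [rootLo_of_pos ha]; exact h
  have hs := shift_coe h'.ne
  refine ⟨?_, fun b hb => entry_mul_of_pos ha haN hs hb⟩
  rw [natGen_of_lt haN, T_mul_gen (lt_of_entry_lt h'), hs]

/-- The small entry `α` travels to the right over `r` copies of `β`. Every letter is an ascent of
the pattern, so the product remains a single `T_y`. -/
theorem T_mul_upWord {x : X n k} {a r : ℕ} {α β : ℤ} (ha : 1 ≤ a) (har : a + r ≤ n + k)
    (h1 : entry (x : signedPerm (n + k)) a = α)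
    (h2 : ∀ b : ℤ, a < b → b ≤ a + r → entry (x : signedPerm (n + k)) b = β) (hαβ : α < β) :
    ∃ y : X n k, T (n + k) p q x * upWord (n + k) p q a r = T (n + k) p q y ∧
      ∀ b : ℤ, 1 ≤ b → entry (y : signedPerm (n + k)) b =
        if a ≤ b ∧ b < a + r then β else if b = a + r then α
        else entry (x : signedPerm (n + k)) b := by
  induction r with
  | zero =>
    refine ⟨x, by rw [upWord_zero, mul_one], fun b hb => ?_⟩
    split_ifs with e1 e2
    · push_cast at e1; omega
    · rw [e2, ← h1]; simp
    · rfl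
  | succ r ih =>
    push_cast at h2
    obtain ⟨y, hy, he⟩ := ih (by omega) (fun b hb hb' => h2 b hb (by omega))
    have e1 : entry (y : signedPerm (n + k)) ((a + r : ℕ) : ℤ) = α := by
      rw [he _ (by push_cast; omega), if_neg (by push_cast; omega), if_pos (by push_cast; rfl)]
    have e2 : entry (y : signedPerm (n + k)) ((a + r : ℕ) + 1 : ℤ) = β := by
      rw [he _ (by push_cast; omega), if_neg (by push_cast; omega), if_neg (by push_cast; omega),
        h2 _ (by push_cast; omega) (by push_cast; omega)]
    obtain ⟨s1, s2⟩ := T_mul_natGen (p := p) (q := q) (x := y) (a := a + r) (by omega) (by omega)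
      (by rw [e1, e2]; exact hαβ)
    refine ⟨_, by rw [upWord_succ, ← mul_assoc, hy, s1], fun b hb => ?_⟩
    rw [s2 b hb, e1, e2, he b hb]
    push_cast
    split_ifs <;> first | rfl | omega

theorem T_mul_downWord {x : X n k} {a r : ℕ} {α β : ℤ} (ha : 1 ≤ a) (har : a + r ≤ n + k)
    (h1 : entry (x : signedPerm (n + k)) (a + r) = β)
    (h2 : ∀ b : ℤ, a ≤ b → b < a + r → entry (x : signedPerm (n + k)) b = α) (hαβ : α < β) :
    ∃ y : X n k, T (n + k) p q x * downWord (n + k) p q a r = T (n + k) p q y ∧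
      ∀ b : ℤ, 1 ≤ b → entry (y : signedPerm (n + k)) b =
        if b = a then β else if a < b ∧ b ≤ a + r then α
        else entry (x : signedPerm (n + k)) b := by
  induction r generalizing x with
  | zero =>
    refine ⟨x, by rw [downWord_zero, mul_one], fun b hb => ?_⟩
    split_ifs with e1 e2
    · rw [e1, ← h1]; simp
    · push_cast at e2; omega
    · rfl
  | succ r ih =>
    push_cast at h1 h2
    have e1 : entry (x : signedPerm (n + k)) ((a + r : ℕ) : ℤ) = α :=
      h2 _ (by push_cast; omega) (by push_cast; omega)
    have e2 : entry (x : signedPerm (n + k)) ((a + r : ℕ) + 1 : ℤ) = β := by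
      rw [← h1]; push_cast; rw [add_assoc]
    obtain ⟨s1, s2⟩ := T_mul_natGen (p := p) (q := q) (x := x) (a := a + r) (by omega) (by omega)
      (by rw [e1, e2]; exact hαβ)
    obtain ⟨y, hy, he⟩ := ih (x := shift ⟨a + r, by omega⟩ x) (by omega)
      (by rw [s2 _ (by omega), if_pos (by push_cast; rfl), e2])
      (fun b hb hb' => by
        rw [s2 _ (by omega), if_neg (by push_cast; omega), if_neg (by push_cast; omega)]
        exact h2 b hb (by omega))
    refine ⟨y, by rw [downWord_succ, ← mul_assoc, s1, hy], fun b hb => ?_⟩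
    rw [he b hb, s2 b hb, e1, e2]
    push_cast
    split_ifs <;> first | rfl | omega

/-- `t` turns the leading `1` into `-1`, which is carried to the right past the remaining `m - 1`
entries `1`; this is repeated with one `1` fewer. -/
theorem T_mul_flipWord {x : X n k} {m : ℕ} (hm : m ≤ k)
    (h1 : ∀ b : ℤ, 1 ≤ b → b ≤ m → entry (x : signedPerm (n + k)) b = 1)
    (h2 : ∀ b : ℤ, m < b → b ≤ k → entry (x : signedPerm (n + k)) b = -1) :
    ∃ y : X n k, T (n + k) p q x * flipWord (n + k) p q m = T (n + k) p q y ∧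
      ∀ b : ℤ, 1 ≤ b → entry (y : signedPerm (n + k)) b =
        if b ≤ k then -1 else entry (x : signedPerm (n + k)) b := by
  induction m generalizing x with
  | zero =>
    refine ⟨x, by rw [flipWord, mul_one], fun b hb => ?_⟩
    split_ifs with e
    · exact h2 b (by push_cast; omega) e
    · rfl
  | succ m ih =>
    push_cast at h1 h2
    have hN : 0 < n + k := by omega
    have e1 := h1 1 le_rfl (by omega)
    have h' : entry (x : signedPerm (n + k)) (rootLo (⟨0, hN⟩ : Fin (n + k))) <
        entry (x : signedPerm (n + k)) ((⟨0, hN⟩ : Fin (n + k)) + 1) := by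
      simp only [rootLo, if_true, Nat.cast_zero, zero_add, entry_neg, e1]; omega
    have hs := shift_coe h'.ne
    have s1 : T (n + k) p q x * natGen (n + k) p q 0 = T (n + k) p q (shift ⟨0, hN⟩ x) := by
      rw [natGen_of_lt hN, T_mul_gen (lt_of_entry_lt h'), hs]
    have s2 : ∀ b : ℤ, 1 ≤ b → entry (shift ⟨0, hN⟩ x : signedPerm (n + k)) b =
        if b = 1 then -1 else entry (x : signedPerm (n + k)) b := by
      intro b hb
      rw [hs, entry_mul]
      split_ifs with e
      · rw [e, simplePerm_zero_one, entry_neg, e1]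
      · rw [simplePerm_of_lt (by push_cast; omega)]
    obtain ⟨y, hy, he⟩ := T_mul_upWord (p := p) (q := q) (x := shift ⟨0, hN⟩ x) (a := 1) (r := m)
      (α := -1) (β := 1) le_rfl (by omega) (by rw [s2 _ (by simp), if_pos (by simp)])
      (fun b hb hb' => by
        push_cast at hb hb'
        rw [s2 b (by omega), if_neg (by omega), h1 b (by omega) (by omega)]) (by omega)
    obtain ⟨z, hz, hze⟩ := ih (x := y) (by omega)
      (fun b hb hb' => by
        rw [he b hb]
        push_cast
        rw [if_pos (by omega)])
      (fun b hb hb' => by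
        rw [he b (by omega), s2 b (by omega)]
        push_cast
        split_ifs <;> first | omega | (apply h2 <;> omega))
    refine ⟨z, ?_, fun b hb => ?_⟩
    · rw [flipWord_succ, upWord_succ', mul_assoc, ← mul_assoc, s1, ← mul_assoc, hy, hz]
    · rw [hze b hb]
      split_ifs with e
      · rfl
      · rw [he b hb, s2 b hb]
        push_cast
        split_ifs <;> omega

/-- The representative `x` has entries of class `c` at the positions `j + 1, …, j + k`, and of
class `0` elsewhere. -/
def IsBlock (c : ℤ) (j : ℕ) (x : X n k) : Prop :=
  ∀ b : ℤ, 1 ≤ b → b ≤ n + k →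
    entry (x : signedPerm (n + k)) b = if j < b ∧ b ≤ j + k then c else 0

theorem IsBlock.mid {c : ℤ} {j : ℕ} {x : X n k} (h : IsBlock c j x) (hj : j ≤ n) {b : ℤ}
    (h1 : j < b) (h2 : b ≤ j + k) : entry (x : signedPerm (n + k)) b = c := by
  rw [h b (by omega) (by omega), if_pos ⟨h1, h2⟩]

theorem IsBlock.out {c : ℤ} {j : ℕ} {x : X n k} (h : IsBlock c j x) {b : ℤ}
    (h0 : 1 ≤ b) (hN : b ≤ n + k) (h1 : ¬ (j < b ∧ b ≤ j + k)) :
    entry (x : signedPerm (n + k)) b = 0 := by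
  rw [h b h0 hN, if_neg h1]

theorem IsBlock.eq {c : ℤ} {j : ℕ} {x y : X n k} (hx : IsBlock c j x) (hy : IsBlock c j y) :
    x = y :=
  Subtype.ext (eq_of_entry_eq x.2 y.2 fun b h1 h2 => (hx b h1 h2).trans (hy b h1 h2).symm)

/-- The `0` in front of the block is carried to the right over entries `1`, the signs of the shifted
block are changed, and the `0` returns to the left over entries `-1`. All moves are ascents. -/
theorem T_mul_longWord {x : X n k} {j : ℕ} (hj : j ≤ n) (hx : IsBlock 1 j x) :
    ∃ y : X n k, T (n + k) p q x * longWord (n + k) p q k j = T (n + k) p q y ∧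
      IsBlock (-1) j y := by
  induction j generalizing x with
  | zero =>
    obtain ⟨y, hy, he⟩ := T_mul_flipWord (p := p) (q := q) (x := x) le_rfl
      (fun b h1 h2 => hx.mid hj (by push_cast; omega) (by push_cast; omega))
      (fun b h1 h2 => by omega)
    refine ⟨y, hy, fun b h1 h2 => ?_⟩
    rw [he b h1]
    push_cast
    by_cases e : b ≤ k
    · rw [if_pos e, if_pos (by omega)]
    · rw [if_neg e, if_neg (by omega), hx.out h1 h2 (by push_cast; omega)]
  | succ j ih =>
    obtain ⟨y, hy, he⟩ := T_mul_upWord (p := p) (q := q) (x := x) (a := j + 1) (r := k)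
      (α := 0) (β := 1) (by omega) (by omega)
      (hx.out (by push_cast; omega) (by push_cast; omega) (by omega))
      (fun b h1 h2 => hx.mid hj h1 h2) (by omega)
    obtain ⟨z, hz, hze⟩ := ih (x := y) (by omega) (fun b h1 h2 => by
      rw [he b h1]
      push_cast
      split_ifs <;> first | rfl | omega | exact hx.out h1 h2 (by push_cast; omega))
    obtain ⟨w, hw, hwe⟩ := T_mul_downWord (p := p) (q := q) (x := z) (a := j + 1) (r := k)
      (α := -1) (β := 0) (by omega) (by omega)
      (hze.out (by push_cast; omega) (by push_cast; omega) (by push_cast; omega))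
      (fun b h1 h2 => hze.mid (by omega) (by push_cast at h1; omega) (by push_cast at h2; omega))
      (by omega)
    refine ⟨w, ?_, fun b h1 h2 => ?_⟩
    · rw [longWord_succ, ← mul_assoc, hy, ← mul_assoc, hz, hw]
    · rw [hwe b h1]
      by_cases e1 : b = (j + 1 : ℕ)
      · rw [if_pos e1, if_neg (by omega)]
      · rw [if_neg e1]
        by_cases e2 : ((j + 1 : ℕ) : ℤ) < b ∧ b ≤ (j + 1 : ℕ) + k
        · rw [if_pos e2, if_pos e2]
        · rw [if_neg e2, if_neg e2]
          exact hze.out h1 h2 (by push_cast at e1 e2 ⊢; omega)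

theorem isBlock_oneRep : IsBlock 1 n (oneRep n k) := by
  intro b h1 h2
  change cls n b = _
  have := cls_cases n b
  split_ifs <;> omega

theorem isBlock_longestRep : IsBlock (-1) n (longestRep n k) := by
  intro b h1 h2
  rw [entry_longestRep h1 h2]
  split_ifs <;> omega

theorem T_longestRep : T (n + k) p q (longestRep n k) = longWord (n + k) p q k n := by
  obtain ⟨y, hy, hb⟩ := T_mul_longWord (p := p) (q := q) le_rfl (isBlock_oneRep (n := n) (k := k))
  rw [isBlock_longestRep.eq hb, ← hy, oneRep, T_one, one_mul]

end TypeBHecke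
end

noncomputable section

namespace TypeBHecke

/-! ### The coefficient of the longest representative -/

variable {n k : ℕ} {p q : ℂ} {A : Type*} [Ring A] [Algebra ℂ A] (f : HeckeBS n k p q →ₐ[ℂ] A)

theorem paramB_mk {a : ℕ} (ha : 1 ≤ a) (haN : a < n + k) :
    paramB (n + k) p q ⟨a, haN⟩ = q := by
  rw [paramB, if_neg (by simp only; omega)]

theorem act_natGen_of_lt {x : X n k} {a : ℕ} (ha : 1 ≤ a) (haN : a < n + k) (v : X n k → A)
    (h : entry (x : signedPerm (n + k)) a < entry (x : signedPerm (n + k)) (a + 1)) :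
    act f v (natGen (n + k) p q a) x = q • v (shift ⟨a, haN⟩ x) := by
  rw [natGen_of_lt haN, act_gen, actGen_apply_lt, paramB_mk ha]
  simpa only [rootLo_of_pos ha] using h

theorem act_natGen_of_gt {x : X n k} {a : ℕ} (ha : 1 ≤ a) (haN : a < n + k) (v : X n k → A)
    (h : entry (x : signedPerm (n + k)) (a + 1) < entry (x : signedPerm (n + k)) a) :
    act f v (natGen (n + k) p q a) x = v (shift ⟨a, haN⟩ x) + (1 - q) • v x := by
  rw [natGen_of_lt haN, act_gen, actGen_apply_gt, paramB_mk ha]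
  simpa only [rootLo_of_pos ha] using h

theorem entry_shift_of_ne {x : X n k} {a : ℕ} (ha : 1 ≤ a) (haN : a < n + k)
    (h : entry (x : signedPerm (n + k)) a ≠ entry (x : signedPerm (n + k)) (a + 1)) {b : ℤ}
    (hb : 1 ≤ b) : entry (shift ⟨a, haN⟩ x : signedPerm (n + k)) b =
      if b = a then entry (x : signedPerm (n + k)) (a + 1) else
      if b = a + 1 then entry (x : signedPerm (n + k)) a
      else entry (x : signedPerm (n + k)) b :=
  entry_mul_of_pos ha haN (shift_coe (by simpa only [rootLo_of_pos ha] using h)) hb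

/-- The generators of the factor `S_k` act trivially through `f`. -/
def TrivOnS (f : HeckeBS n k p q →ₐ[ℂ] A) : Prop :=
  ∀ (j : Fin (n + k)) (hj : (j : ℕ) ≠ n), n < (j : ℕ) → parGen f j hj = 1

variable {f}

/-- Entries of class `-1` are values below `-n`, so the conjugated reflection moves only integers of
absolute value above `n` and belongs to `S_k`. -/
theorem exists_conj_of_neg {x : X n k} {a : ℕ} (ha : 1 ≤ a) (haN : a < n + k)
    (h1 : entry (x : signedPerm (n + k)) a = -1)
    (h2 : entry (x : signedPerm (n + k)) (a + 1) = -1) :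
    ∃ j : Fin (n + k), n < (j : ℕ) ∧
      (x : signedPerm (n + k)) * simpleRefl (n + k) ⟨a, haN⟩ = simpleRefl (n + k) j * x := by
  obtain ⟨j, hj, hr⟩ := exists_root_of_entry_eq (i := ⟨a, haN⟩) x.2
    (by simp only [rootLo_of_pos ha, h1, h2])
  refine ⟨j, ?_, mul_simpleRefl_eq_of_root hr⟩
  simp only [rootLo_of_pos ha] at hr
  have c1 := cls_cases n (x.1.1 a)
  have c2 := cls_cases n (x.1.1 (a + 1))
  rw [entry] at h1 h2
  have : rootLo j = j ∨ rootLo j = -1 := by unfold rootLo; split_ifs <;> simp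
  omega

theorem TrivOnS.act_natGen (hf : TrivOnS f) {x : X n k} {a : ℕ} (ha : 1 ≤ a) (haN : a < n + k)
    (h1 : entry (x : signedPerm (n + k)) a = -1)
    (h2 : entry (x : signedPerm (n + k)) (a + 1) = -1) (v : X n k → A) :
    act f v (natGen (n + k) p q a) x = v x := by
  obtain ⟨j, hj, hc⟩ := exists_conj_of_neg ha haN h1 h2
  rw [natGen_of_lt haN, act_gen, actGen_apply_eq f v (entry_eq_of_conj (Nat.ne_of_gt hj) hc),
    twist_eq f (Nat.ne_of_gt hj) hc, hf j _ hj, mul_one]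

theorem TrivOnS.act_natGen_basisVec (hf : TrivOnS f) {x : X n k} {a : ℕ} (ha : 1 ≤ a)
    (haN : a < n + k) (h1 : entry (x : signedPerm (n + k)) a = -1)
    (h2 : entry (x : signedPerm (n + k)) (a + 1) = -1) :
    act f (basisVec A x) (natGen (n + k) p q a) = basisVec A x := by
  obtain ⟨j, hj, hc⟩ := exists_conj_of_neg ha haN h1 h2
  rw [natGen_of_lt haN, act_gen, actGen_basisVec_eq f (Nat.ne_of_gt hj) hc, hf j _ hj, one_smul]

theorem TrivOnS.act_upWord_basisVec (hf : TrivOnS f) {x : X n k} {a r : ℕ} (ha : 1 ≤ a)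
    (har : a + r ≤ n + k)
    (h : ∀ b : ℤ, a ≤ b → b ≤ a + r → entry (x : signedPerm (n + k)) b = -1) :
    act f (basisVec A x) (upWord (n + k) p q a r) = basisVec A x := by
  induction r with
  | zero => rw [upWord_zero, act_one]
  | succ r ih =>
    push_cast at h
    rw [upWord_succ, act_mul, ih (by omega) (fun b hb hb' => h b hb (by omega)),
      hf.act_natGen_basisVec (by omega) (by omega) (h _ (by push_cast; omega) (by push_cast; omega))
        (h _ (by push_cast; omega) (by push_cast; omega))]

/-- Moving an entry to the right past a block of entries `-1`, as seen by a functional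
`v ↦ (v h)(z)` that is invariant under most of the generators of the block. -/
theorem TrivOnS.act_upWord_of_invariant (hf : TrivOnS f) {x z : X n k} {a r : ℕ}
    {h : HeckeB (n + k) p q} (ha : 1 ≤ a) (har : a + r ≤ n + k)
    (h1 : -1 < entry (x : signedPerm (n + k)) a)
    (h2 : ∀ b : ℤ, a < b → b ≤ a + r → entry (x : signedPerm (n + k)) b = -1)
    (hinv : ∀ (v : X n k → A) (i : ℕ), a ≤ i → i + 1 < a + r →
      act f v (natGen (n + k) p q i * h) z = act f v h z) :
    ∃ y : X n k, (∀ b : ℤ, 1 ≤ b → entry (y : signedPerm (n + k)) b =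
        if a ≤ b ∧ b < a + r then -1 else if b = a + r then entry (x : signedPerm (n + k)) a
        else entry (x : signedPerm (n + k)) b) ∧
      act f (basisVec A y) (downWord (n + k) p q a r) = basisVec A x ∧
      act f (basisVec A x) (upWord (n + k) p q a r * h) z =
        q ^ r • act f (basisVec A y) h z + (1 - q ^ r) • act f (basisVec A x) h z := by
  induction r generalizing h with
  | zero =>
    refine ⟨x, fun b hb => ?_, ?_, ?_⟩
    · split_ifs with e1 e2
      · push_cast at e1; omega
      · rw [e2]; simp
      · rfl
    · rw [downWord_zero, act_one]
    · rw [upWord_zero, one_mul, pow_zero, one_smul, sub_self, zero_smul, add_zero]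
  | succ r ih =>
    push_cast at h2
    -- The last letter of the word is moved into `h`; invariance survives for the smaller range
    -- because those generators commute with `T_{a+r}`.
    obtain ⟨y, he, hd, hφ⟩ := ih (h := natGen (n + k) p q (a + r) * h) (by omega)
      (fun b hb hb' => h2 b hb (by omega)) (fun v i hi hi' => by
        rw [← mul_assoc, natGen_comm (by omega) (by omega), mul_assoc, act_mul,
          hinv _ i hi (by omega), ← act_mul])
    have hN : a + r < n + k := by omega
    have e1 : entry (y : signedPerm (n + k)) ((a + r : ℕ) : ℤ) =
        entry (x : signedPerm (n + k)) a := by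
      rw [he _ (by push_cast; omega), if_neg (by push_cast; omega), if_pos (by push_cast; rfl)]
    have e2 : entry (y : signedPerm (n + k)) ((a + r : ℕ) + 1 : ℤ) = -1 := by
      rw [he _ (by push_cast; omega), if_neg (by push_cast; omega), if_neg (by push_cast; omega),
        h2 _ (by push_cast; omega) (by push_cast; omega)]
    have hgt : entry (y : signedPerm (n + k)) ((⟨a + r, hN⟩ : Fin (n + k)) + 1 : ℤ) <
        entry (y : signedPerm (n + k)) (rootLo (⟨a + r, hN⟩ : Fin (n + k))) := by
      simp only [rootLo_of_pos (show 1 ≤ a + r by omega), e1, e2]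
      exact h1
    obtain ⟨g1, g2⟩ := actGen_basisVec_gt f hgt (shift_coe hgt.ne')
    rw [← act_gen, ← natGen_of_lt hN] at g1 g2
    rw [paramB_mk (by omega)] at g2
    have hs := fun {b : ℤ} (hb : 1 ≤ b) => entry_shift_of_ne (x := y) (a := a + r) (by omega) hN
      (by rw [e1, e2]; exact h1.ne') hb
    -- By invariance the functional ignores the word that brings the entry back. As that word
    -- carries `e_y` to `e_x`, the functional takes equal values on both, so the error terms
    -- combine.
    have hdown : ∀ (s : ℕ) (v : X n k → A), s ≤ r →
        act f v (downWord (n + k) p q a s * h) z = act f v h z := by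
      intro s
      induction s with
      | zero => intro v _; rw [downWord_zero, one_mul]
      | succ s ihs =>
        intro v hs
        rw [downWord_succ, mul_assoc, act_mul, ihs _ (by omega), ← act_mul,
          hinv _ _ (by omega) (by omega)]
    have hy : act f (basisVec A y) h z = act f (basisVec A x) h z := by
      rw [← hdown r _ le_rfl, act_mul, hd]
    refine ⟨shift ⟨a + r, hN⟩ y, fun b hb => ?_, ?_, ?_⟩
    · rw [hs hb, e1, e2, he b hb]
      push_cast
      split_ifs <;> first | rfl | omega
    · rw [downWord_succ, act_mul, g1, hd]
    -- For `r > 0` the positions `a + r` and `a + r + 1` of `x` both carry `-1`, so `T_{a+r}` fixes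
    -- `e_x`; for `r = 0` they do not, but the factor `1 - q^r` vanishes.
    · have hx : (1 - q ^ r) • act f (basisVec A x) (natGen (n + k) p q (a + r) * h) z =
          (1 - q ^ r) • act f (basisVec A x) h z := by
        by_cases hr : r = 0
        · rw [hr, pow_zero, sub_self, zero_smul, zero_smul]
        · rw [act_mul, hf.act_natGen_basisVec (by omega) hN
            (h2 _ (by push_cast; omega) (by push_cast; omega))
            (h2 _ (by push_cast; omega) (by push_cast; omega))]
      rw [upWord_succ, mul_assoc, hφ, hx, act_mul, g2, add_act, complex_smul_act,
        complex_smul_act, Pi.add_apply, Pi.smul_apply, Pi.smul_apply, hy]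
      module

/-- The coefficient of a vector after moving an entry `0` to the left past a block of `-1`. -/
theorem TrivOnS.act_downWord_apply (hf : TrivOnS f) {x y : X n k} {a r : ℕ} {v : X n k → A}
    (ha : 1 ≤ a) (har : a + r ≤ n + k) (h1 : entry (x : signedPerm (n + k)) a = 0)
    (hy : ∀ b : ℤ, 1 ≤ b → b ≤ n + k → entry (y : signedPerm (n + k)) b =
        if a ≤ b ∧ b < a + r then -1 else if b = a + r then 0
        else entry (x : signedPerm (n + k)) b)
    (h2 : ∀ b : ℤ, a < b → b ≤ a + r → entry (x : signedPerm (n + k)) b = -1)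
    (hv : ∀ z : X n k, entry (z : signedPerm (n + k)) (a + r) = -1 → v z = 0) :
    act f v (downWord (n + k) p q a r) x = v y := by
  induction r generalizing v y with
  | zero =>
    have : x = y := by
      refine Subtype.ext (eq_of_entry_eq x.2 y.2 fun b hb hb' => ?_)
      rw [hy b hb hb']
      split_ifs with e1 e2
      · push_cast at e1; omega
      · rw [e2, ← h1]; simp
      · rfl
    rw [downWord_zero, act_one, this]
  | succ r ih =>
    push_cast at h2 hy hv
    have hN : a + r < n + k := by omega
    have e1 : entry (y : signedPerm (n + k)) ((a + r : ℕ) : ℤ) = -1 := by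
      rw [hy _ (by push_cast; omega) (by push_cast; omega), if_pos (by push_cast; omega)]
    have e2 : entry (y : signedPerm (n + k)) ((a + r : ℕ) + 1 : ℤ) = 0 := by
      rw [hy _ (by push_cast; omega) (by push_cast; omega), if_neg (by push_cast; omega),
        if_pos (by push_cast; ring)]
    have hne : entry (y : signedPerm (n + k)) ((a + r : ℕ) : ℤ) ≠
        entry (y : signedPerm (n + k)) ((a + r : ℕ) + 1 : ℤ) := by rw [e1, e2]; omega
    have hs := fun {b : ℤ} (hb : 1 ≤ b) =>
      entry_shift_of_ne (x := y) (a := a + r) (by omega) hN hne hb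
    -- Of the two terms contributing to the coordinate at `y s_{a+r}`, the one with factor `1 - q`
    -- vanishes: that pattern has `-1` at position `a + r + 1`.
    rw [downWord_succ, act_mul, ih (y := shift ⟨a + r, hN⟩ y) (by omega) ?_
      (fun b hb hb' => h2 b hb (by omega)) ?_, act_natGen_of_gt f (by omega) hN, shift_shift,
      hv (shift ⟨a + r, hN⟩ y), smul_zero, add_zero]
    · rw [hs (by omega), if_neg (by push_cast; omega), if_pos (by push_cast; ring), e1]
    · simpa only [rootLo_of_pos (show 1 ≤ a + r by omega)] using hne
    · rw [hs (by push_cast; omega), hs (by push_cast; omega), if_pos rfl, if_neg (by omega),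
        if_pos rfl, e1, e2]
      omega
    · intro b hb hb'
      rw [hs hb, e1, e2, hy b hb hb']
      push_cast
      split_ifs <;> first | rfl | omega | (rw [h2] <;> omega)
    -- If `z` has `-1` at position `a + r`, the coordinate of `v T_{a+r}` at `z` involves `v` only
    -- at a pattern with `-1` at position `a + r + 1`, where `v` vanishes.
    · intro z hz
      have hz' : entry (z : signedPerm (n + k)) ((a + r : ℕ) : ℤ) = -1 := by
        rw [← hz]; push_cast; rfl
      rcases lt_trichotomy (entry (z : signedPerm (n + k)) ((a + r : ℕ) : ℤ))
        (entry (z : signedPerm (n + k)) ((a + r : ℕ) + 1 : ℤ)) with h | h | h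
      · rw [act_natGen_of_lt f (by omega) hN _ h, hv, smul_zero]
        rw [entry_shift_of_ne (by omega) hN h.ne (by omega), if_neg (by push_cast; omega),
          if_pos (by push_cast; ring), hz']
      · rw [hf.act_natGen (by omega) hN hz' (by rw [← h, hz']), hv]
        rw [← hz', h]; push_cast; rw [add_assoc]
      · have := entry_cases z.1 ((a + r : ℕ) + 1 : ℤ)
        omega

variable (f) in
/-- The action of `h` preserves the vectors supported on the representatives with a given entry at
the position `r`. -/
def PreservesEntry (r : ℤ) (h : HeckeB (n + k) p q) : Prop :=
  ∀ (c : ℤ) (v : X n k → A), (∀ z : X n k, entry (z : signedPerm (n + k)) r ≠ c → v z = 0) →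
    ∀ z : X n k, entry (z : signedPerm (n + k)) r ≠ c → act f v h z = 0

theorem PreservesEntry.one (r : ℤ) : PreservesEntry f r 1 := by
  intro c v hv z hz
  rw [act_one]; exact hv z hz

theorem PreservesEntry.mul {r : ℤ} {h h' : HeckeB (n + k) p q} (H : PreservesEntry f r h)
    (H' : PreservesEntry f r h') : PreservesEntry f r (h * h') := by
  intro c v hv z hz
  rw [act_mul]
  exact H' c _ (H c v hv) z hz

theorem PreservesEntry.natGen {r : ℤ} {i : ℕ} (hi : (i : ℤ) + 1 < r) :
    PreservesEntry f r (natGen (n + k) p q i) := by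
  by_cases hN : i < n + k
  · intro c v hv z hz
    rw [natGen_of_lt hN, act_gen]
    have hs : entry (shift ⟨i, hN⟩ z : signedPerm (n + k)) r =
        entry (z : signedPerm (n + k)) r := by
      unfold shift
      split_ifs
      · change entry ((z : signedPerm (n + k)) * simpleRefl (n + k) ⟨i, hN⟩) r = _
        rw [entry_mul, simplePerm_of_lt (by exact hi)]
      · rfl
    have hvs := hv (shift ⟨i, hN⟩ z) (by rwa [hs])
    rcases lt_trichotomy (entry (z : signedPerm (n + k)) (rootLo (⟨i, hN⟩ : Fin (n + k))))
      (entry (z : signedPerm (n + k)) ((⟨i, hN⟩ : Fin (n + k)) + 1)) with h | h | h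
    · rw [actGen_apply_lt f _ h, hvs, smul_zero]
    · rw [actGen_apply_eq f _ h, hv z hz, zero_mul]
    · rw [actGen_apply_gt f _ h, hvs, hv z hz, smul_zero, add_zero]
  · rw [TypeBHecke.natGen, dif_neg hN]
    exact .one r

theorem PreservesEntry.upWord {r : ℤ} {a s : ℕ} (h : (a : ℤ) + s < r) :
    PreservesEntry f r (upWord (n + k) p q a s) := by
  induction s with
  | zero => exact .one r
  | succ s ih =>
    push_cast at h
    exact (ih (by omega)).mul (.natGen (by push_cast; omega))

theorem PreservesEntry.downWord {r : ℤ} {a s : ℕ} (h : (a : ℤ) + s < r) :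
    PreservesEntry f r (downWord (n + k) p q a s) := by
  induction s with
  | zero => exact .one r
  | succ s ih =>
    push_cast at h
    exact PreservesEntry.mul (.natGen (by push_cast; omega)) (ih (by omega))

theorem PreservesEntry.flipWord {r : ℤ} {m : ℕ} (h : (m : ℤ) < r) :
    PreservesEntry f r (flipWord (n + k) p q m) := by
  induction m with
  | zero => exact .one r
  | succ m ih =>
    push_cast at h
    exact PreservesEntry.mul (.upWord (by push_cast; omega)) (ih (by omega))

theorem PreservesEntry.longWord {r : ℤ} {l j : ℕ} (h : (j : ℤ) + l < r) :
    PreservesEntry f r (longWord (n + k) p q l j) := by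
  induction j with
  | zero => exact .flipWord (by push_cast at h; omega)
  | succ j ih =>
    push_cast at h
    exact PreservesEntry.mul (.upWord (by push_cast; omega))
      (PreservesEntry.mul (ih (by omega)) (.downWord (by push_cast; omega)))

theorem PreservesEntry.act_basisVec {r : ℤ} {h : HeckeB (n + k) p q} (H : PreservesEntry f r h)
    {x z : X n k} (hz : entry (z : signedPerm (n + k)) r ≠ entry (x : signedPerm (n + k)) r) :
    act f (basisVec A x) h z = 0 := by
  refine H _ _ (fun y hy => basisVec_of_ne ?_) z hz
  rintro rfl
  exact hy rfl

/-- The Rogers–Szegő polynomials at `-p`, by their three-term recursion. -/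
def rogersSzego (p q : ℂ) : ℕ → ℂ
  | 0 => 1
  | 1 => 1 - p
  | m + 2 => (1 - p) * rogersSzego p q (m + 1) + p * (1 - q ^ (m + 1)) * rogersSzego p q m

/-- The leading `T_0` splits `e_x` into `(1 - p) e_x + p e_y`, where `y` has its first entry flipped
to `1`. On `e_x` the remaining up-word is trivial, which gives the term of order `m + 1`. On `e_y`
the entry `1` is carried past entries `-1`; only the part with factor `1 - q^{m+1}` contributes, and
there the next `T_0` flips the sign back and leaves order `m`. -/
theorem TrivOnS.act_flipWord (hf : TrivOnS f) {x : X n k}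
    (hx : ∀ b : ℤ, 1 ≤ b → b ≤ k → entry (x : signedPerm (n + k)) b = -1) {m : ℕ} (hm : m ≤ k) :
    act f (basisVec A x) (flipWord (n + k) p q m) x = rogersSzego p q m • (1 : A) := by
  by_cases hm0 : m = 0
  · subst hm0
    rw [flipWord, act_one, basisVec_self, rogersSzego, one_smul]
  have hN : 0 < n + k := by omega
  have e1 := hx 1 le_rfl (by omega)
  have hgt : entry (x : signedPerm (n + k)) ((⟨0, hN⟩ : Fin (n + k)) + 1 : ℤ) <
      entry (x : signedPerm (n + k)) (rootLo (⟨0, hN⟩ : Fin (n + k))) := by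
    simp only [rootLo, if_true, Nat.cast_zero, zero_add, entry_neg, e1]; omega
  obtain ⟨g1, g2⟩ := actGen_basisVec_gt f hgt (shift_coe hgt.ne')
  rw [← act_gen, ← natGen_of_lt hN] at g1 g2
  rw [show paramB (n + k) p q ⟨0, hN⟩ = p from if_pos rfl] at g2
  set y := shift ⟨0, hN⟩ x with hy
  have hye : ∀ b : ℤ, 1 ≤ b → entry (y : signedPerm (n + k)) b =
      if b = 1 then 1 else entry (x : signedPerm (n + k)) b := by
    intro b hb
    rw [hy, shift_coe hgt.ne', entry_mul]
    split_ifs with e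
    · rw [e, simplePerm_zero_one, entry_neg, e1, neg_neg]
    · rw [simplePerm_of_lt (by push_cast; omega)]
  have hyx : x ≠ y := by
    intro e
    have := hye 1 le_rfl
    rw [← e, e1, if_pos rfl] at this
    omega
  induction m using Nat.twoStepInduction with
  | zero => omega
  | one =>
    rw [flipWord_succ, flipWord, mul_one, upWord_succ, upWord_zero, one_mul, g2, Pi.add_apply,
      Pi.smul_apply, Pi.smul_apply, basisVec_self, basisVec_of_ne hyx, smul_zero, add_zero]
    rfl
  | more m ih1 ih2 =>
    have hg : act f (basisVec A x) (flipWord (n + k) p q m) x = rogersSzego p q m • (1 : A) := by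
      by_cases h0 : m = 0
      · subst h0
        rw [flipWord, act_one, basisVec_self, rogersSzego, one_smul]
      · exact ih1 (by omega) h0
    have t1 : act f (basisVec A x) (upWord (n + k) p q 1 (m + 1) * flipWord (n + k) p q (m + 1)) x =
        rogersSzego p q (m + 1) • (1 : A) := by
      rw [act_mul, hf.act_upWord_basisVec le_rfl (by omega), ih2 (by omega) (by omega)]
      intro b hb hb'
      push_cast at hb hb'
      exact hx b hb (by omega)
    have t3 : act f (basisVec A y) (flipWord (n + k) p q (m + 1)) x =
        rogersSzego p q m • (1 : A) := by
      rw [flipWord_succ, upWord_succ', mul_assoc, act_mul, g1, act_mul, zero_add,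
        hf.act_upWord_basisVec le_rfl (by omega), hg]
      intro b hb hb'
      push_cast at hb hb'
      exact hx b hb (by omega)
    obtain ⟨w, hw, -, t2⟩ := hf.act_upWord_of_invariant (x := y) (z := x) (a := 1) (r := m + 1)
      (h := flipWord (n + k) p q (m + 1)) le_rfl (by omega)
      (by rw [hye _ (by simp), if_pos (by simp)]; omega)
      (fun b hb hb' => by
        push_cast at hb hb'
        rw [hye b (by omega), if_neg (by omega), hx b (by omega) (by omega)])
      -- `T_i` passes through the flip word as `T_{m+1-i}`, whose two positions both carry `-1` in
      -- `x`.
      (fun v i hi hi' => by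
        obtain ⟨j, hj⟩ : ∃ j, m + 1 = i + j := ⟨m + 1 - i, by omega⟩
        rw [hj, natGen_mul_flipWord hi (by omega) (by omega), act_mul,
          hf.act_natGen (by omega) (by omega) (hx _ (by omega) (by omega))
            (hx _ (by omega) (by omega))])
    have t4 : act f (basisVec A w) (flipWord (n + k) p q (m + 1)) x = 0 := by
      -- The shorter flip word does not touch position `m + 2`, where `w` has the entry `1` and `x`
      -- has `-1`.
      apply PreservesEntry.act_basisVec (r := (m : ℤ) + 2) (.flipWord (by push_cast; omega))
      rw [hw _ (by omega), if_neg (by push_cast; omega), if_pos (by push_cast; ring),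
        hye _ (by simp), if_pos (by simp), hx _ (by omega) (by omega)]
      omega
    rw [t3, t4] at t2
    rw [flipWord_succ, upWord_succ', mul_assoc, act_mul, g2, add_act, complex_smul_act,
      complex_smul_act, Pi.add_apply, Pi.smul_apply, Pi.smul_apply, zero_add, t1, t2, rogersSzego]
    module

/-- Since `q^k = 1`, carrying the `0` over the whole block leaves only the shifted block `y`, and
the down-word turns the coordinate at `y` into the one at `x`. So the coefficient does not depend on
`j`. -/
theorem TrivOnS.act_longWord (hf : TrivOnS f) (hq : q ^ k = 1) {j : ℕ} (hj : j ≤ n) {x : X n k}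
    (hx : IsBlock (-1) j x) :
    act f (basisVec A x) (longWord (n + k) p q k j) x = rogersSzego p q k • (1 : A) := by
  induction j generalizing x with
  | zero =>
    exact hf.act_flipWord (fun b h1 h2 => hx.mid hj (by push_cast; omega) (by push_cast; omega))
      le_rfl
  | succ j ih =>
    have h0 : entry (x : signedPerm (n + k)) ((j + 1 : ℕ) : ℤ) = 0 :=
      hx.out (by push_cast; omega) (by push_cast; omega) (by omega)
    obtain ⟨y, hy, -, t⟩ := hf.act_upWord_of_invariant (x := x) (z := x) (a := j + 1) (r := k)
      (h := longWord (n + k) p q k j * downWord (n + k) p q (j + 1) k) (by omega) (by omega)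
      (by rw [h0]; omega) (fun b hb hb' => hx.mid hj hb hb')
      (fun v i hi hi' => by
        obtain ⟨i', hi''⟩ : ∃ i', i + i' = 2 * j + k := ⟨2 * j + k - i, by omega⟩
        rw [← mul_assoc, natGen_mul_longWord (i' := i') (by omega) (by omega) hi'' (by omega),
          mul_assoc, natGen_mul_downWord (by omega) (by omega) (by omega) (by omega), ← mul_assoc,
          act_mul, hf.act_natGen (by omega) (by omega)
            (hx.mid hj (by push_cast; omega) (by push_cast; omega))
            (hx.mid hj (by push_cast; omega) (by push_cast; omega))])
    have hyb : IsBlock (-1) j y := by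
      intro b h1 h2
      rw [hy b h1, h0]
      push_cast
      split_ifs <;> first | rfl | omega | exact hx.out h1 h2 (by push_cast; omega)
    rw [longWord_succ, t, hq, one_smul, sub_self, zero_smul, add_zero, act_mul,
      hf.act_downWord_apply (y := y) (by omega) (by omega) h0 ?_
        (fun b hb hb' => hx.mid hj hb hb') ?_, ih (by omega) hyb]
    · intro b h1 h2
      rw [hy b h1, h0]
    -- The middle word acts on positions up to `j + k` only, so every pattern that it reaches from
    -- `y` keeps the `0` at position `j + 1 + k`.
    · intro z hz
      apply PreservesEntry.act_basisVec (r := ((j + 1 : ℕ) : ℤ) + k) (.longWord (by push_cast; omega))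
      rw [hz, hyb.out (by push_cast; omega) (by push_cast; omega) (by push_cast; omega)]
      omega

/-! ### Rogers–Szegő polynomials at roots of unity -/

/-- The Gaussian binomial coefficients, by the `q`-Pascal recursion. -/
def qBinom (q : ℂ) : ℕ → ℕ → ℂ
  | _, 0 => 1
  | 0, _ + 1 => 0
  | m + 1, j + 1 => qBinom q m j + q ^ (j + 1) * qBinom q m (j + 1)

theorem qBinom_zero_right (q : ℂ) (m : ℕ) : qBinom q m 0 = 1 := by
  cases m <;> rfl

theorem qBinom_eq_zero {q : ℂ} {m j : ℕ} (h : m < j) : qBinom q m j = 0 := by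
  induction m generalizing j with
  | zero => obtain ⟨j, rfl⟩ : ∃ i, j = i + 1 := ⟨j - 1, by omega⟩; rfl
  | succ m ih =>
    obtain ⟨j, rfl⟩ : ∃ i, j = i + 1 := ⟨j - 1, by omega⟩
    rw [qBinom, ih (by omega), ih (by omega), mul_zero, add_zero]

theorem qBinom_self (q : ℂ) (m : ℕ) : qBinom q m m = 1 := by
  induction m with
  | zero => rfl
  | succ m ih => rw [qBinom, ih, qBinom_eq_zero (by omega), mul_zero, add_zero]

theorem qBinom_succ_succ (q : ℂ) (m j : ℕ) :
    qBinom q (m + 1) (j + 1) = qBinom q m j + q ^ (j + 1) * qBinom q m (j + 1) := rfl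

/-- The `q`-analogue of the absorption identity, in a form without division: it remains valid at
roots of unity, where it forces the inner Gaussian binomials to vanish. -/
theorem qBinom_absorb (q : ℂ) (m j : ℕ) :
    (1 - q ^ (j + 1)) * qBinom q (m + 1) (j + 1) = (1 - q ^ (m + 1)) * qBinom q m j := by
  induction m generalizing j with
  | zero =>
    cases j with
    | zero => simp [qBinom]
    | succ j => simp [qBinom]
  | succ m ih =>
    cases j with
    | zero =>
      have h1 := ih 0
      rw [qBinom_zero_right] at h1
      rw [qBinom_succ_succ q (m + 1) 0, qBinom_zero_right]
      linear_combination q * h1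
    | succ j =>
      have h1 := ih (j + 1)
      have h2 := ih j
      have h3 := qBinom_succ_succ q m j
      rw [qBinom_succ_succ q (m + 1) (j + 1)]
      linear_combination q ^ (j + 2) * h1 + q * h2 - q * (1 - q ^ (m + 1)) * h3

theorem qBinom_three_term (q : ℂ) (m j : ℕ) : qBinom q (m + 2) (j + 1) =
    qBinom q (m + 1) (j + 1) + qBinom q (m + 1) j - (1 - q ^ (m + 1)) * qBinom q m j := by
  rw [qBinom_succ_succ q (m + 1) j]
  linear_combination -qBinom_absorb q m j

/-- The three-term identity for Gaussian binomials, multiplied by `(-p)^{j+1}` and summed over `j`,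
is the defining recursion. -/
theorem rogersSzego_eq (p q : ℂ) (m : ℕ) :
    rogersSzego p q m = ∑ j ∈ Finset.range (m + 1), qBinom q m j * (-p) ^ j := by
  induction m using Nat.twoStepInduction with
  | zero => simp [rogersSzego, qBinom]
  | one => simp [rogersSzego, qBinom, Finset.sum_range_succ, sub_eq_add_neg]
  | more m ih ih' =>
    have e1 : rogersSzego p q m = ∑ j ∈ Finset.range (m + 2), qBinom q m j * (-p) ^ j := by
      rw [Finset.sum_range_succ, ← ih, qBinom_eq_zero (by omega), zero_mul, add_zero]
    have e2 : rogersSzego p q (m + 1) =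
        (∑ j ∈ Finset.range (m + 2), qBinom q (m + 1) (j + 1) * (-p) ^ (j + 1)) + 1 := by
      have := Finset.sum_range_succ' (fun j => qBinom q (m + 1) j * (-p) ^ j) (m + 2)
      rw [Finset.sum_range_succ, ← ih', qBinom_eq_zero (by omega), zero_mul, add_zero] at this
      rw [this, qBinom_zero_right, pow_zero, mul_one]
    have e3 : ∑ j ∈ Finset.range (m + 2), qBinom q (m + 2) (j + 1) * (-p) ^ (j + 1) =
        (∑ j ∈ Finset.range (m + 2), qBinom q (m + 1) (j + 1) * (-p) ^ (j + 1))
          - p * (∑ j ∈ Finset.range (m + 2), qBinom q (m + 1) j * (-p) ^ j)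
          + p * (1 - q ^ (m + 1)) * ∑ j ∈ Finset.range (m + 2), qBinom q m j * (-p) ^ j := by
      rw [Finset.mul_sum, Finset.mul_sum, ← Finset.sum_sub_distrib, ← Finset.sum_add_distrib]
      refine Finset.sum_congr rfl fun j _ => ?_
      rw [qBinom_three_term]
      ring
    rw [Finset.sum_range_succ', e3, qBinom_zero_right, pow_zero, mul_one, ← ih', ← e1, rogersSzego]
    linear_combination e2

/-- For `0 < j < k`, absorption gives `(1 - q^j) [k, j]_q = 0` because `q^k = 1`, while `q^j ≠ 1` by
primitivity. -/
theorem rogersSzego_of_primitive {p q : ℂ} (hk : 1 ≤ k) (hq : IsPrimitiveRoot q k) :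
    rogersSzego p q k = 1 + (-p) ^ k := by
  rw [rogersSzego_eq, Finset.sum_range_succ, qBinom_self, one_mul]
  obtain ⟨m, rfl⟩ : ∃ m, k = m + 1 := ⟨k - 1, by omega⟩
  rw [Finset.sum_range_succ', pow_zero, mul_one, qBinom_zero_right, Finset.sum_eq_zero, zero_add]
  intro j hj
  rw [Finset.mem_range] at hj
  have h := qBinom_absorb q m j
  rw [hq.pow_eq_one, sub_self, zero_mul, mul_eq_zero, sub_eq_zero] at h
  rcases h with h | h
  · exact absurd h.symm (hq.pow_ne_one_of_pos_of_lt (by omega) (by omega))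
  · rw [h, zero_mul]

end TypeBHecke

end

open TypeBHecke
/-- Let `n ≥ 0`, `k ≥ 2`, `p ∈ ℂ` and let `q` be a primitive `k`-th root of unity. There are unique
coefficients `z_x ∈ H_{p,q}(B_n × S_k)` with `T_{w_{n,k}}² = ∑_{x ∈ X_{n,k}} z_x T_x`, and they
satisfy `1_triv ⊗ z_{w_{n,k}} = 1_triv ⊗ (1 + (-p)^k) T_1`. -/
theorem theorem2p6 (n k : ℕ) (hk : 2 ≤ k) (p q : ℂ) (hq : IsPrimitiveRoot q k) :
    ∃ z : X n k → HeckeBS n k p q,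
      (T (n + k) p q (longestRep n k) ^ 2 =
          ∑ x : X n k, inclBS n k p q (z x) * T (n + k) p q x) ∧
      (∀ z' : X n k → HeckeBS n k p q,
        T (n + k) p q (longestRep n k) ^ 2 =
          ∑ x : X n k, inclBS n k p q (z' x) * T (n + k) p q x → z' = z) ∧
      trivTensor n k p q (z (longestRep n k)) =
        trivTensor n k p q ((1 + (-p) ^ k) • (1 : HeckeBS n k p q)) := by
  obtain ⟨z, hz⟩ := exists_coeff (T (n + k) p q (longestRep n k) ^ 2)
  refine ⟨z, hz, fun z' hz' => ?_, ?_⟩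
  · funext x
    -- For `f = id` the induced module reads off the coefficients themselves.
    have h1 := coeff_eq (AlgHom.id ℂ _) hz x
    have h2 := coeff_eq (AlgHom.id ℂ _) hz' x
    exact h2.trans h1.symm
  · have hf : TrivOnS (projS n k p q) := fun j hj h => parGen_projS_of_gt hj h
    -- The first factor `T_w` carries `e_1` to `e_w`; the second is replaced by its explicit word,
    -- and its diagonal coordinate at `w` is evaluated.
    rw [trivTensor_projS, coeff_eq (projS n k p q) hz, pow_two, act_mul, act_T, T_longestRep,
      hf.act_longWord hq.pow_eq_one le_rfl isBlock_longestRep,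
      rogersSzego_of_primitive (by omega) hq]
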